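/- Let $k$ be a field, $Q$ a finite quiver, and $\Lambda=kQ/\mathcal J$ a gentle algebra: $\mathcal J$ is an admissible ideal generated by paths of length $2$; at most two arrows start, and at most two arrows end, at any vertex; and for each arrow $y$ there is at most one arrow $x$ with $t(x)=h(y)$ and $xy\in\mathcal J$, at most one such $x$ with $xy\notin\mathcal J$, at most one arrow $z$ with $h(z)=t(y)$ and $yz\in\mathcal J$, and at most one such $z$ with $yz\notin\mathcal J$. (Here $t$ and $h$ denote tail and head, and $ba$ is the path $a$ followed by $b$.) Let $\mathbf P$ be the set of non-trivial paths not in $\mathcal J$; for $\gamma\in\mathbf P$ let $\mathrm f(\gamma)$ and $\mathrm l(\gamma)$ be its first and last arrow. A generalised $I$-word $[C]$, for $I=\{0,\dots,m\}$, $\mathbb N$, $-\mathbb N$ or $\mathbb Z$, is a sequence of letters $[C_i]$ (one for each $i\in I$ with $i-1\in I$), each of the form $[\gamma]$ or $[\gamma^{-1}]$ with $\gamma\in\mathbf P$, in which any two consecutive letters are of the form $[\gamma][\lambda^{-1}]$ with $h(\gamma)=h(\lambda)$, $\mathrm l(\gamma)\ne \mathrm l(\lambda)$; $[\gamma^{-1}][\lambda^{-1}]$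 with $t(\gamma)=h(\lambda)$, $\mathrm f(\gamma)\mathrm l(\lambda)\in\mathcal J$; $[\gamma^{-1}][\lambda]$ with $t(\gamma)=t(\lambda)$, $\mathrm f(\gamma)\neq \mathrm f(\lambda)$; or $[\gamma][\lambda]$ with $h(\gamma)=t(\lambda)$, $\mathrm f(\lambda)\mathrm l(\gamma)\in\mathcal J$. For $I=\{0\}$ there are instead the trivial words $[1_{v,\pm1}]$, one pair for each vertex $v$. A word is finite if $I$ is finite. Let $v_C(i)$ be the vertex between $[C_i]$ and $[C_{i+1}]$, where $[\gamma]$ leads from $t(\gamma)$ on its left to $h(\gamma)$ on its right and $[\gamma^{-1}]$ from $h(\gamma)$ to $t(\gamma)$; for a trivial word $v_C(0)=v$. Let $\mu_C:I\to\mathbb Z$ be given by $\mu_C(0)=0$ and $\mu_C(i)-\mu_C(i-1)=-1$ if $[C_i]=[\gamma]$, $=1$ if $[C_i]=[\gamma^{-1}]$. The complex $P(C)$ of projective left $\Lambda$-modules has $P^n(C)=\bigoplus_{\mu_C(i)=n}\Lambda e_{v_C(i)}$, with generator $b_i$ of the $i$-th summand, and $d(b_i)=b_i^-+b_i^+$,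 where $b_i^+=\gamma b_{i+1}$ if $[C_{i+1}]=[\gamma^{-1}]$, $b_i^-=\gamma b_{i-1}$ if $[C_i]=[\gamma]$, and $b_i^\pm=0$ otherwise. For a $\mathbb Z$-word, $[C[t]]$ is the $\mathbb Z$-word whose $i$-th letter is $[C_{i+t}]$; for other words $[C[t]]=[C]$. A $\mathbb Z$-word is periodic if $[C]=[C[p]]$ and $\mu_C(p)=0$ for some $p>0$, the least such $p$ being its period; words that are not periodic are aperiodic. A string complex is a complex $P(A)$ with $[A]$ aperiodic. If $[D]$ is periodic of period $p$, then $T$ acts on $P(D)$ by $b_i\mapsto b_{i-p}$, and for an indecomposable $k[T,T^{-1}]$-module $V$ the band complex is $P(D,V)=P(D)\otimes_{k[T,T^{-1}]}V$. Choose signs $s(a),s(a^{-1})\in\{\pm1\}$ for all arrows $a$ such that, with $h(a^{-1})=t(a)$, two distinct symbols with the same head have the same sign if and only if they are of the form $\alpha^{-1},\beta$ with $\alpha\beta\in\mathcal J$. For a finite word $[C]$ let $[C(\swarrow)]=[B][C]$ where $[B]=\dots[\alpha_2][\alpha_1]$ is the longest non-empty (finite or infinite) sequence of arrows for which $[B][C]$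 is a generalised word, and $[C(\swarrow)]=[C]$ if there is no such sequence. Similarly let $[C(\searrow)]=[C][E]$ where $[E]=[\gamma_1^{-1}][\gamma_2^{-1}]\dots$ is the longest non-empty sequence of inverses of arrows for which $[C][E]$ is a generalised word, and $[C(\searrow)]=[C]$ if there is none. Here, for trivial $[C]=[1_{v,\delta}]$, $[B][C]=[B]$ is admitted only if $h(\alpha_1)=v$ and $s(\alpha_1)=\delta$, and $[C][E]=[E]$ only if $h(\gamma_1)=v$ and $s(\gamma_1)=-\delta$. Let $[C(\swarrow\searrow)]=[B][C(\searrow)]$ if $[B]$ exists, and $[C(\searrow)]$ otherwise (if both ends are infinite, the letter of index $1$ is the first one after $[B]$). Let $\mathcal K^{+,b}(\Lambda\text{-}\mathbf{proj})$ be the full subcategory of the homotopy category of complexes of projective $\Lambda$-modules consisting of the objects isomorphic to a left-bounded complex of finitely generated projective $\Lambda$-modules with bounded cohomology. Then: (i) For a generalised word $[A]$, $P(A)$ is a string complex lying in $\mathcal K^{+,b}(\Lambda\text{-}\mathbf{proj})$ if and only if there are a finite generalised word $[C]$ and an integer $t$ such that $[A]=[C'[t]]$ where $[C']$ is one of $[C]$,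 $[C(\swarrow)]$, $[C(\searrow)]$, $[C(\swarrow\searrow)]$. In other words, up to shift, the string complexes in $\mathcal K^{+,b}(\Lambda\text{-}\mathbf{proj})$ are precisely the complexes $P(C)$, $P(C(\swarrow))$, $P(C(\searrow))$ and $P(C(\swarrow\searrow))$ with $[C]$ a finite generalised word. (ii) For a periodic word $[D]$ and an indecomposable $k[T,T^{-1}]$-module $V$, a shift of the band complex $P(D,V)$ lies in $\mathcal K^{+,b}(\Lambda\text{-}\mathbf{proj})$ if and only if $V$ is finite-dimensional over $k$. -/

import Mathlib

universe u

open CategoryTheory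
open scoped LaurentPolynomial TensorProduct

noncomputable section

namespace GentleAlgebra

/-! ### Quivers, paths and the path algebra -/

section PathAlgebra

variable (k : Type u) [Field k] (Q : Type u) [Quiver.{u} Q]

/-- The arrows of the quiver `Q`. -/
abbrev Arrow : Type u := Quiver.Total Q

variable {Q}

/-- The tail `t(a)` of an arrow. -/
abbrev Arrow.tail (a : Arrow Q) : Q := a.left

/-- The head `h(a)` of an arrow. -/
abbrev Arrow.head (a : Arrow Q) : Q := a.right

variable (Q)

/-- A path of `Q` (possibly trivial), with its tail and its head. -/
structure QPath : Type u where
  /-- the vertex where the path starts -/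
  tail : Q
  /-- the vertex where the path ends -/
  head : Q
  /-- the path itself -/
  path : Quiver.Path tail head

variable {Q}

namespace QPath

/-- The number of arrows in a path. -/
def length (p : QPath Q) : ℕ := p.path.length

/-- The trivial path at a vertex. -/
def triv (v : Q) : QPath Q := ⟨v, v, .nil⟩

/-- An arrow as a path of length one. -/
def ofArrow (a : Arrow Q) : QPath Q := ⟨a.tail, a.head, a.hom.toPath⟩

end QPath

/-- The first arrow of the path which traverses `p` and then the arrow `a`. -/
def firstArrowAux {v w : Q} (p : Quiver.Path v w) (a : Arrow Q) : Arrow Q :=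
  match p with
  | .nil => a
  | .cons q e => firstArrowAux q ⟨_, _, e⟩

variable (Q)

/-- A non-trivial path, presented as its last arrow preceded by a (possibly trivial) path. -/
structure NPath : Type u where
  /-- the tail of the path -/
  tail : Q
  /-- the last arrow of the path -/
  last : Arrow Q
  /-- the part of the path before its last arrow -/
  front : Quiver.Path tail last.tail

variable {Q}

namespace NPath

/-- The head of a non-trivial path. -/
def head (γ : NPath Q) : Q := γ.last.head

/-- The first arrow of a non-trivial path. -/
def first (γ : NPath Q) : Arrow Q := firstArrowAux γ.front γ.last

/-- A non-trivial path is a path. -/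
def toQPath (γ : NPath Q) : QPath Q := ⟨γ.tail, γ.head, γ.front.cons γ.last.hom⟩

/-- The length of a non-trivial path. -/
def length (γ : NPath Q) : ℕ := γ.toQPath.length

end NPath

variable (Q)

/-- The path algebra `kQ`: the vector space with basis the paths of `Q`. -/
def PathAlgebra : Type u := QPath Q →₀ k

namespace PathAlgebra

instance : AddCommGroup (PathAlgebra k Q) := inferInstanceAs (AddCommGroup (QPath Q →₀ k))
instance : Module k (PathAlgebra k Q) := inferInstanceAs (Module k (QPath Q →₀ k))

variable {Q}

/-- A path as an element of the path algebra. -/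
def of (p : QPath Q) : PathAlgebra k Q := Finsupp.single p 1

/-- The paths form a basis of the path algebra. -/
def basis : Module.Basis (QPath Q) k (PathAlgebra k Q) :=
  ⟨LinearEquiv.refl k (QPath Q →₀ k)⟩

theorem basis_apply (p : QPath Q) : basis k p = of k p := rfl

open Classical in
/-- The product `p q` of two paths: first `q`, then `p`, if the head of `q` is the tail of `p`, and
zero otherwise. -/
def mulPath (p q : QPath Q) : PathAlgebra k Q :=
  if h : q.head = p.tail then of k ⟨q.tail, p.head, q.path.comp (h ▸ p.path)⟩ else 0

/-- The multiplication of the path algebra: the bilinear extension of the product of paths. -/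
def mulHom : PathAlgebra k Q →ₗ[k] PathAlgebra k Q →ₗ[k] PathAlgebra k Q :=
  (basis k).constr k fun p => (basis k).constr k fun q => mulPath k p q

instance : Mul (PathAlgebra k Q) := ⟨fun x y => mulHom k x y⟩

theorem mul_def (x y : PathAlgebra k Q) : x * y = mulHom k x y := rfl

theorem of_mul_of (p q : QPath Q) : of k p * of k q = mulPath k p q := by
  rw [mul_def, mulHom, ← basis_apply, ← basis_apply, Module.Basis.constr_basis,
    Module.Basis.constr_basis]

@[elab_as_elim]
theorem induction {P : PathAlgebra k Q → Prop} (x : PathAlgebra k Q) (h0 : P 0)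
    (hadd : ∀ x y, P x → P y → P (x + y)) (hof : ∀ (c : k) p, P (c • of k p)) : P x := by
  refine Finsupp.induction_linear x h0 (fun f g hf hg => hadd f g hf hg) fun p c => ?_
  have h : (Finsupp.single p c : QPath Q →₀ k) = c • Finsupp.single p 1 := by simp
  rw [h]
  exact hof c p

theorem of_mul_of_comp {a b c : Q} (p : Quiver.Path b c) (q : Quiver.Path a b) :
    of k ⟨b, c, p⟩ * of k ⟨a, b, q⟩ = of k (⟨a, c, q.comp p⟩ : QPath Q) := by
  rw [of_mul_of]; simp [mulPath]

theorem of_cons {a b c : Q} (p : Quiver.Path a b) (e : b ⟶ c) :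
    of k (⟨a, c, p.cons e⟩ : QPath Q) = of k (QPath.ofArrow ⟨b, c, e⟩) * of k ⟨a, b, p⟩ :=
  (of_mul_of_comp k e.toPath p).symm

theorem of_mul_of_ne {p q : QPath Q} (h : q.head ≠ p.tail) : of k p * of k q = 0 := by
  rw [of_mul_of]; simp [mulPath, h]

protected theorem add_mul (x y z : PathAlgebra k Q) : (x + y) * z = x * z + y * z := by
  simp [mul_def]

protected theorem mul_add (x y z : PathAlgebra k Q) : x * (y + z) = x * y + x * z := by
  simp [mul_def]

protected theorem smul_mul (c : k) (x y : PathAlgebra k Q) : (c • x) * y = c • (x * y) := by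
  simp [mul_def]

protected theorem mul_smul (c : k) (x y : PathAlgebra k Q) : x * (c • y) = c • (x * y) := by
  simp [mul_def]

protected theorem zero_mul (x : PathAlgebra k Q) : 0 * x = 0 := by simp [mul_def]

protected theorem mul_zero (x : PathAlgebra k Q) : x * 0 = 0 := by simp [mul_def]

theorem of_mul_assoc (p q r : QPath Q) :
    of k p * of k q * of k r = of k p * (of k q * of k r) := by
  obtain ⟨a, b, p⟩ := p
  obtain ⟨c, d, q⟩ := q
  obtain ⟨e, f, r⟩ := r
  by_cases h1 : d = a
  · subst h1
    by_cases h2 : f = c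
    · subst h2
      simp only [of_mul_of_comp, Quiver.Path.comp_assoc]
    · rw [of_mul_of_comp, of_mul_of_ne k (p := ⟨c, _, _⟩) h2, of_mul_of_ne k (p := ⟨c, _, _⟩) h2,
        PathAlgebra.mul_zero]
  · rw [of_mul_of_ne k (p := ⟨a, _, _⟩) h1, PathAlgebra.zero_mul]
    by_cases h2 : f = c
    · subst h2
      rw [of_mul_of_comp, of_mul_of_ne k (p := ⟨a, _, _⟩) h1]
    · rw [of_mul_of_ne k (p := ⟨c, _, _⟩) h2, PathAlgebra.mul_zero]

protected theorem mul_assoc (x y z : PathAlgebra k Q) : x * y * z = x * (y * z) := by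
  induction x using induction with
  | h0 => simp [PathAlgebra.zero_mul]
  | hadd x x' hx hx' => simp only [PathAlgebra.add_mul, hx, hx']
  | hof c p =>
    induction y using induction with
    | h0 => simp [PathAlgebra.zero_mul, PathAlgebra.mul_zero]
    | hadd y y' hy hy' => simp only [PathAlgebra.add_mul, PathAlgebra.mul_add, hy, hy']
    | hof d q =>
      induction z using induction with
      | h0 => simp [PathAlgebra.mul_zero]
      | hadd z z' hz hz' => simp only [PathAlgebra.mul_add, hz, hz']
      | hof e r =>
        simp only [PathAlgebra.smul_mul, PathAlgebra.mul_smul, of_mul_assoc]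

variable [Fintype Q]

/-- The unit of the path algebra is the sum of the trivial paths. -/
instance : One (PathAlgebra k Q) := ⟨∑ v : Q, of k (QPath.triv v)⟩

theorem one_def : (1 : PathAlgebra k Q) = ∑ v : Q, of k (QPath.triv v) := rfl

protected theorem one_mul (x : PathAlgebra k Q) : 1 * x = x := by
  induction x using induction with
  | h0 => simp [PathAlgebra.mul_zero]
  | hadd x y hx hy => simp only [PathAlgebra.mul_add, hx, hy]
  | hof c p =>
    rw [PathAlgebra.mul_smul, one_def, mul_def, map_sum, LinearMap.sum_apply]
    congr 1
    obtain ⟨a, b, p⟩ := p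
    rw [Finset.sum_eq_single b]
    · exact (of_mul_of_comp k .nil p).trans (by simp)
    · intro v _ hv
      exact of_mul_of_ne k (Ne.symm hv)
    · simp

protected theorem mul_one (x : PathAlgebra k Q) : x * 1 = x := by
  induction x using induction with
  | h0 => simp [PathAlgebra.zero_mul]
  | hadd x y hx hy => simp only [PathAlgebra.add_mul, hx, hy]
  | hof c p =>
    rw [PathAlgebra.smul_mul, one_def, mul_def, map_sum]
    congr 1
    obtain ⟨a, b, p⟩ := p
    rw [Finset.sum_eq_single a]
    · exact (of_mul_of_comp k p .nil).trans (by simp)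
    · intro v _ hv
      exact of_mul_of_ne k hv
    · simp

instance : Ring (PathAlgebra k Q) :=
  { (inferInstance : AddCommGroup (PathAlgebra k Q)) with
    mul := (· * ·)
    one := 1
    left_distrib := PathAlgebra.mul_add k
    right_distrib := PathAlgebra.add_mul k
    zero_mul := PathAlgebra.zero_mul k
    mul_zero := PathAlgebra.mul_zero k
    mul_assoc := PathAlgebra.mul_assoc k
    one_mul := PathAlgebra.one_mul k
    mul_one := PathAlgebra.mul_one k }

instance : Algebra k (PathAlgebra k Q) :=
  Algebra.ofModule (PathAlgebra.smul_mul k) (PathAlgebra.mul_smul k)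

end PathAlgebra

end PathAlgebra

section Gentle

variable {k : Type u} [Field k] {Q : Type u} [Quiver.{u} Q] [Fintype Q]

variable (k) in
/-- An arrow as an element of the path algebra. -/
def arrow (a : Arrow Q) : PathAlgebra k Q := PathAlgebra.of k (QPath.ofArrow a)

variable (k Q) in
/-- The `m`-th power of the ideal generated by the arrows, that is, the ideal of `kQ` generated by
the paths of length `m`. -/
def arrowIdealPow (m : ℕ) : TwoSidedIdeal (PathAlgebra k Q) :=
  TwoSidedIdeal.span {x | ∃ p : QPath Q, p.length = m ∧ x = PathAlgebra.of k p}

/-- Admissible ideals of a path algebra. -/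
def IsAdmissible (J : TwoSidedIdeal (PathAlgebra k Q)) : Prop :=
  ∃ m : ℕ, 2 ≤ m ∧ arrowIdealPow k Q m ≤ J ∧ J ≤ arrowIdealPow k Q 2

/-- The conditions on the ideal `J` which say that `kQ / J` is a gentle algebra. -/
structure IsGentle (J : TwoSidedIdeal (PathAlgebra k Q)) : Prop where
  admissible : IsAdmissible J
  generated : ∃ S : Set (QPath Q), (∀ p ∈ S, p.length = 2) ∧
    J = TwoSidedIdeal.span (PathAlgebra.of k '' S)
  card_out_le (v : Q) : {a : Arrow Q | a.tail = v}.encard ≤ 2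
  card_in_le (v : Q) : {a : Arrow Q | a.head = v}.encard ≤ 2
  card_left_mem_le (y : Arrow Q) :
    {x : Arrow Q | x.tail = y.head ∧ arrow k x * arrow k y ∈ J}.encard ≤ 1
  card_right_mem_le (y : Arrow Q) :
    {z : Arrow Q | z.head = y.tail ∧ arrow k y * arrow k z ∈ J}.encard ≤ 1
  card_left_notMem_le (y : Arrow Q) :
    {x : Arrow Q | x.tail = y.head ∧ arrow k x * arrow k y ∉ J}.encard ≤ 1
  card_right_notMem_le (y : Arrow Q) :
    {z : Arrow Q | z.head = y.tail ∧ arrow k y * arrow k z ∉ J}.encard ≤ 1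

/-- The quotient algebra `Λ = kQ / J`. -/
abbrev Lam (J : TwoSidedIdeal (PathAlgebra k Q)) : Type u := J.ringCon.Quotient

/-- The coset in `Λ` of a path. -/
def pathClass (J : TwoSidedIdeal (PathAlgebra k Q)) (p : QPath Q) : Lam J :=
  J.ringCon.mk' (PathAlgebra.of k p)

/-- The idempotent `e_v` of `Λ`. -/
def idem (J : TwoSidedIdeal (PathAlgebra k Q)) (v : Q) : Lam J := pathClass J (QPath.triv v)

variable (J : TwoSidedIdeal (PathAlgebra k Q))

theorem mk_eq_zero_iff (x : PathAlgebra k Q) : J.ringCon.mk' x = 0 ↔ x ∈ J := by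
  rw [TwoSidedIdeal.mem_iff, ← map_zero J.ringCon.mk']
  exact RingCon.eq _

theorem pathClass_comp {a b c : Q} (p : Quiver.Path b c) (q : Quiver.Path a b) :
    pathClass J ⟨b, c, p⟩ * pathClass J ⟨a, b, q⟩ = pathClass J ⟨a, c, q.comp p⟩ := by
  rw [pathClass, pathClass, ← map_mul, PathAlgebra.of_mul_of_comp]; rfl

theorem pathClass_mul_idem (p : QPath Q) : pathClass J p * idem J p.tail = pathClass J p :=
  (pathClass_comp J p.path .nil).trans (by rw [Quiver.Path.nil_comp])

/-! ### Generalised letters and generalised words -/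

/-- The generalised letters `[γ]` and `[γ⁻¹]`, where `γ` is a non-trivial path not in `J`. -/
structure Letter : Type u where
  /-- the path `γ` -/
  path : NPath Q
  notMem : PathAlgebra.of k path.toQPath ∉ J
  /-- whether the letter is `[γ⁻¹]` rather than `[γ]` -/
  isInv : Bool

variable {J}

namespace Letter

/-- The head of a generalised letter: `h([γ]) = t(γ)` and `h([γ⁻¹]) = h(γ)`. -/
def head (l : Letter J) : Q := if l.isInv then l.path.head else l.path.tail

/-- The tail of a generalised letter: `t([γ]) = h(γ)` and `t([γ⁻¹]) = t(γ)`. -/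
def tail (l : Letter J) : Q := if l.isInv then l.path.tail else l.path.head

/-- The inverse of a generalised letter. -/
def inv (l : Letter J) : Letter J := { l with isInv := !l.isInv }

/-- The coset in `Λ` of the path of a generalised letter. -/
def cls (l : Letter J) : Lam J := pathClass J l.path.toQPath

/-- The degree `H[γ] = -1`, `H[γ⁻¹] = 1`. -/
def deg (l : Letter J) : ℤ := if l.isInv then 1 else -1

/-- The generalised letters `[a]` and `[b]` may be consecutive in a generalised word. -/
def Adj (a b : Letter J) : Prop :=
  match a.isInv, b.isInv with
  | false, true => a.path.head = b.path.head ∧ a.path.last ≠ b.path.last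
  | true, true => a.path.tail = b.path.head ∧ arrow k a.path.first * arrow k b.path.last ∈ J
  | true, false => a.path.tail = b.path.tail ∧ a.path.first ≠ b.path.first
  | false, false => a.path.head = b.path.tail ∧ arrow k b.path.first * arrow k a.path.last ∈ J

theorem Adj.tail_eq {a b : Letter J} (h : a.Adj b) : a.tail = b.head := by
  unfold Adj at h
  cases ha : a.isInv <;> cases hb : b.isInv <;> simp_all [tail, head]

end Letter

variable (J)

/-- Sequences of generalised letters, indexed by `{0}` (trivial), by `{0, …, m}`, by `ℕ`, by `-ℕ`
or by `ℤ`. -/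
inductive PreWord : Type u
  /-- the trivial sequence `1_{v,δ}` -/
  | triv (v : Q) (δ : ℤˣ) : PreWord
  /-- the sequence `[L₁]⋯[L_m]` -/
  | fin (L : List (Letter J)) : PreWord
  /-- the sequence `[C₁][C₂]⋯` with `C_{j+1} = f j` -/
  | nat (f : ℕ → Letter J) : PreWord
  /-- the sequence `⋯[C₋₁][C₀]` with `C_{-j} = f j` -/
  | neg (f : ℕ → Letter J) : PreWord
  /-- the sequence `⋯[C₀]:[C₁]⋯` with `C_j = f j` -/
  | int (f : ℤ → Letter J) : PreWord

variable {J}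

namespace PreWord

/-- The letter `C_i`, if there is one. -/
def letterAt : PreWord J → ℤ → Option (Letter J)
  | triv _ _, _ => none
  | fin L, i => if 1 ≤ i then L[(i - 1).toNat]? else none
  | nat f, i => if 1 ≤ i then some (f (i - 1).toNat) else none
  | neg f, i => if i ≤ 0 then some (f (-i).toNat) else none
  | int f, i => some (f i)

/-- A generalised word: trivial, or a non-empty sequence of generalised letters any two consecutive
ones of which satisfy the adjacency condition. -/
def IsWord : PreWord J → Prop
  | triv _ _ => True
  | fin L => L ≠ [] ∧ L.IsChain Letter.Adj
  | nat f => ∀ j, (f j).Adj (f (j + 1))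
  | neg f => ∀ j, (f (j + 1)).Adj (f j)
  | int f => ∀ j, (f j).Adj (f (j + 1))

theorem IsWord.adj {C : PreWord J} (hC : C.IsWord) {i : ℤ} {a b : Letter J}
    (ha : C.letterAt i = some a) (hb : C.letterAt (i + 1) = some b) : a.Adj b := by
  cases C with
  | triv v δ => simp [letterAt] at ha
  | fin L =>
    simp only [letterAt] at ha hb
    split_ifs at ha hb with h1 h2
    obtain ⟨n, hn⟩ : ∃ n : ℕ, i = n + 1 := ⟨(i - 1).toNat, by omega⟩
    subst hn
    have e1 : ((n : ℤ) + 1 - 1).toNat = n := by omega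
    have e2 : ((n : ℤ) + 1 + 1 - 1).toNat = n + 1 := by omega
    rw [e1] at ha
    rw [e2] at hb
    obtain ⟨hn1, rfl⟩ := List.getElem?_eq_some_iff.1 ha
    obtain ⟨hn2, rfl⟩ := List.getElem?_eq_some_iff.1 hb
    exact List.isChain_iff_getElem.1 hC.2 n hn2
  | nat f =>
    simp only [letterAt] at ha hb
    split_ifs at ha hb with h1 h2
    obtain ⟨n, hn⟩ : ∃ n : ℕ, i = n + 1 := ⟨(i - 1).toNat, by omega⟩
    subst hn
    have e1 : ((n : ℤ) + 1 - 1).toNat = n := by omega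
    have e2 : ((n : ℤ) + 1 + 1 - 1).toNat = n + 1 := by omega
    rw [e1, Option.some_inj] at ha
    rw [e2, Option.some_inj] at hb
    subst ha hb
    exact hC n
  | neg f =>
    simp only [letterAt] at ha hb
    split_ifs at ha hb with h1 h2
    obtain ⟨n, hn⟩ : ∃ n : ℕ, i = -((n : ℤ) + 1) := ⟨(-i - 1).toNat, by omega⟩
    subst hn
    have e1 : (- -((n : ℤ) + 1)).toNat = n + 1 := by omega
    have e2 : (-(-((n : ℤ) + 1) + 1)).toNat = n := by omega
    rw [e1, Option.some_inj] at ha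
    rw [e2, Option.some_inj] at hb
    subst ha hb
    exact hC n
  | int f =>
    simp only [letterAt, Option.some_inj] at ha hb
    subst ha hb
    exact hC i

/-- The vertex `v_C(i)` for `i` in the index set of `C`, and `none` outside the index set: it is
the tail of `C_i` and the head of `C_{i+1}`. -/
def vertexAt (C : PreWord J) (i : ℤ) : Option Q :=
  match C, C.letterAt i, C.letterAt (i + 1) with
  | triv v _, _, _ => if i = 0 then some v else none
  | _, some l, _ => some l.tail
  | _, none, some l => some l.head
  | _, none, none => none

/-- The degree of the letter `C_i`, and zero if there is no such letter. -/
def degAt (C : PreWord J) (i : ℤ) : ℤ := ((C.letterAt i).map Letter.deg).getD 0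

/-- The function `μ_C`: it is `H[C₁] + ⋯ + H[C_i]` for `i ≥ 0` and `-(H[C₀] + ⋯ + H[C_{i+1}])` for
`i ≤ 0`. -/
def mu (C : PreWord J) (i : ℤ) : ℤ :=
  ∑ j ∈ Finset.Ioc 0 i, C.degAt j - ∑ j ∈ Finset.Ioc i 0, C.degAt j

/-- The shift `C[t]` of a sequence of generalised letters. -/
def shift (t : ℤ) : PreWord J → PreWord J
  | int f => int fun i => f (i + t)
  | C => C

/-- The number of letters of a sequence of generalised letters. -/
def length : PreWord J → ℕ∞
  | triv _ _ => 0
  | fin L => L.length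
  | nat _ => ⊤
  | neg _ => ⊤
  | int _ => ⊤

/-- The concatenation `B C`. It is meaningful if `B` has a right end and `C` has a left end; the
value is `B` in the other cases. -/
def concat : PreWord J → PreWord J → PreWord J
  | triv _ _, C => C
  | B, triv _ _ => B
  | fin L, fin M => fin (L ++ M)
  | fin L, nat f => nat fun j => if h : j < L.length then L[j] else f (j - L.length)
  | neg f, fin L => neg fun j =>
      if h : j < L.length then L[L.length - 1 - j] else f (j - L.length)
  | neg f, nat g => int fun i => if i ≤ 0 then f (-i).toNat else g (i - 1).toNat
  | B, _ => B

end PreWord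

variable (J)

/-- Generalised words. -/
structure Word : Type u where
  /-- the underlying sequence of generalised letters -/
  pre : PreWord J
  isWord : pre.IsWord

/-- A choice of a sign for each of the symbols `a = (a, false)` and `a⁻¹ = (a, true)`, for `a` an
arrow. Here `h(a⁻¹) = t(a)`. -/
structure SignChoice where
  /-- the sign of a symbol -/
  sign : Arrow Q × Bool → ℤˣ
  sign_eq_iff (l l' : Arrow Q × Bool) (hne : l ≠ l')
    (hhead : (if l.2 then l.1.tail else l.1.head) = if l'.2 then l'.1.tail else l'.1.head) :
    sign l = sign l' ↔ ∃ a b : Arrow Q, arrow k a * arrow k b ∈ J ∧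
      ((l = (a, true) ∧ l' = (b, false)) ∨ (l = (b, false) ∧ l' = (a, true)))

variable {J}

/-- The sign of a generalised letter: `s([γ]) = s(f(γ)⁻¹)` and `s([γ⁻¹]) = -s(l(γ))`. -/
def SignChoice.letterSign (s : SignChoice J) (l : Letter J) : ℤˣ :=
  if l.isInv then -s.sign (l.path.last, false) else s.sign (l.path.first, true)

namespace PreWord

/-- The head and the sign of `C`, if `C` has a left end. -/
def headSign (s : SignChoice J) : PreWord J → Option (Q × ℤˣ)
  | triv v δ => some (v, δ)
  | fin L => L.head?.map fun l => (l.head, s.letterSign l)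
  | nat f => some ((f 0).head, s.letterSign (f 0))
  | _ => none

/-- The head and the sign of `C⁻¹`, if `C` has a right end. -/
def invHeadSign (s : SignChoice J) : PreWord J → Option (Q × ℤˣ)
  | triv v δ => some (v, -δ)
  | fin L => L.getLast?.map fun l => (l.inv.head, s.letterSign l.inv)
  | neg f => some ((f 0).inv.head, s.letterSign (f 0).inv)
  | _ => none

/-- The composition `B C` is defined and is again a generalised word. -/
structure Composable (s : SignChoice J) (B C : PreWord J) : Prop where
  isWord : (B.concat C).IsWord
  right_triv (v : Q) (δ : ℤˣ) (h : C = triv v δ) : B.invHeadSign s = some (v, -δ)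
  left_triv (v : Q) (δ : ℤˣ) (h : B = triv v δ) : C.headSign s = some (v, δ)

end PreWord

namespace Word

/-- A finite generalised word. -/
def IsFinite (C : Word J) : Prop :=
  (∃ v δ, C.pre = .triv v δ) ∨ ∃ L, C.pre = .fin L

/-- The shift `C[t]`. -/
def shift (t : ℤ) (C : Word J) : Word J :=
  ⟨C.pre.shift t, by
    obtain ⟨C, hC⟩ := C
    cases C with
    | int f => intro j; simpa [add_right_comm] using hC (j + t)
    | _ => exact hC⟩

/-- `C` is a `ℤ`-word with `C = C[p]` and `μ_C(p) = 0`. -/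
def HasPeriod (C : Word J) (p : ℕ) : Prop :=
  (∃ f, C.pre = .int f) ∧ C = C.shift p ∧ C.pre.mu p = 0

/-- Periodic generalised words. -/
def IsPeriodic (C : Word J) : Prop := ∃ p : ℕ, 0 < p ∧ C.HasPeriod p

/-- Aperiodic generalised words. -/
def IsAperiodic (C : Word J) : Prop := ¬ C.IsPeriodic

/-- The period of a periodic generalised word. -/
def period (C : Word J) : ℕ := sInf {p : ℕ | 0 < p ∧ C.HasPeriod p}

/-- The set of the non-trivial sequences `⋯[α₂][α₁]` of arrows, finite or indexed by `-ℕ`, whose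
concatenation with `C` on the right is a generalised word. -/
def swSet (s : SignChoice J) (C : Word J) : Set (PreWord J) :=
  {B | ((∃ L, L ≠ [] ∧ B = .fin L) ∨ ∃ f, B = .neg f) ∧
    (∀ i l, B.letterAt i = some l → l.isInv = false ∧ l.path.length = 1) ∧
    B.Composable s C.pre}

/-- The set of the non-trivial sequences `[γ₁⁻¹][γ₂⁻¹]⋯` of inverses of arrows, finite or indexed
by `ℕ`, whose concatenation with `C` on the left is a generalised word. -/
def seSet (s : SignChoice J) (C : Word J) : Set (PreWord J) :=
  {D | ((∃ L, L ≠ [] ∧ D = .fin L) ∨ ∃ f, D = .nat f) ∧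
    (∀ i l, D.letterAt i = some l → l.isInv = true ∧ l.path.length = 1) ∧
    C.pre.Composable s D}

/-- `B` is the longest element of a set of sequences. -/
def IsLongest (W : Set (PreWord J)) (B : PreWord J) : Prop :=
  B ∈ W ∧ ∀ B' ∈ W, B'.length ≤ B.length

open Classical in
/-- The generalised word `C(↙)`, for a finite generalised word `C`. -/
def sw (s : SignChoice J) (C : Word J) : Word J :=
  if h : ∃ B, IsLongest (C.swSet s) B then ⟨h.choose.concat C.pre, h.choose_spec.1.2.2.isWord⟩ else C

open Classical in
/-- The generalised word `C(↘)`, for a finite generalised word `C`. -/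
def se (s : SignChoice J) (C : Word J) : Word J :=
  if h : ∃ D, IsLongest (C.seSet s) D then ⟨C.pre.concat h.choose, h.choose_spec.1.2.2.isWord⟩ else C

end Word

namespace PreWord

/-- The first letter of a sequence of generalised letters with a left end. -/
def firstLetter : PreWord J → Option (Letter J)
  | fin L => L.head?
  | nat f => some (f 0)
  | _ => none

/-- The last letter of a sequence of generalised letters with a right end. -/
def lastLetter : PreWord J → Option (Letter J)
  | fin L => L.getLast?
  | neg f => some (f 0)
  | _ => none

theorem isWord_concat {B E : PreWord J} (hB : B.IsWord) (hE : E.IsWord)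
    (h : ∀ a ∈ B.lastLetter, ∀ b ∈ E.firstLetter, a.Adj b) : (B.concat E).IsWord := by
  cases B with
  | triv v δ => exact hE
  | nat f => cases E <;> exact hB
  | int f => cases E <;> exact hB
  | fin L =>
    cases E with
    | triv v δ => exact hB
    | neg f => exact hB
    | int f => exact hB
    | fin M =>
      exact ⟨by simp [hB.1], List.isChain_append.2 ⟨hB.2, hE.2, h⟩⟩
    | nat f =>
      intro j
      have hlast : ∀ hj : j < L.length, j + 1 = L.length → L[j] ∈ L.getLast? := by
        intro hj hj'
        rw [Option.mem_def, List.getLast?_eq_getElem?]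
        have : L.length - 1 = j := by omega
        rw [this, List.getElem?_eq_getElem hj]
      rcases lt_trichotomy (j + 1) L.length with h1 | h1 | h1
      · have h2 : j < L.length := by omega
        simp only [h1, h2, dite_true]
        exact List.isChain_iff_getElem.1 hB.2 j h1
      · have h2 : j < L.length := by omega
        have h3 : ¬ j + 1 < L.length := by omega
        simp only [h2, h3, dite_true, dite_false]
        have h4 : j + 1 - L.length = 0 := by omega
        rw [h4]
        exact h _ (hlast h2 h1) _ rfl
      · have h2 : ¬ j < L.length := by omega
        have h3 : ¬ j + 1 < L.length := by omega
        simp only [h2, h3, dite_false]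
        have h4 : j + 1 - L.length = (j - L.length) + 1 := by omega
        rw [h4]
        exact hE _
  | neg f =>
    cases E with
    | triv v δ => exact hB
    | neg f => exact hB
    | int f => exact hB
    | fin L =>
      intro j
      rcases lt_trichotomy (j + 1) L.length with h1 | h1 | h1
      · have h2 : j < L.length := by omega
        simp only [h1, h2, dite_true]
        have h4 := List.isChain_iff_getElem.1 hE.2 (L.length - 1 - (j + 1)) (by omega)
        have h5 : L.length - 1 - (j + 1) + 1 = L.length - 1 - j := by omega
        simpa only [h5] using h4
      · have h2 : j < L.length := by omega
        have h3 : ¬ j + 1 < L.length := by omega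
        simp only [h2, h3, dite_true, dite_false]
        have h4 : j + 1 - L.length = 0 := by omega
        have h5 : L.length - 1 - j = 0 := by omega
        simp only [h4, h5]
        refine h _ rfl _ ?_
        rw [firstLetter, Option.mem_def, List.head?_eq_getElem?, List.getElem?_eq_getElem]
      · have h2 : ¬ j < L.length := by omega
        have h3 : ¬ j + 1 < L.length := by omega
        simp only [h2, h3, dite_false]
        have h4 : j + 1 - L.length = (j - L.length) + 1 := by omega
        rw [h4]
        exact hB _
    | nat g =>
      intro j
      rcases lt_trichotomy j 0 with h1 | h1 | h1
      · have h2 : j ≤ 0 := by omega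
        have h3 : j + 1 ≤ 0 := by omega
        simp only [h2, h3, if_true]
        have h4 : (-j).toNat = (-(j + 1)).toNat + 1 := by omega
        rw [h4]
        exact hB _
      · subst h1
        simpa using h _ rfl _ rfl
      · have h2 : ¬ j ≤ 0 := by omega
        have h3 : ¬ j + 1 ≤ 0 := by omega
        simp only [h2, h3, if_false]
        have h4 : (j + 1 - 1).toNat = (j - 1).toNat + 1 := by omega
        rw [h4]
        exact hE _

theorem isWord_of_concat_fin {B : PreWord J} {M : List (Letter J)} (hM : M ≠ [])
    (hBs : (∃ L, L ≠ [] ∧ B = .fin L) ∨ ∃ f, B = .neg f) (h : (B.concat (.fin M)).IsWord) :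
    B.IsWord ∧ ∀ a ∈ B.lastLetter, ∀ b ∈ M.head?, a.Adj b := by
  rcases hBs with ⟨L, hL, rfl⟩ | ⟨f, rfl⟩
  · obtain ⟨h1, h2, h3⟩ := List.isChain_append.1 h.2
    exact ⟨⟨hL, h1⟩, h3⟩
  · have hM' : 0 < M.length := List.length_pos_iff.2 hM
    refine ⟨fun j => ?_, ?_⟩
    · have h1 := h (j + M.length)
      have h2 : ¬ j + M.length < M.length := by omega
      have h3 : ¬ j + M.length + 1 < M.length := by omega
      simp only [h2, h3, dite_false] at h1
      have h4 : j + M.length + 1 - M.length = j + 1 := by omega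
      rw [h4, Nat.add_sub_cancel] at h1
      exact h1
    · intro a ha b hb
      have h1 := h (M.length - 1)
      have h2 : M.length - 1 < M.length := by omega
      have h3 : ¬ M.length - 1 + 1 < M.length := by omega
      simp only [h2, h3, dite_true, dite_false] at h1
      have h4 : M.length - 1 + 1 - M.length = 0 := by omega
      simp only [h4, Nat.sub_self] at h1
      rw [List.head?_eq_getElem?, List.getElem?_eq_getElem hM', Option.mem_def,
        Option.some_inj] at hb
      obtain rfl : f 0 = a := by simpa [lastLetter] using ha
      subst hb
      exact h1

end PreWord

namespace Word

theorem isWord_concat_concat {s : SignChoice J} {C : Word J} {B D : PreWord J}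
    (hB : B ∈ C.swSet s) (hD : D ∈ C.seSet s) : (B.concat (C.pre.concat D)).IsWord := by
  obtain ⟨hB1, hB2, hB3⟩ := hB
  obtain ⟨hD1, hD2, hD3⟩ := hD
  obtain ⟨C, hC⟩ := C
  cases C with
  | triv v δ =>
    have hBw : B.IsWord := by
      rcases hB1 with ⟨L, hL, rfl⟩ | ⟨f, rfl⟩ <;> exact hB3.isWord
    refine PreWord.isWord_concat hBw hD3.isWord fun a ha b hb => ?_
    have hb' : b ∈ D.firstLetter := hb
    have ha1 : a.isInv = false ∧ a.head = a.path.tail ∧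
        (a.inv.head, s.letterSign a.inv) = (v, -δ) := by
      have h3 := hB3.right_triv v δ rfl
      rcases hB1 with ⟨L, hL, rfl⟩ | ⟨f, rfl⟩
      · have ha2 : L.getLast? = some a := ha
        have h4 : a.isInv = false := by
          refine (hB2 L.length a ?_).1
          rw [List.getLast?_eq_getElem?] at ha2
          have := List.length_pos_iff.2 hL
          have h6 : (1 : ℤ) ≤ L.length := by omega
          have h7 : ((L.length : ℤ) - 1).toNat = L.length - 1 := by omega
          simp only [PreWord.letterAt, h6, if_true, h7, ha2]
        refine ⟨h4, by simp [Letter.head, h4], ?_⟩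
        simpa [PreWord.invHeadSign, ha2] using h3
      · obtain rfl : f 0 = a := by simpa [PreWord.lastLetter] using ha
        have h4 : (f 0).isInv = false := (hB2 0 (f 0) (by simp [PreWord.letterAt])).1
        refine ⟨h4, by simp [Letter.head, h4], ?_⟩
        simpa [PreWord.invHeadSign] using h3
    have hb1 : b.isInv = true ∧ (b.head, s.letterSign b) = (v, δ) := by
      have h3 := hD3.left_triv v δ rfl
      rcases hD1 with ⟨L, hL, rfl⟩ | ⟨f, rfl⟩
      · have hb2 : L.head? = some b := hb
        have h4 : b.isInv = true := by
          refine (hD2 1 b ?_).1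
          rw [List.head?_eq_getElem?] at hb2
          simp [PreWord.letterAt, hb2]
        refine ⟨h4, ?_⟩
        simpa [PreWord.headSign, hb2] using h3
      · obtain rfl : f 0 = b := by simpa [PreWord.firstLetter] using hb'
        have h4 : (f 0).isInv = true := (hD2 1 (f 0) (by simp [PreWord.letterAt])).1
        refine ⟨h4, ?_⟩
        simpa [PreWord.headSign] using h3
    obtain ⟨ha1, -, ha3⟩ := ha1
    obtain ⟨hb1, hb3⟩ := hb1
    simp only [Prod.mk.injEq, Letter.inv, Letter.head, ha1, SignChoice.letterSign] at ha3
    simp only [Prod.mk.injEq, Letter.head, hb1, SignChoice.letterSign] at hb3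
    simp only [Letter.Adj, ha1, hb1]
    refine ⟨by simpa using ha3.1.trans hb3.1.symm, fun he => ?_⟩
    have h1 := ha3.2
    have h2 := hb3.2
    simp only [Bool.not_false, if_true, he] at h1 h2
    rw [h2] at h1
    rcases Int.units_eq_one_or δ with rfl | rfl <;> simp at h1
  | fin M =>
    obtain ⟨h1, h2⟩ := PreWord.isWord_of_concat_fin hC.1 hB1 hB3.isWord
    refine PreWord.isWord_concat h1 hD3.isWord fun a ha b hb => h2 a ha b ?_
    have hM : 0 < M.length := List.length_pos_iff.2 hC.1
    rcases hD1 with ⟨L, hL, rfl⟩ | ⟨f, rfl⟩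
    · have hb' : b ∈ (M ++ L).head? := hb
      rw [List.head?_append_of_ne_nil _ hC.1] at hb'
      exact hb'
    · have hb' : (if h : 0 < M.length then M[0] else f (0 - M.length)) = b := by
        simpa [PreWord.concat, PreWord.firstLetter] using hb
      simp only [hM, dite_true] at hb'
      rw [List.head?_eq_getElem?, List.getElem?_eq_getElem hM, hb']; rfl
  | nat f => exact (by rcases hD1 with ⟨L, hL, rfl⟩ | ⟨g, rfl⟩ <;> exact hB3.isWord)
  | int f => exact (by rcases hD1 with ⟨L, hL, rfl⟩ | ⟨g, rfl⟩ <;> exact hB3.isWord)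
  | neg f =>
    rcases hB1 with ⟨L, hL, rfl⟩ | ⟨g, rfl⟩ <;> rcases hD1 with ⟨L, hL, rfl⟩ | ⟨g, rfl⟩ <;>
      exact hB3.isWord

theorem isWord_concat_se {s : SignChoice J} {C : Word J} {B : PreWord J}
    (hB : B ∈ C.swSet s) : (B.concat (C.se s).pre).IsWord := by
  unfold se
  by_cases h : ∃ D, IsLongest (C.seSet s) D
  · rw [dif_pos h]
    exact isWord_concat_concat hB h.choose_spec.1
  · rw [dif_neg h]
    exact hB.2.2.isWord

open Classical in
/-- The generalised word `C(↙↘)`, for a finite generalised word `C`. -/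
def swse (s : SignChoice J) (C : Word J) : Word J :=
  if h : ∃ B, IsLongest (C.swSet s) B then
    ⟨h.choose.concat (C.se s).pre, isWord_concat_se h.choose_spec.1⟩
  else C.se s

end Word

/-! ### String complexes -/

namespace PreWord

theorem mu_succ (C : PreWord J) (i : ℤ) : C.mu (i + 1) = C.mu i + C.degAt (i + 1) := by
  unfold mu
  rcases lt_or_ge i 0 with h | h
  · have h1 : Finset.Ioc 0 (i + 1) = ∅ := Finset.Ioc_eq_empty (by omega)
    have h2 : Finset.Ioc 0 i = ∅ := Finset.Ioc_eq_empty (by omega)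
    have h3 : Finset.Ioc i 0 = insert (i + 1) (Finset.Ioc (i + 1) 0) := by
      ext j; simp only [Finset.mem_Ioc, Finset.mem_insert]; omega
    rw [h1, h2, h3, Finset.sum_insert (by simp)]
    simp
  · have h1 : Finset.Ioc (i + 1) 0 = ∅ := Finset.Ioc_eq_empty (by omega)
    have h2 : Finset.Ioc i 0 = ∅ := Finset.Ioc_eq_empty (by omega)
    have h3 : Finset.Ioc 0 (i + 1) = insert (i + 1) (Finset.Ioc 0 i) := by
      ext j; simp only [Finset.mem_Ioc, Finset.mem_insert]; omega
    rw [h1, h2, h3, Finset.sum_insert (by simp)]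
    simp [add_comm]

/-- The left ideal `Λ e_{v_C(i)}` if `i` lies in the index set and `μ_C(i) = n`, and zero
otherwise. -/
def stalk (C : PreWord J) (n i : ℤ) : Submodule (Lam J) (Lam J) :=
  if C.mu i = n then
    match C.vertexAt i with
    | some v => Ideal.span {idem J v}
    | none => ⊥
  else ⊥

/-- The homogeneous component `Pⁿ(C)`, the direct sum of the left ideals `Λ e_{v_C(i)}` with `i` in
the index set and `μ_C(i) = n`. It is realised inside the free module with basis `(b_i)_{i ∈ ℤ}`. -/
def comp (C : PreWord J) (n : ℤ) : Submodule (Lam J) (ℤ →₀ Lam J) where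
  carrier := {f | ∀ i, f i ∈ C.stalk n i}
  add_mem' hf hg i := (C.stalk n i).add_mem (hf i) (hg i)
  zero_mem' i := (C.stalk n i).zero_mem
  smul_mem' c _ hf i := (C.stalk n i).smul_mem c (hf i)

/-- `b_i⁺`, which is `γ b_{i+1}` if `C_{i+1} = [γ⁻¹]`, and zero otherwise. -/
def bPlus (C : PreWord J) (i : ℤ) : ℤ →₀ Lam J :=
  match C.letterAt (i + 1) with
  | some l => if l.isInv then Finsupp.single (i + 1) l.cls else 0
  | none => 0

/-- `b_i⁻`, which is `γ b_{i-1}` if `C_i = [γ]`, and zero otherwise. -/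
def bMinus (C : PreWord J) (i : ℤ) : ℤ →₀ Lam J :=
  match C.letterAt i with
  | some l => if l.isInv then 0 else Finsupp.single (i - 1) l.cls
  | none => 0

/-- The `Λ`-linear map with `b_i ↦ b_i⁻ + b_i⁺`. -/
def diff (C : PreWord J) : (ℤ →₀ Lam J) →ₗ[Lam J] (ℤ →₀ Lam J) :=
  Finsupp.linearCombination (Lam J) fun i => C.bMinus i + C.bPlus i

end PreWord

theorem Letter.cls_mul_idem (l : Letter J) : l.cls * idem J l.path.tail = l.cls :=
  pathClass_mul_idem J l.path.toQPath

theorem exists_of_eq_mul_first (γ : NPath Q) :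
    ∃ x, PathAlgebra.of k γ.toQPath = x * arrow k γ.first := by
  suffices h : ∀ {a b : Q} (p : Quiver.Path a b) (c : Q) (e : b ⟶ c),
      ∃ x, PathAlgebra.of k (⟨a, c, p.cons e⟩ : QPath Q) =
        x * arrow k (firstArrowAux p ⟨b, c, e⟩) from h γ.front _ γ.last.hom
  intro a b p
  induction p with
  | nil => exact fun c e => ⟨1, by rw [one_mul]; rfl⟩
  | @cons b' b p e' ih =>
    intro c e
    obtain ⟨x, hx⟩ := ih b e'
    refine ⟨arrow k ⟨b, c, e⟩ * x, ?_⟩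
    rw [PathAlgebra.of_cons, hx, mul_assoc]
    rfl

/-- If the product of the first arrow of `γ` and the last arrow of `δ` lies in `J` then so does the
product of `γ` and `δ`. -/
theorem pathClass_mul_eq_zero {γ δ : NPath Q} (h : arrow k γ.first * arrow k δ.last ∈ J) :
    pathClass J γ.toQPath * pathClass J δ.toQPath = 0 := by
  obtain ⟨x, hx⟩ := exists_of_eq_mul_first (k := k) γ
  have hδ : PathAlgebra.of k δ.toQPath =
      arrow k δ.last * PathAlgebra.of k ⟨δ.tail, δ.last.tail, δ.front⟩ := PathAlgebra.of_cons k δ.front δ.last.hom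
  rw [pathClass, pathClass, ← map_mul, mk_eq_zero_iff, hx, hδ]
  have h1 := J.mul_mem_right _ (PathAlgebra.of k ⟨δ.tail, δ.last.tail, δ.front⟩)
    (J.mul_mem_left x _ h)
  simpa only [mul_assoc] using h1

namespace PreWord

theorem vertexAt_of_letterAt {C : PreWord J} {i : ℤ} {l : Letter J} (h : C.letterAt i = some l) :
    C.vertexAt i = some l.tail := by
  unfold vertexAt
  cases C with
  | triv v δ => simp [letterAt] at h
  | _ => simp only [h]

theorem vertexAt_of_letterAt_succ {C : PreWord J} (hC : C.IsWord) {i : ℤ} {l : Letter J}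
    (h : C.letterAt (i + 1) = some l) : C.vertexAt i = some l.head := by
  rcases h' : C.letterAt i with _ | l'
  · unfold vertexAt
    cases C with
    | triv v δ => simp [letterAt] at h
    | _ => simp only [h, h']
  · rw [vertexAt_of_letterAt h', (hC.adj h' h).tail_eq]

theorem single_mem_comp {C : PreWord J} {n i : ℤ} {x : Lam J} (h : x ∈ C.stalk n i) :
    Finsupp.single i x ∈ C.comp n := by
  intro j
  rw [Finsupp.single_apply]
  split_ifs with hij
  · exact hij ▸ h
  · exact Submodule.zero_mem _

theorem smul_single_mem_comp {C : PreWord J} {n i : ℤ} {v : Q} {y : Lam J} (x : Lam J)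
    (hn : C.mu i = n) (hv : C.vertexAt i = some v) (hy : y * idem J v = y) :
    x • Finsupp.single i y ∈ C.comp n := by
  refine Submodule.smul_mem _ x (single_mem_comp ?_)
  rw [stalk, if_pos hn, hv]
  exact Ideal.mem_span_singleton'.2 ⟨y, hy⟩

theorem diff_mem {C : PreWord J} (hC : C.IsWord) {n m : ℤ} (hm : n + 1 = m) {f : ℤ →₀ Lam J}
    (hf : f ∈ C.comp n) : C.diff f ∈ C.comp m := by
  rw [diff, Finsupp.linearCombination_apply]
  refine Submodule.sum_mem _ fun i _ => ?_
  change f i • (C.bMinus i + C.bPlus i) ∈ C.comp m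
  by_cases hi : C.mu i = n
  · rw [smul_add]
    refine Submodule.add_mem _ ?_ ?_
    · unfold bMinus
      rcases h : C.letterAt i with _ | l
      · simp
      · by_cases hl : l.isInv
        · simp [hl]
        · have hs : C.letterAt (i - 1 + 1) = some l := by rw [sub_add_cancel, h]
          have h1 := C.mu_succ (i - 1)
          have h2 : C.degAt (i - 1 + 1) = -1 := by simp [degAt, h, Letter.deg, hl]
          rw [h2, sub_add_cancel] at h1
          simp only [hl]
          refine smul_single_mem_comp (v := l.head) _ (by omega)
            (vertexAt_of_letterAt_succ hC hs) ?_
          simpa [Letter.head, hl] using l.cls_mul_idem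
    · unfold bPlus
      rcases h : C.letterAt (i + 1) with _ | l
      · simp
      · by_cases hl : l.isInv
        · have h1 := C.mu_succ i
          have h2 : C.degAt (i + 1) = 1 := by simp [degAt, h, Letter.deg, hl]
          rw [h2] at h1
          simp only [hl]
          refine smul_single_mem_comp (v := l.tail) _ (by omega) (vertexAt_of_letterAt h) ?_
          simpa [Letter.tail, hl] using l.cls_mul_idem
        · simp [hl]
  · have h0 := hf i
    rw [stalk, if_neg hi, Submodule.mem_bot] at h0
    simp [h0]

theorem diff_single (C : PreWord J) (i : ℤ) (x : Lam J) :
    C.diff (Finsupp.single i x) = x • (C.bMinus i + C.bPlus i) := by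
  rw [diff, Finsupp.linearCombination_single]

theorem diff_bPlus {C : PreWord J} (hC : C.IsWord) (i : ℤ) : C.diff (C.bPlus i) = 0 := by
  rw [bPlus]
  rcases h : C.letterAt (i + 1) with _ | l
  · simp
  · by_cases hl : l.isInv
    · simp only [hl, if_true, diff_single, bMinus, bPlus, h]
      rcases h' : C.letterAt (i + 1 + 1) with _ | l'
      · simp
      · by_cases hl' : l'.isInv
        · have h1 := hC.adj h h'
          simp only [Letter.Adj, hl, hl'] at h1
          have h2 : l.cls * l'.cls = 0 := pathClass_mul_eq_zero h1.2
          simp [hl', h2]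
        · simp [hl']
    · simp [hl]

theorem diff_bMinus {C : PreWord J} (hC : C.IsWord) (i : ℤ) : C.diff (C.bMinus i) = 0 := by
  rw [bMinus]
  rcases h : C.letterAt i with _ | l
  · simp
  · by_cases hl : l.isInv
    · simp [hl]
    · have h0 : C.letterAt (i - 1 + 1) = some l := by rw [sub_add_cancel, h]
      simp only [hl, if_false, Bool.false_eq_true, diff_single, bMinus, bPlus, h0]
      rcases h' : C.letterAt (i - 1) with _ | l'
      · simp
      · by_cases hl' : l'.isInv
        · simp [hl']
        · have h1 := hC.adj h' h0
          simp only [Letter.Adj, hl, hl'] at h1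
          have h2 : l.cls * l'.cls = 0 := pathClass_mul_eq_zero h1.2
          simp [hl', h2]

theorem diff_diff {C : PreWord J} (hC : C.IsWord) (f : ℤ →₀ Lam J) : C.diff (C.diff f) = 0 := by
  induction f using Finsupp.induction_linear with
  | zero => simp
  | add f g hf hg => simp [hf, hg]
  | single i x => simp [diff_single, diff_bPlus hC, diff_bMinus hC]

end PreWord

namespace Word

/-- The differential `Pⁿ(C) → Pᵐ(C)`, for `m = n + 1`. -/
def dHom (C : Word J) {n m : ℤ} (h : n + 1 = m) : C.pre.comp n →ₗ[Lam J] C.pre.comp m :=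
  C.pre.diff.restrict fun _ hf => PreWord.diff_mem C.isWord h hf

theorem dHom_dHom (C : Word J) {n m l : ℤ} (h : n + 1 = m) (h' : m + 1 = l) :
    C.dHom h' ∘ₗ C.dHom h = 0 := by
  ext1 f
  exact Subtype.ext (PreWord.diff_diff C.isWord f.1)

/-- The complex `P(C)`. -/
def stringComplex (C : Word J) : CochainComplex (ModuleCat.{u} (Lam J)) ℤ where
  X n := ModuleCat.of (Lam J) (C.pre.comp n)
  d n m := if h : n + 1 = m then ModuleCat.ofHom (C.dHom h) else 0
  shape n m h := dif_neg h
  d_comp_d' n m l h h' := by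
    have h1 : n + 1 = m := h
    have h2 : m + 1 = l := h'
    simp only [h1, h2, dite_true]
    rw [← ModuleCat.ofHom_comp, dHom_dHom]
    rfl

end Word

/-! ### Band complexes -/

namespace PreWord

/-- The `Λ`-linear map with `b_i ↦ b_{i-t}`. -/
def translate (t : ℤ) : (ℤ →₀ Lam J) →ₗ[Lam J] (ℤ →₀ Lam J) :=
  Finsupp.lmapDomain (Lam J) (Lam J) fun i => i - t

theorem translate_single (t i : ℤ) (x : Lam J) :
    translate t (Finsupp.single i x) = Finsupp.single (i - t) x := by
  simp [translate, Finsupp.lmapDomain_apply]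

theorem translate_apply (t : ℤ) (f : ℤ →₀ Lam J) (i : ℤ) : translate t f i = f (i + t) := by
  induction f using Finsupp.induction_linear with
  | zero => simp
  | add f g hf hg => simp [hf, hg]
  | single j x =>
    rw [translate_single, Finsupp.single_apply, Finsupp.single_apply]
    congr 1
    exact propext ⟨fun h => by omega, fun h => by omega⟩

theorem translate_translate (s t : ℤ) (f : ℤ →₀ Lam J) :
    translate s (translate t f) = translate (s + t) f := by
  ext i; simp [translate_apply, add_assoc]

theorem translate_zero (f : ℤ →₀ Lam J) : translate 0 f = f := by
  ext i; simp [translate_apply]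

/-- `t` is a translational symmetry of a sequence of letters which preserves the degrees. -/
structure IsSymm (C : PreWord J) (t : ℤ) : Prop where
  letterAt (i : ℤ) : C.letterAt (i + t) = C.letterAt i
  vertexAt (i : ℤ) : C.vertexAt (i + t) = C.vertexAt i
  mu (i : ℤ) : C.mu (i + t) = C.mu i

theorem IsSymm.translate_mem {C : PreWord J} {t : ℤ} (h : C.IsSymm t) {n : ℤ} {f : ℤ →₀ Lam J}
    (hf : f ∈ C.comp n) : translate t f ∈ C.comp n := by
  intro i
  rw [translate_apply]
  have h1 := hf (i + t)
  rw [stalk, h.mu, h.vertexAt] at h1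
  exact h1

theorem IsSymm.diff_translate {C : PreWord J} {t : ℤ} (h : C.IsSymm t) (f : ℤ →₀ Lam J) :
    C.diff (translate t f) = translate t (C.diff f) := by
  induction f using Finsupp.induction_linear with
  | zero => simp
  | add f g hf hg => simp [hf, hg]
  | single i x =>
    have h1 : C.letterAt (i - t) = C.letterAt i := by
      rw [← h.letterAt (i - t), sub_add_cancel]
    have h2 : C.letterAt (i - t + 1) = C.letterAt (i + 1) := by
      rw [← h.letterAt (i - t + 1)]; congr 1; ring
    rw [translate_single, diff_single, diff_single, map_smul, map_add]
    congr 2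
    · rw [bMinus, bMinus, h1]
      rcases C.letterAt i with _ | l
      · simp
      · by_cases hl : l.isInv
        · simp [hl]
        · have h3 : i - t - 1 = i - 1 - t := by ring
          simp [hl, translate_single, h3]
    · rw [bPlus, bPlus, h2]
      rcases C.letterAt (i + 1) with _ | l
      · simp
      · by_cases hl : l.isInv
        · have h3 : i - t + 1 = i + 1 - t := by ring
          simp [hl, translate_single, h3]
        · simp [hl]

end PreWord

namespace Word

theorem HasPeriod.isSymm {C : Word J} {p : ℕ} (h : C.HasPeriod p) (n : ℤ) :
    C.pre.IsSymm (n * p) := by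
  obtain ⟨⟨f, hf⟩, h2, h3⟩ := h
  have hper : Function.Periodic f (p : ℤ) := by
    intro i
    have h4 := congrArg Word.pre h2
    change C.pre = C.pre.shift p at h4
    rw [hf] at h4
    injection h4 with h5
    exact (congrFun h5 i).symm
  have hpern : Function.Periodic f (n * p) := hper.int_mul n
  have hl : ∀ i, C.pre.letterAt i = some (f i) := fun i => by rw [hf]; rfl
  have hdeg : ∀ (m : ℤ) i, C.pre.degAt (i + m * p) = C.pre.degAt i := fun m i => by
    
    have h5 : f (i + m * p) = f i := hper.int_mul m i
    rw [PreWord.degAt, PreWord.degAt, hl, hl, h5]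
  have hmu : ∀ (m i : ℤ), C.pre.mu (i + m * p) = C.pre.mu i + C.pre.mu (m * p) := by
    intro m i
    have h0 : C.pre.mu 0 = 0 := by simp [PreWord.mu]
    induction i using Int.induction_on with
    | zero => simp [h0]
    | succ i ih =>
      have e1 := C.pre.mu_succ (i + m * p)
      have e2 := C.pre.mu_succ i
      have e3 : (i : ℤ) + m * p + 1 = i + 1 + m * p := by ring
      rw [e3, hdeg] at e1
      omega
    | pred i ih =>
      have e1 := C.pre.mu_succ (-i - 1 + m * p)
      have e2 := C.pre.mu_succ (-i - 1)
      have e3 : -(i : ℤ) - 1 + m * p + 1 = -i - 1 + 1 + m * p := by ring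
      rw [e3, hdeg] at e1
      rw [sub_add_cancel] at e1 e2
      omega
  have hmun : ∀ m : ℤ, C.pre.mu (m * p) = 0 := by
    intro m
    induction m using Int.induction_on with
    | zero => simp [PreWord.mu]
    | succ i ih =>
      have e1 := hmu 1 (i * p)
      rw [one_mul, h3, ih] at e1
      rw [add_mul, one_mul]
      omega
    | pred i ih =>
      have e1 := hmu 1 ((-i - 1) * p)
      rw [one_mul, h3] at e1
      have e2 : (-(i : ℤ) - 1) * p + p = -i * p := by ring
      rw [e2, ih] at e1
      omega
  have hl' : ∀ i, C.pre.letterAt (i + n * p) = C.pre.letterAt i := fun i => by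
    rw [hl, hl, hpern i]
  refine ⟨hl', fun i => ?_, fun i => by rw [hmu, hmun, add_zero]⟩
  rw [PreWord.vertexAt_of_letterAt (hl _), PreWord.vertexAt_of_letterAt (hl i), hpern i]

theorem IsPeriodic.hasPeriod {C : Word J} (hC : C.IsPeriodic) : C.HasPeriod C.period :=
  (Nat.sInf_mem (s := {p : ℕ | 0 < p ∧ C.HasPeriod p}) hC).2

/-- The homogeneous component `Pⁿ(C)` for a periodic word `C`, to be regarded as a module over
`Λ` and over `k[T;T⁻¹]`. -/
def BandComp {C : Word J} (_ : C.IsPeriodic) (n : ℤ) : Type u := C.pre.comp n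

section BandComp

variable {C : Word J} (hC : C.IsPeriodic) (n : ℤ)

instance : AddCommGroup (BandComp hC n) := inferInstanceAs (AddCommGroup (C.pre.comp n))
instance : Module (Lam J) (BandComp hC n) := inferInstanceAs (Module (Lam J) (C.pre.comp n))
instance : Module k (C.pre.comp n) := Submodule.module' _
instance : SMulCommClass (Lam J) k (C.pre.comp n) := inferInstance
instance : IsScalarTower k (Lam J) (C.pre.comp n) := inferInstance

/-- The action of `T ^ t` on `Pⁿ(C)`, given by `b_i ↦ b_{i - tp}` where `p` is the period of `C`. -/
def translateHom : Multiplicative ℤ →* Module.End (Lam J) (C.pre.comp n) where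
  toFun t := (PreWord.translate (t.toAdd * C.period)).restrict fun _ hf =>
    (hC.hasPeriod.isSymm t.toAdd).translate_mem hf
  map_one' := by
    ext1 f
    refine Subtype.ext ?_
    simpa using PreWord.translate_zero f.1
  map_mul' s t := by
    ext1 f
    refine Subtype.ext ?_
    simpa [add_mul] using (PreWord.translate_translate (s.toAdd * C.period)
      (t.toAdd * C.period) f.1).symm

/-- The ring homomorphism which gives the action of `k[T;T⁻¹]` on `Pⁿ(C)`. -/
def laurentHom : k[T;T⁻¹] →ₐ[k] Module.End (Lam J) (C.pre.comp n) :=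
  AddMonoidAlgebra.lift k (Module.End (Lam J) (C.pre.comp n)) ℤ (translateHom hC n)

end BandComp
end Word

namespace Word

section BandComp

variable {C : Word J} (hC : C.IsPeriodic) (n : ℤ)

instance : Module k[T;T⁻¹] (BandComp hC n) :=
  letI : Module (Module.End (Lam J) (C.pre.comp n)) (BandComp hC n) :=
    inferInstanceAs (Module (Module.End (Lam J) (C.pre.comp n)) (C.pre.comp n))
  Module.compHom (BandComp hC n) (laurentHom hC n).toRingHom

theorem laurent_smul_def (r : k[T;T⁻¹]) (x : BandComp hC n) :
    r • x = (laurentHom hC n r : C.pre.comp n →ₗ[Lam J] C.pre.comp n) x := rfl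

instance : SMulCommClass k[T;T⁻¹] (Lam J) (BandComp hC n) :=
  ⟨fun r a x => (laurentHom hC n r).map_smul a x⟩

variable {n} {m : ℤ}

theorem dHom_laurentHom (h : n + 1 = m) (r : k[T;T⁻¹]) (x : C.pre.comp n) :
    C.dHom h (laurentHom hC n r x) = laurentHom hC m r (C.dHom h x) := by
  induction r using LaurentPolynomial.induction_on' with
  | add p q hp hq => simp [hp, hq]
  | C_mul_T t a =>
    have h1 : ∀ l, laurentHom hC l (LaurentPolynomial.C a * LaurentPolynomial.T t) =
        a • translateHom hC l (Multiplicative.ofAdd t) := by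
      intro l
      rw [← LaurentPolynomial.single_eq_C_mul_T, laurentHom, AddMonoidAlgebra.lift_single]
    rw [h1, h1, LinearMap.smul_apply, LinearMap.smul_apply]
    have h2 : C.dHom h (translateHom hC n (Multiplicative.ofAdd t) x) =
        translateHom hC m (Multiplicative.ofAdd t) (C.dHom h x) :=
      Subtype.ext ((hC.hasPeriod.isSymm t).diff_translate x.1)
    rw [← h2]
    have h3 : ∀ (l : ℤ) (y : C.pre.comp l), a • y = (algebraMap k (Lam J) a) • y := fun l y =>
      (algebraMap_smul (Lam J) a y).symm
    rw [h3, h3, map_smul]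

/-- The differential `Pⁿ(C) → Pᵐ(C)` for `m = n + 1` as a map of modules over `k[T;T⁻¹]`. -/
def bandHom (h : n + 1 = m) : BandComp hC n →ₗ[k[T;T⁻¹]] BandComp hC m where
  toFun := C.dHom h
  map_add' := (C.dHom h).map_add
  map_smul' r x := dHom_laurentHom hC h r x

theorem bandHom_smul (h : n + 1 = m) (a : Lam J) (x : BandComp hC n) :
    bandHom hC h (a • x) = a • bandHom hC h x := (C.dHom h).map_smul a x

variable (V : Type u) [AddCommGroup V] [Module k[T;T⁻¹] V]

/-- The differential `d ⊗ id_V` of the complex `P(C,V)`. -/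
def bandDiff (h : n + 1 = m) :
    BandComp hC n ⊗[k[T;T⁻¹]] V →ₗ[Lam J] BandComp hC m ⊗[k[T;T⁻¹]] V where
  toFun := (bandHom hC h).rTensor V
  map_add' := map_add _
  map_smul' a x := by
    induction x using TensorProduct.induction_on with
    | zero => simp
    | tmul x v =>
      rw [TensorProduct.smul_tmul', LinearMap.rTensor_tmul, bandHom_smul, RingHom.id_apply,
        LinearMap.rTensor_tmul, TensorProduct.smul_tmul']
    | add x y hx hy => rw [smul_add, map_add, map_add, smul_add, hx, hy]

theorem bandDiff_bandDiff {l : ℤ} (h : n + 1 = m) (h' : m + 1 = l) :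
    bandDiff hC V h' ∘ₗ bandDiff hC V h = 0 := by
  ext x
  induction x using TensorProduct.induction_on with
  | zero => simp
  | tmul x v =>
    have h1 : bandHom hC h' (bandHom hC h x) = 0 := LinearMap.congr_fun (C.dHom_dHom h h') x
    change bandHom hC h' (bandHom hC h x) ⊗ₜ[k[T;T⁻¹]] v = 0
    rw [h1, TensorProduct.zero_tmul]
  | add x y hx hy => rw [map_add, hx, hy, map_add]

/-- The complex `P(C,V)` for a periodic generalised word `C` and a `k[T;T⁻¹]`-module `V`: its
homogeneous components are `Pⁿ(C) ⊗ V`, and its differential is `d ⊗ id_V`. -/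
def bandComplex : CochainComplex (ModuleCat.{u} (Lam J)) ℤ where
  X n := ModuleCat.of (Lam J) (BandComp hC n ⊗[k[T;T⁻¹]] V)
  d n m := if h : n + 1 = m then ModuleCat.ofHom (bandDiff hC V h) else 0
  shape n m h := dif_neg h
  d_comp_d' n m l h h' := by
    have h1 : n + 1 = m := h
    have h2 : m + 1 = l := h'
    simp only [h1, h2, dite_true]
    rw [← ModuleCat.ofHom_comp, bandDiff_bandDiff]
    rfl

end BandComp

end Word

end Gentle

/-! ### The homotopy category -/

section Homotopy

variable {Λ : Type u} [Ring Λ]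

/-- The complex `X` lies in `C^{+,b}(Λ-proj)`: it consists of finitely generated projective modules,
it is left-bounded, and its cohomology is bounded. -/
structure IsPlusB (X : CochainComplex (ModuleCat.{u} Λ) ℤ) : Prop where
  projective (i : ℤ) : Module.Projective Λ (X.X i)
  finite (i : ℤ) : Module.Finite Λ (X.X i)
  leftBounded : ∃ n : ℤ, ∀ i < n, Subsingleton (X.X i)
  boundedCohomology : ∃ h : ℤ, ∀ i ∉ Set.Icc (-h) h,
    LinearMap.range (X.d i (i + 1)).hom = LinearMap.ker (X.d (i + 1) (i + 1 + 1)).hom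

/-- An object of the homotopy category of complexes of `Λ`-modules lies in `K^{+,b}(Λ-proj)`: it
is isomorphic in the homotopy category to a complex in `C^{+,b}(Λ-proj)`. -/
def InKPlusB (X : HomotopyCategory (ModuleCat.{u} Λ) (ComplexShape.up ℤ)) : Prop :=
  ∃ Y : CochainComplex (ModuleCat.{u} Λ) ℤ, IsPlusB Y ∧
    Nonempty (X ≅ (HomotopyCategory.quotient _ _).obj Y)

end Homotopy

end GentleAlgebra

end

open GentleAlgebra

/-!
A map from a component `Pⁿ` to a simple module vanishes on the image of `d`, since the coefficients
of `d` lie in the radical; hence such maps factor through every homotopy equivalence. For `P(A)` to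
lie in `K^{+,b}` there can thus be only finitely many generators in each degree and none in low
degrees, so the degree tends to infinity along an infinite end of `A`, where exactness in high
degrees forces every letter to be an arrow which raises the degree. Conversely, such ends are exact
in high degrees: for arrows `a` and `y` with `ay ∈ J` the kernel of right multiplication by `y` is
generated by `a`, as there is no other arrow with this property. The same uniqueness, together with
the signs, makes the maximal extensions of a finite word unique, and hence they are exactly the
words with such ends.

The band complex `P(D,V)` is bounded since `μ` is periodic, and `Pⁿ(D) ⊗ V` is a direct summand of
the sum of copies of `Λ ⊗ V` over one period, which is finitely generated if `V` is
finite-dimensional. The maps from `Pⁿ(D) ⊗ V` to `V`, regarded as a sum of copies of a simple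
module, detect the dimension of `V` in the other direction.
-/

noncomputable section

namespace GentleAlgebra

/-! ### Quadratic monomial algebras -/

section PathAlgebra

variable {k : Type u} [Field k] {Q : Type u} [Quiver.{u} Q]

theorem QPath.eq_triv_iff {p : QPath Q} {v : Q} :
    p = QPath.triv v ↔ p.head = v ∧ p.length = 0 := by
  constructor
  · rintro rfl
    exact ⟨rfl, rfl⟩
  · obtain ⟨a, b, p⟩ := p
    rintro ⟨rfl, h⟩
    obtain rfl := Quiver.Path.eq_of_length_zero p h
    rw [QPath.triv, Quiver.Path.eq_nil_of_length_zero p h]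

namespace PathAlgebra

/-- The coefficient of a path in an element of the path algebra. -/
def coeff (p : QPath Q) : PathAlgebra k Q →ₗ[k] k := (basis k).coord p

open Classical in
theorem coeff_of (p q : QPath Q) : coeff p (of k q) = if q = p then 1 else 0 := by
  rw [coeff, ← basis_apply, Module.Basis.coord_apply, Module.Basis.repr_self, Finsupp.single_apply]

theorem eq_of_coeff_of_ne_zero {p q : QPath Q} (h : coeff p (of k q) ≠ 0) : q = p := by
  classical
  rw [coeff_of] at h
  exact (ite_ne_right_iff.1 h).1

theorem sum_coeff_smul (x : PathAlgebra k Q) :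
    ∑ p ∈ ((basis k).repr x).support, coeff p x • of k p = x :=
  (basis k).linearCombination_repr x

theorem exists_of_coeff_mul_ne_zero {p : QPath Q} {x y : PathAlgebra k Q}
    (h : coeff p (x * y) ≠ 0) : ∃ (b : Q) (q : Quiver.Path p.tail b) (r : Quiver.Path b p.head),
      coeff ⟨b, p.head, r⟩ x ≠ 0 ∧ coeff ⟨p.tail, b, q⟩ y ≠ 0 ∧ p.path = q.comp r := by
  rw [← sum_coeff_smul x, ← sum_coeff_smul y, mul_def] at h
  simp only [map_sum, LinearMap.sum_apply, map_smul, LinearMap.smul_apply, ← mul_def] at h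
  obtain ⟨⟨a', b', q⟩, hq, h⟩ := Finset.exists_ne_zero_of_sum_ne_zero h
  obtain ⟨⟨a, b, r⟩, hr, h⟩ := Finset.exists_ne_zero_of_sum_ne_zero (right_ne_zero_of_smul h)
  rw [Finsupp.mem_support_iff] at hq hr
  have h1 := right_ne_zero_of_smul h
  by_cases hab : b' = a
  · subst hab
    rw [of_mul_of_comp] at h1
    obtain rfl := eq_of_coeff_of_ne_zero h1
    exact ⟨b', q, r, hr, hq, rfl⟩
  · rw [of_mul_of_ne k (p := ⟨a, b, r⟩) hab, map_zero] at h1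
    exact absurd rfl h1

theorem coeff_comp_mul_of {a b c : Q} (q : Quiver.Path a b) (p : Quiver.Path b c)
    (x : PathAlgebra k Q) :
    coeff ⟨a, c, q.comp p⟩ (x * of k ⟨a, b, q⟩) = coeff ⟨b, c, p⟩ x := by
  classical
  induction x using induction with
  | h0 => simp [PathAlgebra.zero_mul]
  | hadd x y hx hy => rw [PathAlgebra.add_mul, map_add, map_add, hx, hy]
  | hof r p' =>
    rw [PathAlgebra.smul_mul, map_smul, map_smul]
    congr 1
    obtain ⟨b', c', p'⟩ := p'
    by_cases hb : b = b'
    · subst hb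
      rw [of_mul_of_comp, coeff_of, coeff_of]
      congr 1
      by_cases hc : c' = c
      · subst hc
        simp [Quiver.Path.comp_inj_right]
      · simp [hc]
    · rw [of_mul_of_ne k hb, map_zero, coeff_of, if_neg]
      exact fun h => hb (congrArg QPath.tail h).symm

theorem coeff_triv_mul (v : Q) (x y : PathAlgebra k Q) :
    coeff (QPath.triv v) (x * y) = coeff (QPath.triv v) x * coeff (QPath.triv v) y := by
  classical
  induction x using induction with
  | h0 => simp [PathAlgebra.zero_mul]
  | hadd x x' hx hx' => rw [PathAlgebra.add_mul, map_add, map_add, hx, hx', add_mul]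
  | hof c p =>
    induction y using induction with
    | h0 => simp [PathAlgebra.mul_zero]
    | hadd y y' hy hy' => rw [PathAlgebra.mul_add, map_add, map_add, hy, hy', mul_add]
    | hof d q =>
      suffices h : coeff (QPath.triv v) (of k p * of k q) =
          coeff (QPath.triv v) (of k p) * coeff (QPath.triv v) (of k q) by
        rw [PathAlgebra.smul_mul, PathAlgebra.mul_smul]
        simp only [map_smul, smul_eq_mul, h]
        ring
      obtain ⟨a, b, p⟩ := p
      obtain ⟨a', b', q⟩ := q
      by_cases hab : b' = a
      · subst hab
        rw [of_mul_of_comp, coeff_of, coeff_of, coeff_of, ite_zero_mul_ite_zero, one_mul]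
        refine if_congr ?_ rfl rfl
        simp only [QPath.eq_triv_iff, QPath.length, Quiver.Path.length_comp, Nat.add_eq_zero_iff]
        refine ⟨fun h => ?_, fun h => ⟨h.1.1, h.2.2, h.1.2⟩⟩
        exact ⟨⟨h.1, h.2.2⟩, (Quiver.Path.eq_of_length_zero p h.2.2).trans h.1, h.2.1⟩
      · rw [of_mul_of_ne k (p := ⟨a, b, p⟩) hab, map_zero, coeff_of, coeff_of,
          ite_zero_mul_ite_zero, if_neg]
        rintro ⟨hp, hq⟩
        exact hab ((congrArg QPath.head hq).trans (congrArg QPath.tail hp).symm)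

variable [Fintype Q]

theorem coeff_triv_one (v : Q) : coeff (QPath.triv v) (1 : PathAlgebra k Q) = 1 := by
  classical
  have h (w : Q) : QPath.triv w = QPath.triv v ↔ w = v :=
    QPath.eq_triv_iff.trans (and_iff_left rfl)
  rw [one_def, map_sum]
  simp [coeff_of, h]

/-- The `k`-algebra homomorphism by which `kQ` acts on the simple module at the vertex `v`. -/
def vertexHom (v : Q) : PathAlgebra k Q →ₐ[k] k :=
  AlgHom.ofLinearMap (coeff (QPath.triv v)) (coeff_triv_one v) (coeff_triv_mul v)

end PathAlgebra

end PathAlgebra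

section MonomialIdeals

variable {k : Type u} [Field k] {Q : Type u} [Quiver.{u} Q] [Fintype Q]
  {J : TwoSidedIdeal (PathAlgebra k Q)}

variable (k) in
/-- The two-sided ideal of `kQ` spanned by the paths with the property `P`, where `P` is inherited
by every path which contains a path with this property. -/
def monomialIdeal (P : QPath Q → Prop)
    (comp_right : ∀ {a b c : Q} (p : Quiver.Path a b) (q : Quiver.Path b c),
      P ⟨a, b, p⟩ → P ⟨a, c, p.comp q⟩)
    (comp_left : ∀ {a b c : Q} (p : Quiver.Path a b) (q : Quiver.Path b c),
      P ⟨b, c, q⟩ → P ⟨a, c, p.comp q⟩) : TwoSidedIdeal (PathAlgebra k Q) :=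
  .mk' {x | ∀ p, PathAlgebra.coeff p x ≠ 0 → P p}
    (fun p hp => absurd (map_zero _) hp)
    (fun {x y} hx hy p hp => by
      by_contra hP
      have hxp := not_not.1 (mt (hx p) hP)
      have hyp := not_not.1 (mt (hy p) hP)
      exact hp (by rw [map_add, hxp, hyp, add_zero]))
    (fun hx p hp => hx p (by rwa [map_neg, neg_ne_zero] at hp))
    (fun {x y} hy p hp => by
      obtain ⟨b, q, r, -, hq, h⟩ := PathAlgebra.exists_of_coeff_mul_ne_zero hp
      exact (congrArg P (congrArg (QPath.mk _ _) h)).mpr (comp_right q r (hy _ hq)))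
    (fun {x y} hx p hp => by
      obtain ⟨b, q, r, hr, -, h⟩ := PathAlgebra.exists_of_coeff_mul_ne_zero hp
      exact (congrArg P (congrArg (QPath.mk _ _) h)).mpr (comp_left q r (hx _ hr)))

/-- The ideal `J` is generated by paths of length `2`, that is, `kQ / J` is a quadratic monomial
algebra. -/
def IsQuadratic (J : TwoSidedIdeal (PathAlgebra k Q)) : Prop :=
  ∃ S : Set (QPath Q), (∀ p ∈ S, p.length = 2) ∧ J = TwoSidedIdeal.span (PathAlgebra.of k '' S)

variable (J) in
/-- The path contains two consecutive arrows whose product lies in `J`. -/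
def HasRelation {a : Q} : {b : Q} → Quiver.Path a b → Prop
  | _, .nil => False
  | _, .cons .nil _ => False
  | _, .cons (.cons q f) e =>
    HasRelation (q.cons f) ∨ arrow k ⟨_, _, e⟩ * arrow k ⟨_, _, f⟩ ∈ J

namespace HasRelation

theorem cons {a b c : Q} {p : Quiver.Path a b} (h : HasRelation J p) (e : b ⟶ c) :
    HasRelation J (p.cons e) := by
  cases p with
  | nil => exact h.elim
  | cons q f => exact Or.inl h

theorem comp_right {a b c : Q} {p : Quiver.Path a b} (h : HasRelation J p)
    (q : Quiver.Path b c) : HasRelation J (p.comp q) := by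
  induction q with
  | nil => exact h
  | cons q e ih => exact ih.cons e

theorem comp_left {a b : Q} (p : Quiver.Path a b) :
    ∀ {c : Q} {q : Quiver.Path b c}, HasRelation J q → HasRelation J (p.comp q)
  | _, .nil, h => h.elim
  | _, .cons .nil _, h => h.elim
  | _, .cons (.cons _ _) _, h => h.elim (fun h => Or.inl (comp_left p h)) Or.inr

theorem two_le_length {a : Q} : ∀ {b : Q} {p : Quiver.Path a b}, HasRelation J p → 2 ≤ p.length
  | _, .nil, h => h.elim
  | _, .cons .nil _, h => h.elim
  | _, .cons (.cons _ _) _, _ => Nat.le_add_left 2 _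

theorem of_mem {a : Q} : ∀ {b : Q} {p : Quiver.Path a b}, HasRelation J p →
    PathAlgebra.of k ⟨a, b, p⟩ ∈ J
  | _, .nil, h => h.elim
  | _, .cons .nil _, h => h.elim
  | _, .cons (.cons q f) e, h => by
    rw [PathAlgebra.of_cons]
    rcases h with h | h
    · exact J.mul_mem_left _ _ h.of_mem
    · rw [PathAlgebra.of_cons, ← mul_assoc]
      exact J.mul_mem_right _ _ h

theorem of_toPath_comp (y : Arrow Q) : ∀ {c : Q} {p : Quiver.Path y.head c},
    HasRelation J (y.hom.toPath.comp p) → HasRelation J p ∨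
      ∃ x : Arrow Q, x.tail = y.head ∧ arrow k x * arrow k y ∈ J ∧
        ∃ z, PathAlgebra.of k ⟨y.head, c, p⟩ = z * arrow k x
  | _, .nil, h => h.elim
  | _, .cons .nil e, h => by
    refine Or.inr ⟨⟨_, _, e⟩, rfl, h.resolve_left id, 1, ?_⟩
    rw [one_mul]
    rfl
  | _, .cons (.cons q f) e, h => by
    rcases h with h | h
    · rcases of_toPath_comp y (p := q.cons f) h with h1 | ⟨x, h1, h2, z, hz⟩
      · exact Or.inl (Or.inl h1)
      · refine Or.inr ⟨x, h1, h2, arrow k ⟨_, _, e⟩ * z, ?_⟩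
        rw [PathAlgebra.of_cons, hz, mul_assoc]
        rfl
    · exact Or.inl (Or.inr h)

theorem of_length_eq_two : ∀ {p : QPath Q}, PathAlgebra.of k p ∈ J → p.length = 2 →
    HasRelation J p.path
  | ⟨_, _, .nil⟩, _, h => by simp [QPath.length] at h
  | ⟨_, _, .cons .nil _⟩, _, h => by simp [QPath.length] at h
  | ⟨_, _, .cons (.cons .nil _) _⟩, h, _ => Or.inr (by rwa [PathAlgebra.of_cons] at h)
  | ⟨_, _, .cons (.cons (.cons _ _) _) _⟩, _, h => by simp [QPath.length] at h

end HasRelation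

namespace IsQuadratic

theorem hasRelation_of_coeff_ne_zero (hJ : IsQuadratic J) {x : PathAlgebra k Q} (hx : x ∈ J)
    {p : QPath Q} (hp : PathAlgebra.coeff p x ≠ 0) : HasRelation J p.path := by
  obtain ⟨S, hS, hJS⟩ := hJ
  let I := monomialIdeal k (fun p : QPath Q => HasRelation J p.path)
    (fun _ q h => h.comp_right q) (fun p _ h => h.comp_left p)
  suffices h : J ≤ I from (TwoSidedIdeal.mem_mk' ..).1 (h hx) p hp
  conv_lhs => rw [hJS]
  rw [TwoSidedIdeal.span_le]
  rintro _ ⟨q, hq, rfl⟩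
  have hqJ : PathAlgebra.of k q ∈ J := hJS ▸ TwoSidedIdeal.subset_span ⟨q, hq, rfl⟩
  refine (TwoSidedIdeal.mem_mk' ..).2 fun p hp => ?_
  obtain rfl := PathAlgebra.eq_of_coeff_of_ne_zero hp
  exact .of_length_eq_two hqJ (hS q hq)

theorem coeff_eq_zero (hJ : IsQuadratic J) {x : PathAlgebra k Q} (hx : x ∈ J) {p : QPath Q}
    (hp : p.length < 2) : PathAlgebra.coeff p x = 0 := by
  by_contra h
  exact hp.not_ge (hJ.hasRelation_of_coeff_ne_zero hx h).two_le_length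

/-- The ring homomorphism by which `Λ` acts on the simple module at the vertex `v`. -/
def vertexHom (hJ : IsQuadratic J) (v : Q) : Lam J →+* k :=
  J.ringCon.lift (PathAlgebra.vertexHom v).toRingHom fun x y h => by
    have hxy := hJ.coeff_eq_zero ((TwoSidedIdeal.rel_iff J x y).1 h) (p := .triv v) two_pos
    rwa [map_sub, sub_eq_zero] at hxy

theorem vertexHom_mk (hJ : IsQuadratic J) (v : Q) (x : PathAlgebra k Q) :
    hJ.vertexHom v (J.ringCon.mk' x) = PathAlgebra.coeff (QPath.triv v) x := rfl

theorem vertexHom_idem (hJ : IsQuadratic J) (v : Q) : hJ.vertexHom v (idem J v) = 1 := by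
  classical
  rw [idem, pathClass, vertexHom_mk, PathAlgebra.coeff_of, if_pos rfl]

theorem vertexHom_pathClass (hJ : IsQuadratic J) (v : Q) (γ : NPath Q) :
    hJ.vertexHom v (pathClass J γ.toQPath) = 0 := by
  classical
  rw [pathClass, vertexHom_mk, PathAlgebra.coeff_of, if_neg]
  exact fun h => Nat.succ_ne_zero _ (congrArg QPath.length h)

theorem vertexHom_algebraMap (hJ : IsQuadratic J) (v : Q) (c : k) :
    hJ.vertexHom v (algebraMap k (Lam J) c) = c :=
  (PathAlgebra.vertexHom v).commutes c

theorem length_le_of_mul_eq_pathClass (hJ : IsQuadratic J) {p q : QPath Q} (hq : q.length < 2)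
    {z : Lam J} (h : z * pathClass J p = pathClass J q) : p.length ≤ q.length := by
  classical
  obtain ⟨z, rfl⟩ := J.ringCon.mk'_surjective z
  rw [pathClass, pathClass, ← map_mul, ← sub_eq_zero, ← map_sub, mk_eq_zero_iff] at h
  have hcoeff := hJ.coeff_eq_zero h hq
  rw [map_sub, PathAlgebra.coeff_of, if_pos rfl, sub_eq_zero] at hcoeff
  obtain ⟨b, p', r, -, hp, hqr⟩ :=
    PathAlgebra.exists_of_coeff_mul_ne_zero (hcoeff.trans_ne one_ne_zero)
  obtain rfl := PathAlgebra.eq_of_coeff_of_ne_zero hp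
  rw [QPath.length, QPath.length, hqr, Quiver.Path.length_comp]
  exact Nat.le_add_right _ _

end IsQuadratic

theorem mk_mem_of_forall_coeff {L : Ideal (Lam J)} {x : PathAlgebra k Q}
    (h : ∀ p, PathAlgebra.coeff p x ≠ 0 → pathClass J p ∈ L) : J.ringCon.mk' x ∈ L := by
  rw [← PathAlgebra.sum_coeff_smul x, map_sum]
  refine L.sum_mem fun p hp => ?_
  rw [Algebra.smul_def, map_mul]
  exact L.mul_mem_left _ (h p (Finsupp.mem_support_iff.1 hp))

theorem IsQuadratic.mem_span_of_mul_arrow_eq_zero (hJ : IsQuadratic J) {y : Arrow Q} {x : Lam J}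
    (hx : x * idem J y.head = x) (hxy : x * pathClass J (QPath.ofArrow y) = 0) :
    x ∈ Ideal.span ((fun a => pathClass J (QPath.ofArrow a)) ''
      {a : Arrow Q | a.tail = y.head ∧ arrow k a * arrow k y ∈ J}) := by
  obtain ⟨x, rfl⟩ := J.ringCon.mk'_surjective x
  rw [idem, pathClass, ← map_mul] at hx
  rw [← hx, pathClass, ← map_mul, mk_eq_zero_iff] at hxy
  rw [← hx]
  refine mk_mem_of_forall_coeff fun ⟨b, c, p⟩ hp => ?_
  obtain ⟨_, _, _, -, hq, -⟩ := PathAlgebra.exists_of_coeff_mul_ne_zero hp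
  obtain rfl : y.head = b := congrArg QPath.tail (PathAlgebra.eq_of_coeff_of_ne_zero hq)
  have hrel := hJ.hasRelation_of_coeff_ne_zero hxy
    (p := ⟨y.tail, c, y.hom.toPath.comp p⟩)
    (by rw [QPath.ofArrow, PathAlgebra.coeff_comp_mul_of]; exact hp)
  rcases hrel.of_toPath_comp with h | ⟨a, ha, hay, z, hz⟩
  · rw [pathClass, (mk_eq_zero_iff J _).2 h.of_mem]
    exact Ideal.zero_mem _
  · rw [pathClass, hz, map_mul]
    exact Ideal.mul_mem_left _ _ (Ideal.subset_span ⟨a, ⟨ha, hay⟩, rfl⟩)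

theorem idem_mul_pathClass (p : QPath Q) : idem J p.head * pathClass J p = pathClass J p :=
  (pathClass_comp J .nil p.path).trans (by rw [Quiver.Path.comp_nil])

theorem idem_mul_idem (v : Q) : idem J v * idem J v = idem J v :=
  pathClass_mul_idem J (QPath.triv v)

end MonomialIdeals

/-! ### Homotopy equivalence and bounded cohomology -/

section Homotopy

variable {Λ : Type u} [Ring Λ] {X Y : CochainComplex (ModuleCat.{u} Λ) ℤ}

theorem exactAt_iff_range_eq_ker {l n m : ℤ} (hl : l + 1 = n) (hm : n + 1 = m) :
    X.ExactAt n ↔ LinearMap.range (X.d l n).hom = LinearMap.ker (X.d n m).hom := by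
  rw [X.exactAt_iff' l n m (by simp [← hl]) (by simp [← hm]),
    ShortComplex.moduleCat_exact_iff_range_eq_ker]
  rfl

theorem IsPlusB.exists_forall_exactAt (hX : IsPlusB X) : ∃ b : ℤ, ∀ n > b, X.ExactAt n := by
  obtain ⟨h, hh⟩ := hX.boundedCohomology
  refine ⟨h + 1, fun n hn => ?_⟩
  have hexact := hh (n - 1) (by rw [Set.mem_Icc]; omega)
  rw [sub_add_cancel] at hexact
  exact (exactAt_iff_range_eq_ker (sub_add_cancel n 1) rfl).2 hexact

theorem IsPlusB.of_forall_exactAt (hproj : ∀ i, Module.Projective Λ (X.X i))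
    (hfin : ∀ i, Module.Finite Λ (X.X i)) (hleft : ∃ n : ℤ, ∀ i < n, Subsingleton (X.X i))
    (hexact : ∃ b : ℤ, ∀ n > b, X.ExactAt n) : IsPlusB X where
  projective := hproj
  finite := hfin
  leftBounded := hleft
  boundedCohomology := by
    obtain ⟨a, ha⟩ := hleft
    obtain ⟨b, hb⟩ := hexact
    refine ⟨|a| + |b| + 1, fun i hi => (exactAt_iff_range_eq_ker rfl rfl).1 ?_⟩
    rw [Set.mem_Icc, not_and_or] at hi
    rcases hi with hlow | hhigh
    · have := ha (i + 1) (by linarith [neg_abs_le a, abs_nonneg b])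
      exact .of_isZero (ModuleCat.isZero_of_subsingleton _)
    · exact hb (i + 1) (by linarith [le_abs_self b, abs_nonneg a])

theorem exactAt_shift_iff (n i : ℤ) : (X⟦n⟧).ExactAt i ↔ X.ExactAt (n + i) :=
  ShortComplex.exact_iff_of_iso
    ((CochainComplex.shiftShortComplexFunctorIso (ModuleCat.{u} Λ) n i (n + i) rfl).app X)

theorem IsPlusB.shift (hX : IsPlusB X) (n : ℤ) : IsPlusB (X⟦n⟧) := by
  obtain ⟨a, ha⟩ := hX.leftBounded
  obtain ⟨b, hb⟩ := hX.exists_forall_exactAt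
  exact .of_forall_exactAt (fun i => hX.projective (i + n)) (fun i => hX.finite (i + n))
    ⟨a - n, fun i hi => ha (i + n) (by omega)⟩
    ⟨b - n, fun i hi => (exactAt_shift_iff n i).2 (hb (n + i) (by omega))⟩

theorem InKPlusB.of_iso {X X' : HomotopyCategory (ModuleCat.{u} Λ) (ComplexShape.up ℤ)}
    (e : X ≅ X') (h : InKPlusB X) : InKPlusB X' := by
  obtain ⟨Y, hY, ⟨f⟩⟩ := h
  exact ⟨Y, hY, ⟨e.symm ≪≫ f⟩⟩

theorem InKPlusB.shift {X : HomotopyCategory (ModuleCat.{u} Λ) (ComplexShape.up ℤ)}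
    (h : InKPlusB X) (n : ℤ) : InKPlusB (X⟦n⟧) := by
  obtain ⟨Y, hY, ⟨f⟩⟩ := h
  exact ⟨Y⟦n⟧, hY.shift n, ⟨(shiftFunctor _ n).mapIso f ≪≫
    (((HomotopyCategory.quotient _ _).commShiftIso n).app Y).symm⟩⟩

theorem inKPlusB_shift_iff {X : HomotopyCategory (ModuleCat.{u} Λ) (ComplexShape.up ℤ)} (n : ℤ) :
    InKPlusB (X⟦n⟧) ↔ InKPlusB X :=
  ⟨fun h => (h.shift (-n)).of_iso (shiftShiftNeg X n), fun h => h.shift n⟩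

theorem inKPlusB_quotient_iff : InKPlusB ((HomotopyCategory.quotient _ _).obj X) ↔
    ∃ Y, IsPlusB Y ∧ Nonempty (HomotopyEquiv X Y) :=
  ⟨fun ⟨Y, hY, ⟨f⟩⟩ => ⟨Y, hY, ⟨HomotopyCategory.homotopyEquivOfIso f⟩⟩,
    fun ⟨Y, hY, ⟨e⟩⟩ => ⟨Y, hY, ⟨HomotopyCategory.isoOfHomotopyEquiv e⟩⟩⟩

theorem exists_forall_exactAt_of_homotopyEquiv (e : HomotopyEquiv X Y) (hY : IsPlusB Y) :
    ∃ b : ℤ, ∀ n > b, X.ExactAt n := by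
  have : QuasiIso e.hom := e.quasiIso_hom
  simp only [exactAt_iff_of_quasiIsoAt e.hom]
  exact hY.exists_forall_exactAt

theorem map_inv_hom_apply {R W : Type*} [Ring R] {σ : Λ →+* R} [AddCommGroup W] [Module R W]
    (hX : ∀ (n m : ℤ) (φ : X.X m →ₛₗ[σ] W) (x : X.X n), n + 1 = m → φ (X.d n m x) = 0)
    (e : HomotopyEquiv X Y) {n : ℤ} (φ : X.X n →ₛₗ[σ] W) (x : X.X n) :
    φ (e.inv.f n (e.hom.f n x)) = φ x := by
  have hcomm := e.homotopyHomInvId.comm n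
  rw [dNext_eq _ (show (ComplexShape.up ℤ).Rel n (n + 1) from rfl),
    prevD_eq _ (show (ComplexShape.up ℤ).Rel (n - 1) n from sub_add_cancel n 1)] at hcomm
  have hx : e.inv.f n (e.hom.f n x) = e.homotopyHomInvId.hom (n + 1) n (X.d n (n + 1) x) +
      X.d (n - 1) n (e.homotopyHomInvId.hom n (n - 1) x) + x :=
    congrArg (fun f : X.X n ⟶ X.X n => f x) hcomm
  have hright : φ (e.homotopyHomInvId.hom (n + 1) n (X.d n (n + 1) x)) = 0 :=
    hX n (n + 1) (φ.comp (e.homotopyHomInvId.hom (n + 1) n).hom) x rfl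
  rw [hx, map_add, map_add, hright, hX _ _ _ _ (sub_add_cancel n 1), zero_add, zero_add]

end Homotopy

/-! ### The differential of a string complex -/

section Steps

variable {k : Type u} [Field k] {Q : Type u} [Quiver.{u} Q] [Fintype Q]
  {J : TwoSidedIdeal (PathAlgebra k Q)}

namespace PreWord

/-- The differential of `P(C)` has a component from the `i`-th to the `j`-th summand, and it is
right multiplication by the path of the letter `l`. -/
def Step (C : PreWord J) (i j : ℤ) (l : Letter J) : Prop :=
  (j = i + 1 ∧ C.letterAt j = some l ∧ l.isInv = true) ∨
    (j = i - 1 ∧ C.letterAt i = some l ∧ l.isInv = false)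

variable {C : PreWord J} {h i j m n : ℤ} {l l' : Letter J}

theorem step_or_step (h : C.letterAt (i + 1) = some l) :
    C.Step i (i + 1) l ∨ C.Step (i + 1) i l := by
  cases hinv : l.isInv with
  | true => exact .inl (.inl ⟨rfl, h, hinv⟩)
  | false => exact .inr (.inr ⟨(add_sub_cancel_right i 1).symm, h, hinv⟩)

theorem bPlus_apply_of_ne (h : j ≠ i + 1) : C.bPlus i j = 0 := by
  unfold bPlus
  split
  · split_ifs
    · exact Finsupp.single_eq_of_ne h
    · rfl
  · rfl

theorem bMinus_apply_of_ne (h : j ≠ i - 1) : C.bMinus i j = 0 := by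
  unfold bMinus
  split
  · split_ifs
    · rfl
    · exact Finsupp.single_eq_of_ne h
  · rfl

namespace Step

theorem eq_add_one_or_eq_sub_one (h : C.Step i j l) : j = i + 1 ∨ j = i - 1 :=
  h.imp And.left And.left

theorem vertexAt_left (hC : C.IsWord) (h : C.Step i j l) : C.vertexAt i = some l.path.head := by
  rcases h with ⟨rfl, hl, hinv⟩ | ⟨-, hl, hinv⟩
  · rw [vertexAt_of_letterAt_succ hC hl, Letter.head, if_pos hinv]
  · rw [vertexAt_of_letterAt hl, Letter.tail, hinv]
    rfl

theorem vertexAt_right (hC : C.IsWord) (h : C.Step i j l) : C.vertexAt j = some l.path.tail := by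
  rcases h with ⟨-, hl, hinv⟩ | ⟨rfl, hl, hinv⟩
  · rw [vertexAt_of_letterAt hl, Letter.tail, if_pos hinv]
  · rw [vertexAt_of_letterAt_succ hC (l := l) (by rwa [sub_add_cancel]), Letter.head, hinv]
    rfl

theorem mu_eq (h : C.Step i j l) : C.mu j = C.mu i + 1 := by
  rcases h with ⟨rfl, hl, hinv⟩ | ⟨rfl, hl, hinv⟩
  · rw [mu_succ, degAt, hl, Option.map_some, Option.getD_some, Letter.deg, if_pos hinv]
  · have hmu := C.mu_succ (i - 1)
    rw [sub_add_cancel, degAt, hl, Option.map_some, Option.getD_some, Letter.deg, hinv] at hmu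
    rw [hmu]
    exact (neg_add_cancel_right _ _).symm

theorem mul_mem (hC : C.IsWord) (h : C.Step i j l) (h' : C.Step j m l') :
    arrow k l.path.first * arrow k l'.path.last ∈ J := by
  rcases h with ⟨rfl, hl, hinv⟩ | ⟨rfl, hl, hinv⟩ <;>
    rcases h' with ⟨rfl, hl', hinv'⟩ | ⟨rfl, hl', hinv'⟩
  · have hadj := hC.adj hl hl'
    rw [Letter.Adj, hinv, hinv'] at hadj
    exact hadj.2
  · simp_all
  · rw [sub_add_cancel] at hl'
    simp_all
  · have hadj := hC.adj hl' (b := l) (by rwa [sub_add_cancel])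
    rw [Letter.Adj, hinv, hinv'] at hadj
    exact hadj.2

theorem eq_source {i' : ℤ} {l'' : Letter J} (h₁ : C.Step h i l) (h₂ : C.Step i j l')
    (h₃ : C.Step i' i l'') : i' = h := by
  have := h₁.eq_add_one_or_eq_sub_one
  have := h₂.eq_add_one_or_eq_sub_one
  have := h₃.eq_add_one_or_eq_sub_one
  have := h₁.mu_eq
  have := h₂.mu_eq
  have := h₃.mu_eq
  have : j ≠ h := by rintro rfl; omega
  have : j ≠ i' := by rintro rfl; omega
  omega

theorem eq_target {j' : ℤ} {l'' : Letter J} (h₁ : C.Step h i l) (h₂ : C.Step i j l')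
    (h₃ : C.Step i j' l'') : j' = j := by
  have := h₁.eq_add_one_or_eq_sub_one
  have := h₂.eq_add_one_or_eq_sub_one
  have := h₃.eq_add_one_or_eq_sub_one
  have := h₁.mu_eq
  have := h₂.mu_eq
  have := h₃.mu_eq
  have : h ≠ j := by rintro rfl; omega
  have : h ≠ j' := by rintro rfl; omega
  omega

theorem bMinus_add_bPlus_apply (h : C.Step i j l) : (C.bMinus i + C.bPlus i) j = l.cls := by
  rcases h with ⟨rfl, hl, hinv⟩ | ⟨rfl, hl, hinv⟩
  · rw [Finsupp.add_apply, bMinus_apply_of_ne (by omega), zero_add, bPlus, hl]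
    simp [hinv]
  · rw [Finsupp.add_apply, bPlus_apply_of_ne (by omega), add_zero, bMinus, hl]
    simp [hinv]

theorem diff_single_apply (h : C.Step i j l) (x : Lam J) :
    C.diff (Finsupp.single i x) j = x * l.cls := by
  rw [diff_single, Finsupp.smul_apply, h.bMinus_add_bPlus_apply, smul_eq_mul]

end Step

theorem exists_step_of_bMinus_add_bPlus_apply_ne_zero (h : (C.bMinus i + C.bPlus i) j ≠ 0) :
    ∃ l, C.Step i j l := by
  rcases eq_or_ne j (i + 1) with rfl | hplus
  · rw [Finsupp.add_apply, bMinus_apply_of_ne (by omega), zero_add] at h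
    unfold bPlus at h
    split at h
    next l hl => exact ⟨l, .inl ⟨rfl, hl, by_contra fun hinv => h (by simp [hinv])⟩⟩
    next => exact absurd rfl h
  rcases eq_or_ne j (i - 1) with rfl | hminus
  · rw [Finsupp.add_apply, bPlus_apply_of_ne hplus, add_zero] at h
    unfold bMinus at h
    split at h
    next l hl =>
      exact ⟨l, .inr ⟨rfl, hl, Bool.eq_false_iff.2 fun hinv => h (by simp [hinv])⟩⟩
    next => exact absurd rfl h
  · rw [Finsupp.add_apply, bPlus_apply_of_ne hplus, bMinus_apply_of_ne hminus, add_zero] at h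
    exact absurd rfl h

theorem diff_single_apply_eq_zero (h : ∀ l, ¬ C.Step i j l) (x : Lam J) :
    C.diff (Finsupp.single i x) j = 0 := by
  rw [diff_single, Finsupp.smul_apply, by_contra fun hne =>
    not_exists.2 h (exists_step_of_bMinus_add_bPlus_apply_ne_zero hne), smul_zero]

theorem Step.diff_single (h : C.Step i j l) (hu : ∀ j' l', C.Step i j' l' → j' = j) (x : Lam J) :
    C.diff (Finsupp.single i x) = Finsupp.single j (x * l.cls) := by
  ext j'
  rcases eq_or_ne j' j with rfl | hne
  · rw [h.diff_single_apply, Finsupp.single_eq_same]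
  · rw [Finsupp.single_eq_of_ne hne, diff_single_apply_eq_zero]
    exact fun l' h' => hne (hu _ _ h')

theorem Step.diff_apply (h : C.Step i j l) (hu : ∀ i' l', C.Step i' j l' → i' = i)
    (f : ℤ →₀ Lam J) : C.diff f j = f i * l.cls := by
  induction f using Finsupp.induction_linear with
  | zero => simp
  | add f g hf hg => rw [map_add, Finsupp.add_apply, hf, hg, Finsupp.add_apply, add_mul]
  | single i' x =>
    rcases eq_or_ne i i' with rfl | hne
    · rw [h.diff_single_apply, Finsupp.single_eq_same]
    · rw [diff_single_apply_eq_zero, Finsupp.single_eq_of_ne hne, zero_mul]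
      exact fun l' h' => hne (hu _ _ h').symm

theorem diff_apply_mem_span (f : ℤ →₀ Lam J) (j : ℤ) :
    C.diff f j ∈ Ideal.span (Set.range (Letter.cls (J := J))) := by
  induction f using Finsupp.induction_linear with
  | zero => simp
  | add f g hf hg =>
    rw [map_add]
    exact add_mem hf hg
  | single i x =>
    by_cases h : ∃ l, C.Step i j l
    · obtain ⟨l, hl⟩ := h
      rw [hl.diff_single_apply]
      exact Ideal.mul_mem_left _ _ (Ideal.subset_span ⟨l, rfl⟩)
    · rw [diff_single_apply_eq_zero (not_exists.1 h)]
      exact zero_mem _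

theorem vertexHom_diff_apply (hJ : IsQuadratic J) (v : Q) (f : ℤ →₀ Lam J) (j : ℤ) :
    hJ.vertexHom v (C.diff f j) = 0 := by
  refine (Ideal.span_le (I := RingHom.ker (hJ.vertexHom v))).2 ?_ (diff_apply_mem_span f j)
  rintro _ ⟨l, rfl⟩
  exact hJ.vertexHom_pathClass v l.path

end PreWord

end Steps

section Generators

variable {k : Type u} [Field k] {Q : Type u} [Quiver.{u} Q] [Fintype Q]
  {J : TwoSidedIdeal (PathAlgebra k Q)}

namespace PreWord

variable {C : PreWord J} {i n : ℤ}

/-- The idempotent of the vertex `v_C(i)`, and zero outside the index set of `C`. -/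
def idemAt (C : PreWord J) (i : ℤ) : Lam J := (C.vertexAt i).elim 0 (idem J)

/-- The set of the `i` for which `b_i` is a generator of `Pⁿ(C)`. -/
def indexSet (C : PreWord J) (n : ℤ) : Set ℤ := {i | C.mu i = n ∧ ∃ v, C.vertexAt i = some v}

theorem idemAt_of_vertexAt {v : Q} (hv : C.vertexAt i = some v) : C.idemAt i = idem J v := by
  rw [idemAt, hv]
  rfl

theorem mem_stalk_iff {x : Lam J} :
    x ∈ C.stalk n i ↔ (C.mu i ≠ n → x = 0) ∧ x * C.idemAt i = x := by
  unfold stalk idemAt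
  split_ifs with hn
  · rcases C.vertexAt i with _ | v
    · simp [hn, eq_comm]
    · refine Ideal.mem_span_singleton'.trans ⟨?_, fun h => ⟨x, h.2⟩⟩
      rintro ⟨y, rfl⟩
      exact ⟨fun hne => absurd hn hne, by rw [Option.elim_some, mul_assoc, idem_mul_idem]⟩
  · simp only [Submodule.mem_bot, ne_eq, hn, not_false_eq_true, forall_const]
    exact ⟨fun h => ⟨h, by rw [h, zero_mul]⟩, And.left⟩

/-- The generator `b_i` as an element of `Pⁿ(C)`, and zero if `i` is not in `C.indexSet n`. -/
def gen (C : PreWord J) (n i : ℤ) : C.comp n :=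
  ⟨Finsupp.single i (if C.mu i = n then C.idemAt i else 0), single_mem_comp (mem_stalk_iff.2 (by
    split_ifs with hn
    · refine ⟨fun hne => absurd hn hne, ?_⟩
      unfold idemAt
      rcases C.vertexAt i with _ | v
      · exact zero_mul _
      · exact idem_mul_idem v
    · exact ⟨fun _ => rfl, zero_mul _⟩))⟩

theorem coe_gen {v : Q} (hn : C.mu i = n) (hv : C.vertexAt i = some v) :
    (C.gen n i).1 = Finsupp.single i (idem J v) :=
  congrArg (Finsupp.single i) (by rw [if_pos hn, idemAt_of_vertexAt hv])

theorem gen_eq_zero (h : i ∉ C.indexSet n) : C.gen n i = 0 := by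
  refine Subtype.ext (Finsupp.single_eq_zero.2 ?_)
  split_ifs with hn
  · rw [idemAt, Option.eq_none_iff_forall_ne_some.2 fun v hv => h ⟨hn, v, hv⟩]
    rfl
  · rfl

theorem coe_smul_gen (f : C.comp n) (i : ℤ) :
    (f.1 i • C.gen n i).1 = Finsupp.single i (f.1 i) := by
  obtain ⟨hzero, hidem⟩ := mem_stalk_iff.1 (f.2 i)
  refine (Finsupp.smul_single _ _ _).trans (congrArg _ ?_)
  split_ifs with hn
  · exact hidem
  · rw [hzero hn, smul_zero]

theorem sum_smul_gen (f : C.comp n) : ∑ i ∈ f.1.support, f.1 i • C.gen n i = f := by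
  refine Subtype.ext ?_
  simp only [AddSubmonoidClass.coe_finsetSum, coe_smul_gen]
  exact Finsupp.sum_single f.1

instance projective_comp (C : PreWord J) (n : ℤ) : Module.Projective (Lam J) (C.comp n) :=
  .of_split (C.comp n).subtype (Finsupp.linearCombination (Lam J) (C.gen n))
    (LinearMap.ext sum_smul_gen)

theorem span_gen (C : PreWord J) (n : ℤ) :
    Submodule.span (Lam J) (C.gen n '' C.indexSet n) = ⊤ := by
  refine eq_top_iff.2 fun f _ => ?_
  rw [← sum_smul_gen f]
  refine Submodule.sum_mem _ fun i _ => Submodule.smul_mem _ _ ?_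
  by_cases hi : i ∈ C.indexSet n
  · exact Submodule.subset_span ⟨i, hi, rfl⟩
  · rw [gen_eq_zero hi]
    exact zero_mem _

theorem finite_comp (h : (C.indexSet n).Finite) : Module.Finite (Lam J) (C.comp n) :=
  ⟨Submodule.fg_def.2 ⟨_, h.image _, C.span_gen n⟩⟩

theorem subsingleton_comp (h : C.indexSet n = ∅) : Subsingleton (C.comp n) := by
  rw [← Submodule.subsingleton_iff (Lam J), ← subsingleton_iff_bot_eq_top, ← C.span_gen n, h,
    Set.image_empty, Submodule.span_empty]

end PreWord

end Generators

section Signs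

variable {Q : Type u} [Quiver.{u} Q]

namespace NPath

theorem tail_firstArrowAux : ∀ {v w : Q} (p : Quiver.Path v w) (a : Arrow Q), a.tail = w →
    (firstArrowAux p a).tail = v
  | _, _, .nil, _, h => h
  | _, _, .cons q _, _, _ => tail_firstArrowAux q _ rfl

theorem tail_first (γ : NPath Q) : γ.first.tail = γ.tail :=
  tail_firstArrowAux γ.front γ.last rfl

theorem eq_of_length_eq_one : ∀ {γ : NPath Q}, γ.length = 1 → γ = ⟨γ.last.tail, γ.last, .nil⟩
  | ⟨_, _, .nil⟩, _ => rfl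
  | ⟨_, _, .cons p _⟩, h => absurd (Nat.succ_injective h) (Nat.succ_ne_zero p.length)

theorem first_eq_last {γ : NPath Q} (hγ : γ.length = 1) : γ.first = γ.last := by
  rw [eq_of_length_eq_one hγ]
  rfl

end NPath

variable [Fintype Q] {k : Type u} [Field k] {J : TwoSidedIdeal (PathAlgebra k Q)}

theorem NPath.pathClass_eq_of_length_eq_one {γ : NPath Q} (hγ : γ.length = 1) :
    pathClass J γ.toQPath = pathClass J (QPath.ofArrow γ.last) := by
  rw [eq_of_length_eq_one hγ]
  rfl

namespace SignChoice

variable (s : SignChoice J)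
include s

theorem eq_of_sign_eq_of_head_eq {a b : Arrow Q} (h : a.head = b.head)
    (hs : s.sign (a, false) = s.sign (b, false)) : a = b := by
  by_contra hne
  obtain ⟨c, d, -, ⟨hc, -⟩ | ⟨-, hc⟩⟩ :=
    (s.sign_eq_iff (a, false) (b, false) (by simpa using hne) h).1 hs <;>
  simp at hc

theorem eq_of_sign_eq_of_tail_eq {a b : Arrow Q} (h : a.tail = b.tail)
    (hs : s.sign (a, true) = s.sign (b, true)) : a = b := by
  by_contra hne
  obtain ⟨c, d, -, ⟨-, hd⟩ | ⟨hd, -⟩⟩ :=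
    (s.sign_eq_iff (a, true) (b, true) (by simpa using hne) h).1 hs <;>
  simp at hd

theorem sign_inv_eq_of_mul_mem {a b : Arrow Q} (h : a.tail = b.head)
    (hab : arrow k a * arrow k b ∈ J) : s.sign (a, true) = s.sign (b, false) :=
  (s.sign_eq_iff (a, true) (b, false) (by simp) h).2 ⟨a, b, hab, .inl ⟨rfl, rfl⟩⟩

theorem eq_of_mul_mem {a a' b : Arrow Q} (h : a.tail = b.head) (h' : a'.tail = b.head)
    (hab : arrow k a * arrow k b ∈ J) (hab' : arrow k a' * arrow k b ∈ J) : a = a' :=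
  s.eq_of_sign_eq_of_tail_eq (h.trans h'.symm)
    ((s.sign_inv_eq_of_mul_mem h hab).trans (s.sign_inv_eq_of_mul_mem h' hab').symm)

end SignChoice

end Signs

section StringComplexes

variable {k : Type u} [Field k] {Q : Type u} [Quiver.{u} Q] [Fintype Q]
  {J : TwoSidedIdeal (PathAlgebra k Q)}

namespace Word

variable {C : Word J} {Y : CochainComplex (ModuleCat.{u} (Lam J)) ℤ}

theorem stringComplex_d_apply (C : Word J) {n m : ℤ} (h : n + 1 = m) (x : C.pre.comp n) :
    C.stringComplex.d n m x = C.dHom h x := by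
  have hd : C.stringComplex.d n m = ModuleCat.ofHom (C.dHom h) := dif_pos h
  rw [hd]
  rfl

theorem exactAt_stringComplex_iff {l n : ℤ} (hl : l + 1 = n) : C.stringComplex.ExactAt n ↔
    ∀ f ∈ C.pre.comp n, C.pre.diff f = 0 → ∃ g ∈ C.pre.comp l, C.pre.diff g = f := by
  have hd (n : ℤ) (x : C.pre.comp n) :
      (C.stringComplex.d n (n + 1)).hom x = C.dHom rfl x := C.stringComplex_d_apply rfl x
  subst hl
  rw [exactAt_iff_range_eq_ker rfl rfl]
  constructor
  · intro hex f hf hdf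
    have hker : (C.stringComplex.d (l + 1) (l + 1 + 1)).hom (⟨f, hf⟩ : C.pre.comp (l + 1)) = 0 :=
      (hd (l + 1) ⟨f, hf⟩).trans (Subtype.ext hdf)
    obtain ⟨g, hg⟩ := hex.ge hker
    exact ⟨_, (g : C.pre.comp l).2, congrArg Subtype.val ((hd l g).symm.trans hg)⟩
  · refine fun hex => le_antisymm ?_ fun f hf => ?_
    · rintro _ ⟨x, rfl⟩
      exact congrArg (fun φ => φ.hom x) (C.stringComplex.d_comp_d l (l + 1) (l + 1 + 1))
    · obtain ⟨g, hg, hgf⟩ := hex _ (f : C.pre.comp (l + 1)).2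
        (congrArg Subtype.val ((hd (l + 1) f).symm.trans hf))
      exact ⟨(⟨g, hg⟩ : C.pre.comp l), (hd l _).trans (Subtype.ext hgf)⟩

theorem map_stringComplex_d_apply {W : Type*} [AddCommGroup W] [Module k W] (hJ : IsQuadratic J)
    (v : Q) {n m : ℤ} (φ : C.stringComplex.X m →ₛₗ[hJ.vertexHom v] W) (x : C.stringComplex.X n)
    (h : n + 1 = m) : φ (C.stringComplex.d n m x) = 0 := by
  have hsum := (C.stringComplex_d_apply h x).trans (PreWord.sum_smul_gen (C.dHom h x)).symm
  refine (congrArg φ hsum).trans ((map_sum φ _ _).trans (Finset.sum_eq_zero fun i _ => ?_))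
  have hzero : hJ.vertexHom v ((C.dHom h x).1 i) = 0 := PreWord.vertexHom_diff_apply hJ v _ i
  exact (map_smulₛₗ φ _ _).trans (by rw [hzero, zero_smul])

theorem exists_inv_apply_ne_zero (hJ : IsQuadratic J) (e : HomotopyEquiv C.stringComplex Y)
    {n i : ℤ} (hi : i ∈ C.pre.indexSet n) {S : Set (Y.X n)}
    (hS : Submodule.span (Lam J) S = ⊤) : ∃ y ∈ S, (e.inv.f n y : C.pre.comp n).1 i ≠ 0 := by
  obtain ⟨hn, v, hv⟩ := hi
  let φ : C.stringComplex.X n →ₛₗ[hJ.vertexHom v] k :=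
    (hJ.vertexHom v).toSemilinearMap.comp (Finsupp.lapply i ∘ₗ (C.pre.comp n).subtype)
  have hgen : φ (C.pre.gen n i) = 1 := by
    have hcoe : (C.pre.gen n i).1 i = idem J v := by
      rw [PreWord.coe_gen hn hv, Finsupp.single_eq_same]
    exact (congrArg (hJ.vertexHom v) hcoe).trans (hJ.vertexHom_idem v)
  by_contra! hzero
  have hφ : φ.comp (e.inv.f n).hom = 0 := LinearMap.ext_on hS fun y hy =>
    (congrArg (hJ.vertexHom v) (hzero y hy)).trans (map_zero _)
  have hinv := map_inv_hom_apply (fun n m => map_stringComplex_d_apply hJ v) e φ (C.pre.gen n i)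
  exact one_ne_zero (hgen.symm.trans (hinv.symm.trans (LinearMap.congr_fun hφ _)))

theorem finite_indexSet_of_homotopyEquiv (hJ : IsQuadratic J)
    (e : HomotopyEquiv C.stringComplex Y) (hY : IsPlusB Y) (n : ℤ) :
    (C.pre.indexSet n).Finite := by
  obtain ⟨S, hS, hspan⟩ := Submodule.fg_def.1 (hY.finite n).fg_top
  refine (hS.biUnion fun y _ => (e.inv.f n y : C.pre.comp n).1.hasFiniteSupport).subset ?_
  intro i hi
  obtain ⟨y, hy, hne⟩ := exists_inv_apply_ne_zero hJ e hi hspan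
  exact Set.mem_biUnion hy hne

theorem exists_indexSet_eq_empty_of_homotopyEquiv (hJ : IsQuadratic J)
    (e : HomotopyEquiv C.stringComplex Y) (hY : IsPlusB Y) :
    ∃ b, ∀ n < b, C.pre.indexSet n = ∅ := by
  obtain ⟨b, hb⟩ := hY.leftBounded
  refine ⟨b, fun n hn => Set.eq_empty_of_forall_notMem fun i hi => ?_⟩
  have := hb n hn
  obtain ⟨y, hy, -⟩ := exists_inv_apply_ne_zero hJ e hi (S := ∅) (Subsingleton.elim _ _)
  exact hy

theorem finite_iUnion_indexSet_of_homotopyEquiv (hJ : IsQuadratic J)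
    (e : HomotopyEquiv C.stringComplex Y) (hY : IsPlusB Y) (m : ℤ) :
    (⋃ n ≤ m, C.pre.indexSet n).Finite := by
  obtain ⟨b, hb⟩ := exists_indexSet_eq_empty_of_homotopyEquiv hJ e hY
  refine ((Set.finite_Icc b m).biUnion fun n _ =>
    finite_indexSet_of_homotopyEquiv hJ e hY n).subset (Set.iUnion₂_subset fun n hn i hi => ?_)
  refine Set.mem_biUnion ⟨le_of_not_gt fun hlt => ?_, hn⟩ hi
  rw [hb n hlt] at hi
  exact hi

end Word

end StringComplexes

/-! ### Ends of words -/

section Ends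

variable {k : Type u} [Field k] {Q : Type u} [Quiver.{u} Q] [Fintype Q]
  {J : TwoSidedIdeal (PathAlgebra k Q)}

namespace PreWord

/-- The sequence `C` stops along `g`, or it eventually consists of arrows which raise the degree.
For `g t = t` and `g t = -t` this is a condition on the right and the left end of `C`. -/
def EventuallyUp (C : PreWord J) (g : ℕ → ℤ) : Prop :=
  ∃ N, (∀ t ≥ N, C.vertexAt (g t) = none) ∨
    ∀ t ≥ N, ∃ l, C.Step (g t) (g (t + 1)) l ∧ l.path.length = 1

/-- Each of the two ends of `C` stops or eventually consists of arrows which raise the degree, so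
that it looks like the projective resolution of a cokernel. -/
structure HasResolvingEnds (C : PreWord J) : Prop where
  right : C.EventuallyUp fun t => t
  left : C.EventuallyUp fun t => -t

variable {C : PreWord J} {g : ℕ → ℤ}

theorem eventuallyUp_of_letterAt_eq_none (hC : ∀ v δ, C ≠ triv v δ) {N : ℕ}
    (h : ∀ t ≥ N, C.letterAt (g t) = none ∧ C.letterAt (g t + 1) = none) : C.EventuallyUp g := by
  refine ⟨N, .inl fun t ht => ?_⟩
  obtain ⟨hleft, hright⟩ := h t ht
  cases C with
  | triv v δ => exact (hC v δ rfl).elim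
  | _ => simp only [vertexAt, hleft, hright]

theorem hasResolvingEnds_triv (v : Q) (δ : ℤˣ) : (triv v δ : PreWord J).HasResolvingEnds where
  right := ⟨1, .inl fun t (ht : 1 ≤ t) =>
    if_neg (by simp only [Nat.cast_eq_zero]; omega)⟩
  left := ⟨1, .inl fun t (ht : 1 ≤ t) =>
    if_neg (by simp only [Nat.cast_eq_zero, neg_eq_zero]; omega)⟩

theorem hasResolvingEnds_fin (L : List (Letter J)) : (fin L).HasResolvingEnds where
  right := by
    refine eventuallyUp_of_letterAt_eq_none nofun (N := L.length + 1) fun t ht => ?_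
    have hleft : L[((t : ℤ) - 1).toNat]? = none := List.getElem?_eq_none (by omega)
    have hright : L[((t : ℤ) + 1 - 1).toNat]? = none := List.getElem?_eq_none (by omega)
    simp only [letterAt, hleft, hright, ite_self, and_self]
  left := eventuallyUp_of_letterAt_eq_none nofun (N := 1) fun t ht =>
    ⟨if_neg (by omega), if_neg (by omega)⟩

theorem eventuallyUp_nat_left (f : ℕ → Letter J) : (nat f).EventuallyUp fun t => -t :=
  eventuallyUp_of_letterAt_eq_none nofun (N := 1) fun t ht =>
    ⟨if_neg (by omega), if_neg (by omega)⟩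

theorem eventuallyUp_neg_right (f : ℕ → Letter J) : (neg f).EventuallyUp fun t => t := by
  refine eventuallyUp_of_letterAt_eq_none nofun (N := 1) fun t ht => ?_
  have hleft : ¬ (t : ℤ) ≤ 0 := by omega
  have hright : ¬ (t : ℤ) + 1 ≤ 0 := by omega
  simp only [letterAt, hleft, hright, if_false, and_self]

theorem eventuallyUp_right_iff {f : ℕ → Letter J} (h : ∀ t : ℕ, C.letterAt (t + 1) = some (f t)) :
    (C.EventuallyUp fun t => t) ↔
      ∃ N, ∀ t ≥ N, (f t).isInv = true ∧ (f t).path.length = 1 := by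
  refine exists_congr fun N => ⟨fun H t ht => ?_, fun H => .inr fun t ht =>
    ⟨f t, .inl ⟨rfl, by push_cast; exact h t, (H t ht).1⟩, (H t ht).2⟩⟩
  rcases H with hnone | hstep
  · have hv := vertexAt_of_letterAt (h t)
    rw [← Nat.cast_succ, hnone (t + 1) (by omega)] at hv
    simp at hv
  · obtain ⟨l, ⟨-, hl, hinv⟩ | ⟨hl, -⟩, hlen⟩ := hstep t ht
    · push_cast at hl
      obtain rfl : f t = l := Option.some_injective _ ((h t).symm.trans hl)
      exact ⟨hinv, hlen⟩
    · push_cast at hl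
      omega

theorem eventuallyUp_left_iff {f : ℕ → Letter J} (h : ∀ t : ℕ, C.letterAt (-t) = some (f t)) :
    (C.EventuallyUp fun t => -t) ↔
      ∃ N, ∀ t ≥ N, (f t).isInv = false ∧ (f t).path.length = 1 := by
  refine exists_congr fun N => ⟨fun H t ht => ?_, fun H => .inr fun t ht =>
    ⟨f t, .inr ⟨by push_cast; ring, h t, (H t ht).1⟩, (H t ht).2⟩⟩
  rcases H with hnone | hstep
  · have hv := vertexAt_of_letterAt (h t)
    rw [hnone t ht] at hv
    simp at hv
  · obtain ⟨l, ⟨hl, -⟩ | ⟨-, hl, hinv⟩, hlen⟩ := hstep t ht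
    · push_cast at hl
      omega
    · obtain rfl : f t = l := Option.some_injective _ ((h t).symm.trans hl)
      exact ⟨hinv, hlen⟩

theorem hasResolvingEnds_nat_iff {f : ℕ → Letter J} : (nat f).HasResolvingEnds ↔
    ∃ N, ∀ t ≥ N, (f t).isInv = true ∧ (f t).path.length = 1 := by
  rw [← eventuallyUp_right_iff (C := nat f) fun t => by
    rw [letterAt, if_pos (by omega), add_sub_cancel_right, Int.toNat_natCast]]
  exact ⟨fun h => h.right, fun h => ⟨h, eventuallyUp_nat_left f⟩⟩

theorem hasResolvingEnds_neg_iff {f : ℕ → Letter J} : (neg f).HasResolvingEnds ↔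
    ∃ N, ∀ t ≥ N, (f t).isInv = false ∧ (f t).path.length = 1 := by
  rw [← eventuallyUp_left_iff (C := neg f) fun t => by
    rw [letterAt, if_pos (by omega), neg_neg, Int.toNat_natCast]]
  exact ⟨fun h => h.left, fun h => ⟨eventuallyUp_neg_right f, h⟩⟩

theorem hasResolvingEnds_int_iff {f : ℤ → Letter J} : (int f).HasResolvingEnds ↔
    (∃ N, ∀ i ≥ N, (f i).isInv = true ∧ (f i).path.length = 1) ∧
    ∃ N, ∀ i ≤ N, (f i).isInv = false ∧ (f i).path.length = 1 := by
  have hright := eventuallyUp_right_iff (C := int f) (f := fun t => f (t + 1)) fun t => rfl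
  have hleft := eventuallyUp_left_iff (C := int f) (f := fun t => f (-t)) fun t => rfl
  constructor
  · intro h
    obtain ⟨N, hN⟩ := hright.1 h.right
    obtain ⟨M, hM⟩ := hleft.1 h.left
    refine ⟨⟨N + 1, fun i hi => ?_⟩, ⟨-M, fun i hi => ?_⟩⟩
    · obtain ⟨t, rfl⟩ : ∃ t : ℕ, i = t + 1 := ⟨(i - 1).toNat, by omega⟩
      exact hN t (by omega)
    · obtain ⟨t, rfl⟩ : ∃ t : ℕ, i = -t := ⟨(-i).toNat, by omega⟩
      exact hM t (by omega)
  · rintro ⟨⟨N, hN⟩, M, hM⟩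
    exact ⟨hright.2 ⟨N.toNat, fun t ht => hN _ (by omega)⟩,
      hleft.2 ⟨(-M).toNat, fun t ht => hM _ (by omega)⟩⟩

theorem mu_add_of_forall_step {N : ℕ} (h : ∀ t ≥ N, ∃ l, C.Step (g t) (g (t + 1)) l) (t : ℕ) :
    C.mu (g (N + t)) = C.mu (g N) + t := by
  induction t with
  | zero => simp
  | succ t ih =>
    obtain ⟨l, hl⟩ := h (N + t) (Nat.le_add_right N t)
    rw [← add_assoc, hl.mu_eq, ih]
    push_cast
    ring

theorem EventuallyUp.finite_setOf_mu_le (h : C.EventuallyUp g) (m : ℤ) :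
    {t : ℕ | C.mu (g t) ≤ m ∧ ∃ v, C.vertexAt (g t) = some v}.Finite := by
  obtain ⟨N, hnone | hstep⟩ := h
  · refine (Set.finite_Iio N).subset fun t ⟨_, v, hv⟩ => Set.mem_Iio.2 (not_le.1 fun ht => ?_)
    simp [hnone t ht] at hv
  · refine (Set.finite_Iic (N + (m - C.mu (g N)).toNat)).subset fun t ⟨ht, _⟩ => ?_
    rw [Set.mem_Iic]
    by_contra! hlt
    obtain ⟨r, rfl⟩ := Nat.exists_eq_add_of_le (show N ≤ t by omega)
    rw [mu_add_of_forall_step fun t ht => (hstep t ht).imp fun _ => And.left] at ht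
    omega

theorem EventuallyUp.exists_steps (h : C.EventuallyUp g) : ∃ b, ∀ t v,
    C.vertexAt (g t) = some v → b < C.mu (g t) → ∃ s, t = s + 2 ∧
      ∀ r ≥ s, ∃ l, C.Step (g r) (g (r + 1)) l ∧ l.path.length = 1 := by
  obtain ⟨N, h⟩ := h
  obtain ⟨b, hb⟩ := ((Set.finite_Iio (N + 2)).image fun t => C.mu (g t)).bddAbove
  refine ⟨b, fun t v hv ht => ?_⟩
  rcases lt_or_ge t (N + 2) with htN | htN
  · exact (not_le.2 ht (hb ⟨t, htN, rfl⟩)).elim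
  · rcases h with hnone | hstep
    · simp [hnone t (by omega)] at hv
    · exact ⟨t - 2, by omega, fun r hr => hstep r (by omega)⟩

theorem HasResolvingEnds.finite_iUnion_indexSet (h : C.HasResolvingEnds) (m : ℤ) :
    (⋃ n ≤ m, C.indexSet n).Finite := by
  have hright := (h.right.finite_setOf_mu_le m).image fun t : ℕ => (t : ℤ)
  have hleft := (h.left.finite_setOf_mu_le m).image fun t : ℕ => -(t : ℤ)
  refine (hright.union hleft).subset (Set.iUnion₂_subset fun n hn i hi => ?_)
  obtain ⟨t, rfl | rfl⟩ := i.eq_nat_or_neg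
  · exact .inl ⟨t, ⟨hi.1.trans_le hn, hi.2⟩, rfl⟩
  · exact .inr ⟨t, ⟨hi.1.trans_le hn, hi.2⟩, rfl⟩

theorem finite_indexSet (h : ∀ m, (⋃ n ≤ m, C.indexSet n).Finite) (n : ℤ) :
    (C.indexSet n).Finite :=
  (h n).subset (Set.subset_iUnion₂ (s := fun i (_ : i ≤ n) => C.indexSet i) n le_rfl)

theorem exists_indexSet_eq_empty (h : ∀ m, (⋃ n ≤ m, C.indexSet n).Finite) :
    ∃ b, ∀ n < b, C.indexSet n = ∅ := by
  obtain ⟨b, hb⟩ := ((h 0).image C.mu).bddBelow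
  refine ⟨min b 0, fun n hn => Set.eq_empty_of_forall_notMem fun i hi => ?_⟩
  have hbi := hb ⟨i, Set.mem_biUnion (show n ≤ 0 by omega) hi, rfl⟩
  rw [hi.1] at hbi
  omega

end PreWord

end Ends

section Exactness

open Filter

variable {k : Type u} [Field k] {Q : Type u} [Quiver.{u} Q] [Fintype Q]
  {J : TwoSidedIdeal (PathAlgebra k Q)}

theorem SignChoice.mem_span_of_mul_arrow_eq_zero (s : SignChoice J) (hJ : IsQuadratic J)
    {a y : Arrow Q} (ha : a.tail = y.head) (hay : arrow k a * arrow k y ∈ J) {x : Lam J}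
    (hx : x * idem J y.head = x) (hxy : x * pathClass J (QPath.ofArrow y) = 0) :
    x ∈ Ideal.span {pathClass J (QPath.ofArrow a)} := by
  refine Ideal.span_mono ?_ (hJ.mem_span_of_mul_arrow_eq_zero hx hxy)
  rintro _ ⟨b, ⟨hb, hby⟩, rfl⟩
  rw [s.eq_of_mul_mem hb ha hby hay]
  exact Set.mem_singleton _

namespace Word

variable {C : Word J} {h i j m n : ℤ} {l l' : Letter J}

theorem not_exactAt_of_step_of_step (hJ : IsQuadratic J) (h₁ : C.pre.Step h i l)
    (h₂ : C.pre.Step j i l') (hne : h ≠ j) : ¬ C.stringComplex.ExactAt (C.pre.mu i) := by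
  intro hex
  have hv := h₁.vertexAt_right C.isWord
  have hcycle : C.pre.diff (Finsupp.single i (idem J l.path.tail)) = 0 := by
    ext m
    refine PreWord.diff_single_apply_eq_zero (fun l'' h₃ => hne ?_) _
    have := h₃.mu_eq
    have := h₁.mu_eq
    have := h₂.mu_eq
    have : m ≠ h := by rintro rfl; omega
    have : m ≠ j := by rintro rfl; omega
    have := h₁.eq_add_one_or_eq_sub_one
    have := h₂.eq_add_one_or_eq_sub_one
    have := h₃.eq_add_one_or_eq_sub_one
    omega
  obtain ⟨g, -, hg⟩ := (exactAt_stringComplex_iff (sub_add_cancel _ 1)).1 hex _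
    (PreWord.coe_gen rfl hv ▸ (C.pre.gen (C.pre.mu i) i).2) hcycle
  have hzero := PreWord.vertexHom_diff_apply (C := C.pre) hJ l.path.tail g i
  rw [hg, Finsupp.single_eq_same, hJ.vertexHom_idem] at hzero
  exact one_ne_zero hzero

theorem length_eq_one_of_exactAt (hJ : IsQuadratic J)
    (hex : C.stringComplex.ExactAt (C.pre.mu i)) (h₁ : C.pre.Step h i l)
    (h₂ : C.pre.Step i j l') : l.path.length = 1 := by
  set a := pathClass J (QPath.ofArrow l.path.first)
  have ha : a * idem J l.path.tail = a := by
    rw [← l.path.tail_first]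
    exact pathClass_mul_idem J (QPath.ofArrow l.path.first)
  have hmem : Finsupp.single i a ∈ C.pre.comp (C.pre.mu i) :=
    PreWord.single_mem_comp (PreWord.mem_stalk_iff.2 ⟨fun hne => absurd rfl hne, by
      rw [PreWord.idemAt_of_vertexAt (h₁.vertexAt_right C.isWord), ha]⟩)
  have hcycle : C.pre.diff (Finsupp.single i a) = 0 := by
    have hal : a * l'.cls = 0 := pathClass_mul_eq_zero (γ := ⟨_, l.path.first, .nil⟩)
      (h₁.mul_mem C.isWord h₂)
    rw [h₂.diff_single fun _ _ => h₁.eq_target h₂, hal, Finsupp.single_zero]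
  obtain ⟨g, -, hg⟩ := (exactAt_stringComplex_iff (sub_add_cancel _ 1)).1 hex _ hmem hcycle
  have hgl : g h * l.cls = a := by
    rw [← h₁.diff_apply fun _ _ => h₁.eq_source h₂, hg, Finsupp.single_eq_same]
  exact le_antisymm (hJ.length_le_of_mul_eq_pathClass one_lt_two hgl) (Nat.succ_pos _)

theorem exists_diff_eq_single (hJ : IsQuadratic J) (s : SignChoice J) {g : ℤ}
    {l₀ l₁ l₂ l₃ : Letter J} (h₀ : C.pre.Step g h l₀)
    (h₁ : C.pre.Step h i l₁) (hl₁ : l₁.path.length = 1) (h₂ : C.pre.Step i j l₂)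
    (hl₂ : l₂.path.length = 1) (h₃ : C.pre.Step j m l₃) {f : ℤ →₀ Lam J}
    (hf : f ∈ C.pre.comp n) (hn : C.pre.mu i = n) (hdf : C.pre.diff f = 0) :
    ∃ x ∈ C.pre.comp (n - 1), C.pre.diff x = Finsupp.single i (f i) := by
  have hidem : f i * idem J l₂.path.last.head = f i := by
    rw [← (PreWord.mem_stalk_iff.1 (hf i)).2, mul_assoc,
      PreWord.idemAt_of_vertexAt (h₂.vertexAt_left C.isWord)]
    exact congrArg _ (idem_mul_idem _)
  have hmul : f i * pathClass J (QPath.ofArrow l₂.path.last) = 0 := by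
    rw [← NPath.pathClass_eq_of_length_eq_one hl₂]
    exact (h₂.diff_apply (fun _ _ => h₂.eq_source h₃) f).symm.trans (by rw [hdf]; rfl)
  have htail : l₁.path.first.tail = l₂.path.last.head :=
    l₁.path.tail_first.trans (Option.some_injective _
      ((h₁.vertexAt_right C.isWord).symm.trans (h₂.vertexAt_left C.isWord)))
  obtain ⟨z, hz⟩ := Ideal.mem_span_singleton'.1 (s.mem_span_of_mul_arrow_eq_zero hJ htail
    (h₁.mul_mem C.isWord h₂) hidem hmul)
  rw [NPath.first_eq_last hl₁, ← NPath.pathClass_eq_of_length_eq_one hl₁] at hz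
  refine ⟨Finsupp.single h (z * idem J l₁.path.head), PreWord.single_mem_comp
    (PreWord.mem_stalk_iff.2 ⟨fun hne => (hne ?_).elim, ?_⟩), ?_⟩
  · have := h₁.mu_eq
    omega
  · rw [PreWord.idemAt_of_vertexAt (h₁.vertexAt_left C.isWord), mul_assoc, idem_mul_idem]
  · have hcls : idem J l₁.path.head * l₁.cls = l₁.cls := idem_mul_pathClass l₁.path.toQPath
    rw [h₁.diff_single fun _ _ => h₀.eq_target h₁, mul_assoc, hcls, ← hz]
    rfl

theorem exists_forall_exactAt (hJ : IsQuadratic J) (s : SignChoice J)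
    (hC : C.pre.HasResolvingEnds) : ∃ b, ∀ n > b, C.stringComplex.ExactAt n := by
  obtain ⟨b, hb⟩ := hC.right.exists_steps
  obtain ⟨b', hb'⟩ := hC.left.exists_steps
  refine ⟨max b b', fun n hn => (exactAt_stringComplex_iff (sub_add_cancel n 1)).2 ?_⟩
  intro f hf hdf
  have along {g : ℕ → ℤ} {t : ℕ} (hmu : C.pre.mu (g t) = n) (hsteps : ∃ s, t = s + 2 ∧
      ∀ r ≥ s, ∃ l, C.pre.Step (g r) (g (r + 1)) l ∧ l.path.length = 1) :
      ∃ x ∈ C.pre.comp (n - 1), C.pre.diff x = Finsupp.single (g t) (f (g t)) := by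
    obtain ⟨r, rfl, hsteps⟩ := hsteps
    obtain ⟨l₀, h₀, -⟩ := hsteps r le_rfl
    obtain ⟨l₁, h₁, hl₁⟩ := hsteps (r + 1) (by omega)
    obtain ⟨l₂, h₂, hl₂⟩ := hsteps (r + 2) (by omega)
    obtain ⟨l₃, h₃, -⟩ := hsteps (r + 3) (by omega)
    exact exists_diff_eq_single hJ s h₀ h₁ hl₁ h₂ hl₂ h₃ hf hmu hdf
  have hsingle (i : ℤ) : ∃ x ∈ C.pre.comp (n - 1), C.pre.diff x = Finsupp.single i (f i) := by
    by_cases hi : i ∈ C.pre.indexSet n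
    · obtain ⟨hmu, v, hv⟩ := hi
      obtain ⟨t, rfl | rfl⟩ := i.eq_nat_or_neg
      · exact along (g := fun t => t) hmu (hb t v hv (by omega))
      · exact along (g := fun t => -t) hmu (hb' t v hv (by omega))
    · refine ⟨0, zero_mem _, ?_⟩
      rw [← PreWord.coe_smul_gen ⟨f, hf⟩ i, PreWord.gen_eq_zero hi, smul_zero, map_zero]
      rfl
  choose x hx hdx using hsingle
  refine ⟨∑ i ∈ f.support, x i, sum_mem fun i _ => hx i, ?_⟩
  rw [map_sum, Finset.sum_congr rfl fun i _ => hdx i]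
  exact Finsupp.sum_single f

theorem isPlusB_stringComplex (hJ : IsQuadratic J) (s : SignChoice J)
    (hC : C.pre.HasResolvingEnds) : IsPlusB C.stringComplex := by
  obtain ⟨a, ha⟩ := PreWord.exists_indexSet_eq_empty hC.finite_iUnion_indexSet
  exact .of_forall_exactAt C.pre.projective_comp
    (fun n => PreWord.finite_comp (PreWord.finite_indexSet hC.finite_iUnion_indexSet n))
    ⟨a, fun n hn => PreWord.subsingleton_comp (ha n hn)⟩ (exists_forall_exactAt hJ s hC)

theorem tendsto_mu_atTop (hfin : ∀ m, (⋃ n ≤ m, C.pre.indexSet n).Finite) {g : ℕ → ℤ}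
    (hg : g.Injective) (hv : ∀ t, ∃ v, C.pre.vertexAt (g t) = some v) :
    Tendsto (fun t => C.pre.mu (g t)) atTop atTop := by
  refine tendsto_atTop.2 fun m => ?_
  rw [← Nat.cofinite_eq_atTop]
  refine ((hfin m).preimage hg.injOn).subset fun t ht => ?_
  have ht : ¬ m ≤ C.pre.mu (g t) := ht
  exact Set.mem_biUnion (show C.pre.mu (g t) ≤ m from (not_le.1 ht).le) ⟨rfl, hv t⟩

/-- The first rising step in the exact range is followed by rising steps only, as a local maximum
of the degree would be a cycle which is no boundary. -/
theorem eventuallyUp_of_tendsto (hJ : IsQuadratic J)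
    (hex : ∃ b, ∀ n > b, C.stringComplex.ExactAt n) {g : ℕ → ℤ} (hg : g.Injective)
    (hmu : Tendsto (fun t => C.pre.mu (g t)) atTop atTop)
    (hstep : ∀ t, ∃ l, C.pre.Step (g t) (g (t + 1)) l ∨ C.pre.Step (g (t + 1)) (g t) l) :
    C.pre.EventuallyUp g := by
  obtain ⟨b, hb⟩ := hex
  obtain ⟨N, hN⟩ := (tendsto_atTop.1 hmu (b + 1)).exists_forall_of_atTop
  obtain ⟨t₀, ht₀, hrise⟩ : ∃ t ≥ N, ∃ l, C.pre.Step (g t) (g (t + 1)) l := by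
    by_contra! hfall
    have hanti : Antitone fun t => C.pre.mu (g (N + t)) := antitone_nat_of_succ_le fun t => by
      obtain ⟨l, hl | hl⟩ := hstep (N + t)
      · exact absurd hl (hfall _ (Nat.le_add_right N t) l)
      · exact (Int.le.intro 1 hl.mu_eq.symm)
    obtain ⟨t, hlt⟩ := (tendsto_atTop.1 hmu (C.pre.mu (g N) + 1)).exists_forall_of_atTop
    have := hanti (Nat.zero_le t)
    have := hlt (N + t) (Nat.le_add_left t N)
    simp only [add_zero] at *
    omega
  have hsteps : ∀ t ≥ t₀, ∃ l, C.pre.Step (g t) (g (t + 1)) l := by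
    intro t ht
    induction t, ht using Nat.le_induction with
    | base => exact hrise
    | succ t ht ih =>
      obtain ⟨l, hl⟩ := ih
      obtain ⟨l', hl' | hl'⟩ := hstep (t + 1)
      · exact ⟨l', hl'⟩
      · refine absurd (hb _ (hN (t + 1) (by omega))) (not_exactAt_of_step_of_step hJ hl hl' ?_)
        exact hg.ne (by omega)
  refine ⟨t₀, .inr fun t ht => ?_⟩
  obtain ⟨l, hl⟩ := hsteps t ht
  obtain ⟨l', hl'⟩ := hsteps (t + 1) (by omega)
  exact ⟨l, hl, length_eq_one_of_exactAt hJ (hb _ (hN _ (by omega))) hl hl'⟩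

theorem hasResolvingEnds_of_homotopyEquiv (hJ : IsQuadratic J)
    {Y : CochainComplex (ModuleCat.{u} (Lam J)) ℤ} (e : HomotopyEquiv C.stringComplex Y)
    (hY : IsPlusB Y) : C.pre.HasResolvingEnds := by
  have hup {g : ℕ → ℤ} (hg : g.Injective)
      (hstep : ∀ t, ∃ l, C.pre.Step (g t) (g (t + 1)) l ∨ C.pre.Step (g (t + 1)) (g t) l) :
      C.pre.EventuallyUp g := by
    refine eventuallyUp_of_tendsto hJ (exists_forall_exactAt_of_homotopyEquiv e hY) hg
      (tendsto_mu_atTop (finite_iUnion_indexSet_of_homotopyEquiv hJ e hY) hg fun t => ?_) hstep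
    obtain ⟨l, hl | hl⟩ := hstep t
    · exact ⟨_, hl.vertexAt_left C.isWord⟩
    · exact ⟨_, hl.vertexAt_right C.isWord⟩
  have hright (h : ∀ t : ℕ, ∃ l, C.pre.letterAt (t + 1) = some l) :
      C.pre.EventuallyUp fun t => t := hup Nat.cast_injective fun t => by
    obtain ⟨l, hl⟩ := h t
    exact ⟨l, by push_cast; exact PreWord.step_or_step hl⟩
  have hleft (h : ∀ t : ℕ, ∃ l, C.pre.letterAt (-t) = some l) :
      C.pre.EventuallyUp fun t => -t := hup (neg_injective.comp Nat.cast_injective) fun t => by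
    obtain ⟨l, hl⟩ := h t
    rw [show -(t : ℤ) = -((t + 1 : ℕ) : ℤ) + 1 by push_cast; ring] at hl ⊢
    exact ⟨l, (PreWord.step_or_step hl).symm⟩
  rcases hC : C.pre with ⟨v, δ⟩ | L | f | f | f <;> rw [hC] at hright hleft
  · exact PreWord.hasResolvingEnds_triv v δ
  · exact PreWord.hasResolvingEnds_fin L
  · exact ⟨hright fun t => ⟨_, if_pos (by omega)⟩, PreWord.eventuallyUp_nat_left f⟩
  · exact ⟨PreWord.eventuallyUp_neg_right f, hleft fun t => ⟨_, if_pos (by omega)⟩⟩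
  · exact ⟨hright fun t => ⟨_, rfl⟩, hleft fun t => ⟨_, rfl⟩⟩

end Word

end Exactness

/-! ### Maximal extensions of finite words -/

section Words

variable {k : Type u} [Field k] {Q : Type u} [Quiver.{u} Q] [Fintype Q]
  {J : TwoSidedIdeal (PathAlgebra k Q)}

theorem Letter.Adj.inv {a b : Letter J} (h : a.Adj b) : b.inv.Adj a.inv := by
  cases ha : a.isInv <;> cases hb : b.isInv <;>
    simp only [Letter.Adj, Letter.inv, ha, hb, Bool.not_true, Bool.not_false] at h ⊢
  exacts [⟨h.1.symm, h.2⟩, ⟨h.1.symm, h.2.symm⟩, ⟨h.1.symm, h.2.symm⟩, ⟨h.1.symm, h.2⟩]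

theorem Letter.inv_injective : (Letter.inv : Letter J → Letter J).Injective :=
  Function.LeftInverse.injective (g := Letter.inv) fun l => by simp only [Letter.inv, Bool.not_not]

namespace SignChoice

variable (s : SignChoice J)
include s

theorem letterSign_of_adj {a b : Letter J} (h : a.Adj b) :
    s.letterSign b = -s.letterSign a.inv := by
  cases ha : a.isInv <;> cases hb : b.isInv <;>
    simp only [Letter.Adj, letterSign, Letter.inv, ha, hb, Bool.not_true, Bool.not_false, if_true,
      Bool.false_eq_true, if_false, neg_neg] at h ⊢
  · exact s.sign_inv_eq_of_mul_mem (b.path.tail_first.trans h.1.symm) h.2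
  · rw [Int.units_ne_iff_eq_neg.1 fun hs => h.2 (s.eq_of_sign_eq_of_head_eq h.1 hs)]
  · refine Int.units_ne_iff_eq_neg.1 fun hs => h.2 (s.eq_of_sign_eq_of_tail_eq ?_ hs).symm
    exact b.path.tail_first.trans (h.1.symm.trans a.path.tail_first.symm)
  · rw [s.sign_inv_eq_of_mul_mem (a.path.tail_first.trans h.1) h.2]

theorem eq_of_adj_of_adj {l a b : Letter J} (ha : l.Adj a) (hb : l.Adj b)
    (ha' : a.isInv = true ∧ a.path.length = 1) (hb' : b.isInv = true ∧ b.path.length = 1) :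
    a = b := by
  have hhead : a.head = b.head := ha.tail_eq.symm.trans hb.tail_eq
  have hsign : s.letterSign a = s.letterSign b :=
    (s.letterSign_of_adj ha).trans (s.letterSign_of_adj hb).symm
  obtain ⟨p, hp, ia⟩ := a
  obtain ⟨q, hq, ib⟩ := b
  obtain ⟨rfl, hp'⟩ := ha'
  obtain ⟨rfl, hq'⟩ := hb'
  have hlast : p.last = q.last := s.eq_of_sign_eq_of_head_eq hhead (neg_injective hsign)
  obtain rfl : p = q := by
    exact (NPath.eq_of_length_eq_one hp').trans
      (hlast ▸ (NPath.eq_of_length_eq_one hq').symm)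
  rfl

end SignChoice

namespace PreWord

variable {B C : PreWord J}

theorem eq_of_isWord_nat (s : SignChoice J) {f g : ℕ → Letter J} (hf : (nat f).IsWord)
    (hg : (nat g).IsWord) {N : ℕ} (hN : 0 < N) (heq : ∀ t < N, f t = g t)
    (hf' : ∀ t ≥ N, (f t).isInv = true ∧ (f t).path.length = 1)
    (hg' : ∀ t ≥ N, (g t).isInv = true ∧ (g t).path.length = 1) : f = g := by
  funext t
  induction t with
  | zero => exact heq 0 hN
  | succ t ih =>
    rcases lt_or_ge (t + 1) N with ht | ht
    · exact heq _ ht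
    · exact s.eq_of_adj_of_adj (hf t) (ih ▸ hg t) (hf' _ ht) (hg' _ ht)

theorem eq_of_isWord_neg (s : SignChoice J) {f g : ℕ → Letter J} (hf : (neg f).IsWord)
    (hg : (neg g).IsWord) {N : ℕ} (hN : 0 < N) (heq : ∀ t < N, f t = g t)
    (hf' : ∀ t ≥ N, (f t).isInv = false ∧ (f t).path.length = 1)
    (hg' : ∀ t ≥ N, (g t).isInv = false ∧ (g t).path.length = 1) : f = g := by
  have hinv : (fun t => (f t).inv) = fun t => (g t).inv :=
    eq_of_isWord_nat s (fun t => (hf t).inv) (fun t => (hg t).inv) hN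
      (fun t ht => congrArg Letter.inv (heq t ht))
      (fun t ht => ⟨congrArg not (hf' t ht).1, (hf' t ht).2⟩)
      fun t ht => ⟨congrArg not (hg' t ht).1, (hg' t ht).2⟩
  exact funext fun t => Letter.inv_injective (congrFun hinv t)

theorem fin_concat_nat_eq_iff {L : List (Letter J)} {f g : ℕ → Letter J} :
    (fin L).concat (nat g) = nat f ↔
      (∀ t (h : t < L.length), L[t] = f t) ∧ ∀ t, g t = f (L.length + t) := by
  simp only [concat, nat.injEq, funext_iff]
  refine ⟨fun H => ⟨fun t ht => ?_, fun t => ?_⟩, fun H t => ?_⟩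
  · rw [← H t, dif_pos ht]
  · rw [← H (L.length + t), dif_neg (by omega), Nat.add_sub_cancel_left]
  · split_ifs with ht
    · exact H.1 t ht
    · rw [H.2, Nat.add_sub_cancel' (not_lt.1 ht)]

theorem neg_concat_fin_eq_iff {L : List (Letter J)} {f g : ℕ → Letter J} :
    (neg g).concat (fin L) = neg f ↔
      (∀ t (h : t < L.length), L[L.length - 1 - t] = f t) ∧ ∀ t, g t = f (L.length + t) := by
  simp only [concat, neg.injEq, funext_iff]
  refine ⟨fun H => ⟨fun t ht => ?_, fun t => ?_⟩, fun H t => ?_⟩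
  · rw [← H t, dif_pos ht]
  · rw [← H (L.length + t), dif_neg (by omega), Nat.add_sub_cancel_left]
  · split_ifs with ht
    · exact H.1 t ht
    · rw [H.2, Nat.add_sub_cancel' (not_lt.1 ht)]

theorem neg_concat_nat_eq (f : ℤ → Letter J) :
    (neg fun t => f (-t)).concat (nat fun t => f (t + 1)) = int f := by
  refine congrArg int (funext fun i => ?_)
  beta_reduce
  split_ifs with hi <;> congr 1 <;> omega

theorem isWord_fin_map_range {f : ℕ → Letter J} {N : ℕ} (h : ∀ t < N, (f t).Adj (f (t + 1))) :
    (fin ((List.range (N + 1)).map f)).IsWord := by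
  refine ⟨by simp, List.isChain_iff_getElem.2 fun t ht => ?_⟩
  simp only [List.length_map, List.length_range] at ht
  simpa only [List.getElem_map, List.getElem_range] using h t (by omega)

theorem HasResolvingEnds.concat (hB : B.HasResolvingEnds) (hC : C.HasResolvingEnds) :
    (B.concat C).HasResolvingEnds := by
  cases B with
  | triv v δ => exact hC
  | nat f => cases C <;> exact hB
  | int f => cases C <;> exact hB
  | fin L =>
    cases C with
    | nat f =>
      obtain ⟨N, hN⟩ := hasResolvingEnds_nat_iff.1 hC
      refine hasResolvingEnds_nat_iff.2 ⟨N + L.length, fun t ht => ?_⟩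
      rw [dif_neg (by omega)]
      exact hN _ (by omega)
    | fin M => exact hasResolvingEnds_fin _
    | _ => exact hB
  | neg f =>
    cases C with
    | fin L =>
      obtain ⟨N, hN⟩ := hasResolvingEnds_neg_iff.1 hB
      refine hasResolvingEnds_neg_iff.2 ⟨N + L.length, fun t ht => ?_⟩
      rw [dif_neg (by omega)]
      exact hN _ (by omega)
    | nat g =>
      obtain ⟨N, hN⟩ := hasResolvingEnds_neg_iff.1 hB
      obtain ⟨M, hM⟩ := hasResolvingEnds_nat_iff.1 hC
      refine hasResolvingEnds_int_iff.2 ⟨⟨M + 1, fun i hi => ?_⟩, ⟨-N, fun i hi => ?_⟩⟩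
      · rw [if_neg (by omega)]
        exact hM _ (by omega)
      · rw [if_pos (by omega)]
        exact hN _ (by omega)
    | _ => exact hB

theorem HasResolvingEnds.shift (hC : C.HasResolvingEnds) (t : ℤ) :
    (C.shift t).HasResolvingEnds := by
  cases C with
  | int f =>
    obtain ⟨⟨N, hN⟩, M, hM⟩ := hasResolvingEnds_int_iff.1 hC
    exact hasResolvingEnds_int_iff.2 ⟨⟨N - t, fun i hi => hN _ (by omega)⟩,
      ⟨M - t, fun i hi => hM _ (by omega)⟩⟩
  | _ => exact hC

end PreWord

namespace Word

variable {A C : Word J} {s : SignChoice J} {L : List (Letter J)} {f g : ℕ → Letter J}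

theorem ext_of_pre_eq (h : A.pre = C.pre) : A = C := by
  cases A
  cases C
  cases h
  rfl

theorem shift_zero (C : Word J) : C.shift 0 = C := by
  refine ext_of_pre_eq ?_
  rcases hC : C.pre with _ | _ | _ | _ | f <;> simp only [shift, PreWord.shift, hC, add_zero]

theorem IsPeriodic.not_hasResolvingEnds (hC : C.IsPeriodic) : ¬ C.pre.HasResolvingEnds := by
  intro hends
  obtain ⟨p, hp, hper⟩ := hC
  obtain ⟨f, hf⟩ := hper.1
  rw [hf] at hends
  obtain ⟨⟨N, hN⟩, M, hM⟩ := PreWord.hasResolvingEnds_int_iff.1 hends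
  have hsymm := (hper.isSymm (-|N - M|)).letterAt N
  rw [hf] at hsymm
  have hle : N + -|N - M| * p ≤ M := by
    nlinarith [le_abs_self (N - M), abs_nonneg (N - M), (Nat.one_le_cast (α := ℤ)).2 hp]
  have hinv : (f (N + -|N - M| * p)).isInv = true := by
    rw [Option.some_injective _ hsymm]
    exact (hN N le_rfl).1
  exact absurd hinv (by rw [(hM _ hle).1]; decide)

theorem isInv_and_length_eq_one_of_mem_swSet (hg : .neg g ∈ C.swSet s) (t : ℕ) :
    (g t).isInv = false ∧ (g t).path.length = 1 := by
  refine hg.2.1 (-t) _ ?_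
  rw [PreWord.letterAt, if_pos (by omega), neg_neg, Int.toNat_natCast]

theorem hasResolvingEnds_of_mem_swSet {B : PreWord J} (hB : B ∈ C.swSet s) :
    B.HasResolvingEnds := by
  obtain ⟨L, -, rfl⟩ | ⟨f, rfl⟩ := hB.1
  · exact PreWord.hasResolvingEnds_fin L
  · exact PreWord.hasResolvingEnds_neg_iff.2
      ⟨0, fun t _ => isInv_and_length_eq_one_of_mem_swSet hB t⟩

theorem isInv_and_length_eq_one_of_mem_seSet (hg : .nat g ∈ C.seSet s) (t : ℕ) :
    (g t).isInv = true ∧ (g t).path.length = 1 := by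
  refine hg.2.1 (t + 1) _ ?_
  rw [PreWord.letterAt, if_pos (by omega), add_sub_cancel_right, Int.toNat_natCast]

theorem hasResolvingEnds_of_mem_seSet {D : PreWord J} (hD : D ∈ C.seSet s) :
    D.HasResolvingEnds := by
  obtain ⟨L, -, rfl⟩ | ⟨f, rfl⟩ := hD.1
  · exact PreWord.hasResolvingEnds_fin L
  · exact PreWord.hasResolvingEnds_nat_iff.2
      ⟨0, fun t _ => isInv_and_length_eq_one_of_mem_seSet hD t⟩

theorem IsFinite.hasResolvingEnds (hC : C.IsFinite) : C.pre.HasResolvingEnds := by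
  rcases hC with ⟨v, δ, h⟩ | ⟨L, h⟩ <;> rw [h]
  · exact PreWord.hasResolvingEnds_triv v δ
  · exact PreWord.hasResolvingEnds_fin L

theorem hasResolvingEnds_sw (hC : C.pre.HasResolvingEnds) (s : SignChoice J) :
    (C.sw s).pre.HasResolvingEnds := by
  unfold sw
  split_ifs with h
  · exact (hasResolvingEnds_of_mem_swSet h.choose_spec.1).concat hC
  · exact hC

theorem hasResolvingEnds_se (hC : C.pre.HasResolvingEnds) (s : SignChoice J) :
    (C.se s).pre.HasResolvingEnds := by
  unfold se
  split_ifs with h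
  · exact hC.concat (hasResolvingEnds_of_mem_seSet h.choose_spec.1)
  · exact hC

theorem hasResolvingEnds_swse (hC : C.pre.HasResolvingEnds) (s : SignChoice J) :
    (C.swse s).pre.HasResolvingEnds := by
  unfold swse
  split_ifs with h
  · exact (hasResolvingEnds_of_mem_swSet h.choose_spec.1).concat (hasResolvingEnds_se hC s)
  · exact hasResolvingEnds_se hC s

theorem length_pos (hC : C.pre = .fin L) : 0 < L.length := by
  have hword := C.isWord
  rw [hC] at hword
  exact List.length_pos_iff.2 hword.1

theorem eq_of_nat_mem_seSet (hC : C.pre = .fin L) (hf : .nat f ∈ C.seSet s)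
    (hg : .nat g ∈ C.seSet s) : f = g := by
  obtain ⟨F, hF⟩ : ∃ F, (PreWord.fin L).concat (.nat f) = .nat F := ⟨_, rfl⟩
  obtain ⟨G, hG⟩ : ∃ G, (PreWord.fin L).concat (.nat g) = .nat G := ⟨_, rfl⟩
  obtain ⟨hFL, hFf⟩ := PreWord.fin_concat_nat_eq_iff.1 hF
  obtain ⟨hGL, hGg⟩ := PreWord.fin_concat_nat_eq_iff.1 hG
  have hup {f F : ℕ → Letter J} (hf : .nat f ∈ C.seSet s) (h : ∀ t, f t = F (L.length + t))
      (t : ℕ) (ht : t ≥ L.length) : (F t).isInv = true ∧ (F t).path.length = 1 := by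
    have harrow := isInv_and_length_eq_one_of_mem_seSet hf (t - L.length)
    rwa [h, Nat.add_sub_cancel' ht] at harrow
  have hFG : F = G := PreWord.eq_of_isWord_nat s (hF ▸ hC ▸ hf.2.2.isWord)
    (hG ▸ hC ▸ hg.2.2.isWord) (length_pos hC)
    (fun t ht => (hFL t ht).symm.trans (hGL t ht)) (hup hf hFf) (hup hg hGg)
  exact funext fun t => (hFf t).trans (hFG ▸ (hGg t).symm)

theorem isLongest_seSet_iff (hC : C.pre = .fin L) (hg : .nat g ∈ C.seSet s) {D : PreWord J} :
    IsLongest (C.seSet s) D ↔ D = .nat g := by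
  constructor
  · rintro ⟨hD, hmax⟩
    obtain ⟨M, -, rfl⟩ | ⟨f, rfl⟩ := hD.1
    · exact absurd (hmax _ hg) (by simp [PreWord.length])
    · rw [eq_of_nat_mem_seSet hC hD hg]
  · rintro rfl
    exact ⟨hg, fun _ _ => le_top⟩

theorem eq_of_neg_mem_swSet (hC : C.pre = .fin L) (hf : .neg f ∈ C.swSet s)
    (hg : .neg g ∈ C.swSet s) : f = g := by
  obtain ⟨F, hF⟩ : ∃ F, (PreWord.neg f).concat (.fin L) = .neg F := ⟨_, rfl⟩
  obtain ⟨G, hG⟩ : ∃ G, (PreWord.neg g).concat (.fin L) = .neg G := ⟨_, rfl⟩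
  obtain ⟨hFL, hFf⟩ := PreWord.neg_concat_fin_eq_iff.1 hF
  obtain ⟨hGL, hGg⟩ := PreWord.neg_concat_fin_eq_iff.1 hG
  have hup {f F : ℕ → Letter J} (hf : .neg f ∈ C.swSet s) (h : ∀ t, f t = F (L.length + t))
      (t : ℕ) (ht : t ≥ L.length) : (F t).isInv = false ∧ (F t).path.length = 1 := by
    have harrow := isInv_and_length_eq_one_of_mem_swSet hf (t - L.length)
    rwa [h, Nat.add_sub_cancel' ht] at harrow
  have hFG : F = G := PreWord.eq_of_isWord_neg s (hF ▸ hC ▸ hf.2.2.isWord)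
    (hG ▸ hC ▸ hg.2.2.isWord) (length_pos hC)
    (fun t ht => (hFL t ht).symm.trans (hGL t ht)) (hup hf hFf) (hup hg hGg)
  exact funext fun t => (hFf t).trans (hFG ▸ (hGg t).symm)

theorem isLongest_swSet_iff (hC : C.pre = .fin L) (hg : .neg g ∈ C.swSet s) {B : PreWord J} :
    IsLongest (C.swSet s) B ↔ B = .neg g := by
  constructor
  · rintro ⟨hB, hmax⟩
    obtain ⟨M, -, rfl⟩ | ⟨f, rfl⟩ := hB.1
    · exact absurd (hmax _ hg) (by simp [PreWord.length])
    · rw [eq_of_neg_mem_swSet hC hB hg]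
  · rintro rfl
    exact ⟨hg, fun _ _ => le_top⟩

theorem nat_mem_seSet (hC : C.pre = .fin L) (h : ((PreWord.fin L).concat (.nat g)).IsWord)
    (hg : ∀ t, (g t).isInv = true ∧ (g t).path.length = 1) : .nat g ∈ C.seSet s := by
  refine ⟨.inr ⟨g, rfl⟩, fun i l hl => ?_, by rwa [hC], nofun, by rw [hC]; exact nofun⟩
  rw [PreWord.letterAt] at hl
  split_ifs at hl
  exact Option.some_injective _ hl ▸ hg _

theorem neg_mem_swSet (hC : C.pre = .fin L) (h : ((PreWord.neg g).concat (.fin L)).IsWord)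
    (hg : ∀ t, (g t).isInv = false ∧ (g t).path.length = 1) : .neg g ∈ C.swSet s := by
  refine ⟨.inr ⟨g, rfl⟩, fun i l hl => ?_, by rwa [hC], by rw [hC]; exact nofun, nofun⟩
  rw [PreWord.letterAt] at hl
  split_ifs at hl
  exact Option.some_injective _ hl ▸ hg _

theorem pre_se (hC : C.pre = .fin L) (hg : .nat g ∈ C.seSet s) :
    (C.se s).pre = (PreWord.fin L).concat (.nat g) := by
  have h : ∃ D, IsLongest (C.seSet s) D := ⟨_, (isLongest_seSet_iff hC hg).2 rfl⟩
  rw [se, dif_pos h]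
  exact congrArg₂ PreWord.concat hC ((isLongest_seSet_iff hC hg).1 h.choose_spec)

theorem pre_sw (hC : C.pre = .fin L) (hg : .neg g ∈ C.swSet s) :
    (C.sw s).pre = (PreWord.neg g).concat (.fin L) := by
  have h : ∃ B, IsLongest (C.swSet s) B := ⟨_, (isLongest_swSet_iff hC hg).2 rfl⟩
  rw [sw, dif_pos h]
  exact congrArg₂ PreWord.concat ((isLongest_swSet_iff hC hg).1 h.choose_spec) hC

theorem pre_swse (hC : C.pre = .fin L) (hg : .neg g ∈ C.swSet s) (hf : .nat f ∈ C.seSet s) :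
    (C.swse s).pre = (PreWord.neg g).concat ((PreWord.fin L).concat (.nat f)) := by
  have h : ∃ B, IsLongest (C.swSet s) B := ⟨_, (isLongest_swSet_iff hC hg).2 rfl⟩
  rw [swse, dif_pos h]
  exact congrArg₂ PreWord.concat ((isLongest_swSet_iff hC hg).1 h.choose_spec) (pre_se hC hf)

theorem exists_se_eq (s : SignChoice J) (hA : A.pre = .nat f) (hends : A.pre.HasResolvingEnds) :
    ∃ C : Word J, C.IsFinite ∧ C.se s = A := by
  have hword := A.isWord
  rw [hA] at hends hword
  obtain ⟨N, hN⟩ := PreWord.hasResolvingEnds_nat_iff.1 hends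
  let C : Word J := ⟨_, PreWord.isWord_fin_map_range (N := N) fun t _ => hword t⟩
  have hconcat : C.pre.concat (.nat fun t => f (N + 1 + t)) = .nat f :=
    PreWord.fin_concat_nat_eq_iff.2 (by simp)
  have hmem : .nat (fun t => f (N + 1 + t)) ∈ C.seSet s :=
    nat_mem_seSet rfl (hconcat ▸ hword) fun t => hN _ (by omega)
  exact ⟨C, .inr ⟨_, rfl⟩, ext_of_pre_eq ((pre_se rfl hmem).trans (hconcat.trans hA.symm))⟩

theorem exists_sw_eq (s : SignChoice J) (hA : A.pre = .neg f) (hends : A.pre.HasResolvingEnds) :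
    ∃ C : Word J, C.IsFinite ∧ C.sw s = A := by
  have hword := A.isWord
  rw [hA] at hends hword
  obtain ⟨N, hN⟩ := PreWord.hasResolvingEnds_neg_iff.1 hends
  have hadj : ∀ t < N, (f (N - t)).Adj (f (N - (t + 1))) := fun t ht => by
    have hsucc : N - t = N - (t + 1) + 1 := by omega
    simpa only [hsucc] using hword (N - (t + 1))
  let C : Word J := ⟨_, PreWord.isWord_fin_map_range (f := fun t => f (N - t)) hadj⟩
  have hconcat : (PreWord.neg fun t => f (N + 1 + t)).concat C.pre = .neg f := by
    refine PreWord.neg_concat_fin_eq_iff.2 ⟨fun t ht => ?_, by simp⟩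
    simp only [List.length_map, List.length_range] at ht
    simp only [List.getElem_map, List.getElem_range, List.length_map, List.length_range]
    congr 1
    omega
  have hmem : .neg (fun t => f (N + 1 + t)) ∈ C.swSet s :=
    neg_mem_swSet rfl (hconcat ▸ hword) fun t => hN _ (by omega)
  exact ⟨C, .inr ⟨_, rfl⟩, ext_of_pre_eq ((pre_sw rfl hmem).trans (hconcat.trans hA.symm))⟩

theorem exists_pre_swse_eq_int (s : SignChoice J) {f : ℤ → Letter J} (hf : (PreWord.int f).IsWord)
    (hends : (PreWord.int f).HasResolvingEnds)
    (hleft : ∀ i ≤ 0, (f i).isInv = false ∧ (f i).path.length = 1) :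
    ∃ C : Word J, C.IsFinite ∧ (C.swse s).pre = .int f := by
  obtain ⟨⟨N, hN⟩, -⟩ := PreWord.hasResolvingEnds_int_iff.1 hends
  have hpos : (PreWord.nat fun t => f (t + 1)).IsWord := fun t => by
    push_cast
    exact hf _
  have hneg : (PreWord.neg fun t => f (-t)).IsWord := fun t => by
    have hsucc : -(t : ℤ) = -((t + 1 : ℕ) : ℤ) + 1 := by push_cast; ring
    simpa only [hsucc] using hf (-((t + 1 : ℕ) : ℤ))
  let C : Word J := ⟨_, PreWord.isWord_fin_map_range (N := N.toNat) fun t _ => hpos t⟩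
  have hconcat : C.pre.concat (.nat fun t => f ((N.toNat + 1 + t : ℕ) + 1)) =
      .nat fun t => f (t + 1) :=
    PreWord.fin_concat_nat_eq_iff.2 (by simp)
  have hse : .nat (fun t => f ((N.toNat + 1 + t : ℕ) + 1)) ∈ C.seSet s :=
    nat_mem_seSet rfl (hconcat ▸ hpos) fun t => hN _ (by omega)
  have hadj : ((PreWord.neg fun t => f (-t)).concat C.pre).IsWord := by
    refine PreWord.isWord_concat hneg C.isWord fun a ha b hb => ?_
    obtain rfl : f 0 = a := Option.some_injective _ ha
    obtain rfl : f 1 = b := by simpa [C, PreWord.firstLetter, List.head?_range] using hb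
    exact hf 0
  have hsw : .neg (fun t => f (-t)) ∈ C.swSet s :=
    neg_mem_swSet rfl hadj fun t => hleft _ (by omega)
  refine ⟨C, .inr ⟨_, rfl⟩, (pre_swse rfl hsw hse).trans ?_⟩
  rw [← PreWord.neg_concat_nat_eq f]
  exact congrArg _ hconcat

theorem exists_swse_shift_eq (s : SignChoice J) {f : ℤ → Letter J} (hA : A.pre = .int f)
    (hends : A.pre.HasResolvingEnds) :
    ∃ C : Word J, C.IsFinite ∧ ∃ t : ℤ, (C.swse s).shift t = A := by
  have hword := A.isWord
  rw [hA] at hends hword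
  obtain ⟨M, hM⟩ := (PreWord.hasResolvingEnds_int_iff.1 hends).2
  obtain ⟨C, hC, hpre⟩ := exists_pre_swse_eq_int s (f := fun i => f (i + M))
    (fun i => by simpa only [add_right_comm] using hword (i + M))
    (hends.shift M) fun i hi => hM _ (by omega)
  refine ⟨C, hC, -M, ext_of_pre_eq ?_⟩
  change (C.swse s).pre.shift (-M) = A.pre
  rw [hpre, hA]
  exact congrArg PreWord.int (funext fun i => congrArg f (neg_add_cancel_right i M))

theorem hasResolvingEnds_iff (s : SignChoice J) : A.pre.HasResolvingEnds ↔
    ∃ C : Word J, C.IsFinite ∧ ∃ t : ℤ,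
      A = C.shift t ∨ A = (C.sw s).shift t ∨ A = (C.se s).shift t ∨ A = (C.swse s).shift t := by
  constructor
  · intro h
    rcases hA : A.pre with ⟨v, δ⟩ | L | f | f | f
    · exact ⟨A, .inl ⟨v, δ, hA⟩, 0, .inl A.shift_zero.symm⟩
    · exact ⟨A, .inr ⟨L, hA⟩, 0, .inl A.shift_zero.symm⟩
    · obtain ⟨C, hC, rfl⟩ := exists_se_eq s hA h
      exact ⟨C, hC, 0, .inr (.inr (.inl (shift_zero _).symm))⟩
    · obtain ⟨C, hC, rfl⟩ := exists_sw_eq s hA h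
      exact ⟨C, hC, 0, .inr (.inl (shift_zero _).symm)⟩
    · obtain ⟨C, hC, t, rfl⟩ := exists_swse_shift_eq s hA h
      exact ⟨C, hC, t, .inr (.inr (.inr rfl))⟩
  · rintro ⟨C, hC, t, rfl | rfl | rfl | rfl⟩
    · exact hC.hasResolvingEnds.shift t
    · exact (hasResolvingEnds_sw hC.hasResolvingEnds s).shift t
    · exact (hasResolvingEnds_se hC.hasResolvingEnds s).shift t
    · exact (hasResolvingEnds_swse hC.hasResolvingEnds s).shift t

end Word

end Words

/-! ### Finiteness of band complexes -/

section Bands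

variable {k : Type u} [Field k] {Q : Type u} [Quiver.{u} Q] [Fintype Q]
  {J : TwoSidedIdeal (PathAlgebra k Q)}

namespace Word

variable {C : Word J} {hC : C.IsPeriodic} {n : ℤ}

theorem IsPeriodic.period_pos (hC : C.IsPeriodic) : 0 < (C.period : ℤ) :=
  Int.natCast_pos.2 (Nat.sInf_mem (s := {p : ℕ | 0 < p ∧ C.HasPeriod p}) hC).1

theorem IsPeriodic.exists_forall_abs_mu_le (hC : C.IsPeriodic) : ∃ b, ∀ i, |C.pre.mu i| ≤ b := by
  obtain ⟨b, hb⟩ := ((Set.finite_Ico (0 : ℤ) C.period).image fun i => |C.pre.mu i|).bddAbove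
  refine ⟨b, fun i => ?_⟩
  rw [← Int.emod_add_ediv_mul i C.period, (hC.hasPeriod.isSymm _).mu]
  exact hb ⟨_, ⟨Int.emod_nonneg _ hC.period_pos.ne', Int.emod_lt_of_pos _ hC.period_pos⟩, rfl⟩

theorem coe_C_mul_T_smul (c : k) (t : ℤ) (x : BandComp hC n) :
    ((LaurentPolynomial.C c * LaurentPolynomial.T t : k[T;T⁻¹]) • x : C.pre.comp n).1 =
      algebraMap k (Lam J) c • PreWord.translate (t * C.period) (x : C.pre.comp n).1 := by
  rw [laurent_smul_def, ← LaurentPolynomial.single_eq_C_mul_T, laurentHom,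
    AddMonoidAlgebra.lift_single]
  exact (algebraMap_smul (Lam J) c _).symm

variable (hC) in
/-- The generator `b_i` as an element of `Pⁿ(C)`, and zero if it is not of degree `n`. -/
def bandGen (n i : ℤ) : BandComp hC n := C.pre.gen n i

theorem T_smul_bandGen (t i : ℤ) :
    (LaurentPolynomial.T t : k[T;T⁻¹]) • bandGen hC n i = bandGen hC n (i - t * C.period) := by
  have hsymm := hC.hasPeriod.isSymm t
  have hmu := hsymm.mu (i - t * C.period)
  have hvertex := hsymm.vertexAt (i - t * C.period)
  rw [sub_add_cancel] at hmu hvertex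
  have htranslate := coe_C_mul_T_smul 1 t (bandGen hC n i)
  rw [map_one, one_mul, map_one, one_smul] at htranslate
  refine Subtype.ext (htranslate.trans ((PreWord.translate_single ..).trans ?_))
  simp only [bandGen, PreWord.gen, PreWord.idemAt, hmu, hvertex]

variable {V : Type u} [AddCommGroup V] [Module k[T;T⁻¹] V]

theorem bandGen_tmul (i : ℤ) (v : V) : bandGen hC n i ⊗ₜ[k[T;T⁻¹]] v =
    bandGen hC n (i % C.period) ⊗ₜ ((LaurentPolynomial.T (-(i / C.period)) : k[T;T⁻¹]) • v) := by
  rw [← TensorProduct.smul_tmul, T_smul_bandGen, neg_mul, sub_neg_eq_add, Int.emod_add_ediv_mul]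

variable (hC) in
/-- The homomorphism `x ↦ x ⊗ v`. -/
def tmulHom (n : ℤ) (v : V) : C.pre.comp n →ₗ[Lam J] BandComp hC n ⊗[k[T;T⁻¹]] V where
  toFun x := (show BandComp hC n from x) ⊗ₜ v
  map_add' x y := TensorProduct.add_tmul (show BandComp hC n from x) (show BandComp hC n from y) v
  map_smul' _ _ := rfl

theorem bandTensor_hom_ext {R W : Type*} [Ring R] {σ : Lam J →+* R} [AddCommGroup W] [Module R W]
    {f g : BandComp hC n ⊗[k[T;T⁻¹]] V →ₛₗ[σ] W}
    (h : ∀ i v, f (bandGen hC n i ⊗ₜ v) = g (bandGen hC n i ⊗ₜ v)) : f = g := by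
  refine LinearMap.ext fun x => ?_
  induction x using TensorProduct.induction_on with
  | zero => rw [map_zero, map_zero]
  | add x y hx hy => rw [map_add, map_add, hx, hy]
  | tmul x v =>
    have htmul : f.comp (tmulHom hC n v) = g.comp (tmulHom hC n v) := by
      refine LinearMap.ext_on (C.pre.span_gen n) ?_
      rintro _ ⟨i, -, rfl⟩
      exact h i v
    exact LinearMap.congr_fun htmul x

variable (hC V) in
theorem exists_subsingleton_bandTensor : ∃ b, ∀ n : ℤ, b < |n| →
    Subsingleton (BandComp hC n ⊗[k[T;T⁻¹]] V) := by
  obtain ⟨b, hb⟩ := hC.exists_forall_abs_mu_le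
  refine ⟨b, fun n hn => ?_⟩
  have hid : (LinearMap.id : BandComp hC n ⊗[k[T;T⁻¹]] V →ₗ[Lam J] _) = 0 := by
    refine bandTensor_hom_ext fun i v => ?_
    have hgen : C.pre.gen n i = 0 := PreWord.gen_eq_zero fun hi => (hb i).not_gt (hi.1 ▸ hn)
    exact (congrArg (tmulHom hC n v) hgen).trans (map_zero _)
  exact subsingleton_of_forall_eq 0 (LinearMap.congr_fun hid)

theorem bandComplex_d_tmul {m : ℤ} (h : n + 1 = m) (x : C.pre.comp n) (v : V) :
    (bandComplex hC V).d n m (tmulHom hC n v x) = tmulHom hC m v (C.dHom h x) := by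
  have hd : (bandComplex hC V).d n m = ModuleCat.ofHom (bandDiff hC V h) := dif_pos h
  rw [hd]
  rfl

theorem map_bandComplex_d_apply {W : Type*} [AddCommGroup W] [Module k W] (hJ : IsQuadratic J)
    (w : Q) {m : ℤ} (φ : (bandComplex hC V).X m →ₛₗ[hJ.vertexHom w] W)
    (x : (bandComplex hC V).X n) (h : n + 1 = m) : φ ((bandComplex hC V).d n m x) = 0 := by
  have hzero : φ.comp ((bandComplex hC V).d n m).hom = 0 := bandTensor_hom_ext fun i v =>
    (congrArg φ ((bandComplex_d_tmul h _ v).trans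
      (congrArg (tmulHom hC m v) (C.stringComplex_d_apply h (C.pre.gen n i)).symm))).trans
      (map_stringComplex_d_apply hJ w (φ.comp (tmulHom hC m v)) _ h)
  exact LinearMap.congr_fun hzero x

variable [Module k V] [IsScalarTower k k[T;T⁻¹] V]

/-- The homomorphism from `⨁ Λ b_i` which sends `b_{r + tp}` to `1 ⊗ T⁻ᵗ v`, where `p` is the
period of `C`, and the other `b_i` to zero, as a function of `v`. -/
def periodCoord (C : Word J) (r : ℤ) : V →ₗ[k] (ℤ →₀ Lam J) →ₗ[Lam J] Lam J ⊗[k] V :=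
  (Finsupp.llift (Lam J ⊗[k] V) (Lam J) k ℤ).toLinearMap ∘ₗ LinearMap.pi fun i =>
    if i % C.period = r then
      TensorProduct.mk k (Lam J) V 1 ∘ₗ
        Algebra.lsmul k k V (LaurentPolynomial.T (-(i / C.period)) : k[T;T⁻¹])
    else 0

theorem periodCoord_single (r i : ℤ) (a : Lam J) (v : V) :
    periodCoord C r v (Finsupp.single i a) =
      if i % C.period = r then
        a ⊗ₜ ((LaurentPolynomial.T (-(i / C.period)) : k[T;T⁻¹]) • v)
      else 0 := by
  simp only [periodCoord, LinearMap.comp_apply, LinearEquiv.coe_coe, Finsupp.llift_apply,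
    Finsupp.lift_apply, zero_smul, Finsupp.sum_single_index, LinearMap.pi_apply]
  split_ifs
  · simp [TensorProduct.smul_tmul']
  · rw [LinearMap.zero_apply, smul_zero]

theorem periodCoord_translate (hC : C.IsPeriodic) (r t : ℤ) (v : V) (f : ℤ →₀ Lam J) :
    periodCoord C r v (PreWord.translate (t * C.period) f) =
      periodCoord C r ((LaurentPolynomial.T t : k[T;T⁻¹]) • v) f := by
  induction f using Finsupp.induction_linear with
  | zero => simp only [map_zero]
  | add f g hf hg => simp only [map_add, hf, hg]
  | single i a =>
    rw [PreWord.translate_single, periodCoord_single, periodCoord_single,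
      Int.sub_mul_emod_self_right, Int.sub_mul_ediv_right _ _ hC.period_pos.ne', smul_smul,
      ← LaurentPolynomial.T_add, neg_sub, neg_add_eq_sub]

theorem periodCoord_laurent_smul (r : ℤ) (q : k[T;T⁻¹]) (x : BandComp hC n) (v : V) :
    periodCoord C r v (q • x : C.pre.comp n).1 =
      periodCoord C r (q • v) (x : C.pre.comp n).1 := by
  induction q using LaurentPolynomial.induction_on' with
  | add q q' hq hq' =>
    have hadd : ((q + q') • x : C.pre.comp n).1 =
        (q • x : C.pre.comp n).1 + (q' • x : C.pre.comp n).1 :=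
      congrArg Subtype.val (add_smul q q' x)
    rw [hadd, map_add, hq, hq', add_smul, map_add, LinearMap.add_apply]
  | C_mul_T t c =>
    have hsmul : (LaurentPolynomial.C c * LaurentPolynomial.T t : k[T;T⁻¹]) • v =
        c • (LaurentPolynomial.T t : k[T;T⁻¹]) • v :=
      (mul_smul _ _ v).trans (algebraMap_smul k[T;T⁻¹] c _)
    rw [coe_C_mul_T_smul, map_smul (periodCoord C r v), periodCoord_translate hC, hsmul,
      map_smul (periodCoord C r), LinearMap.smul_apply, algebraMap_smul]

variable (hC) in
/-- The homomorphism from `Pⁿ(C) ⊗ V` which is given by `periodCoord`. -/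
def bandCoord (n r : ℤ) : BandComp hC n ⊗[k[T;T⁻¹]] V →ₗ[Lam J] Lam J ⊗[k] V :=
  let F : BandComp hC n ⊗[k[T;T⁻¹]] V →+ Lam J ⊗[k] V := TensorProduct.liftAddHom
    (AddMonoidHom.mk' (fun x : BandComp hC n => AddMonoidHom.mk'
      (fun v : V => periodCoord C r v (x : C.pre.comp n).1)
      fun v w => by rw [map_add, LinearMap.add_apply])
      fun x y => AddMonoidHom.ext fun v => map_add (periodCoord C r v) _ _)
    fun q x v => periodCoord_laurent_smul r q x v
  { F with
    map_smul' a x := by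
      change F (a • x) = a • F x
      induction x using TensorProduct.induction_on with
      | zero => rw [smul_zero, map_zero, smul_zero]
      | tmul x v => exact map_smul (periodCoord C r v) a (x : C.pre.comp n).1
      | add x y hx hy => rw [smul_add, map_add, map_add, smul_add, hx, hy] }

theorem bandCoord_bandGen_tmul (r i : ℤ) (v : V) :
    bandCoord hC n r (bandGen hC n i ⊗ₜ v) =
      if i % C.period = r then
        (C.pre.gen n i).1 i ⊗ₜ ((LaurentPolynomial.T (-(i / C.period)) : k[T;T⁻¹]) • v)
      else 0 := by
  have hgen : (C.pre.gen n i).1 = Finsupp.single i ((C.pre.gen n i).1 i) := by simp [PreWord.gen]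
  exact (congrArg (periodCoord C r v) hgen).trans (periodCoord_single r i _ v)

instance : Module k (BandComp hC n) := inferInstanceAs (Module k (C.pre.comp n))
instance : IsScalarTower k (Lam J) (BandComp hC n) :=
  inferInstanceAs (IsScalarTower k (Lam J) (C.pre.comp n))
instance : IsScalarTower k k[T;T⁻¹] (BandComp hC n) :=
  .of_algebraMap_smul fun c => LinearMap.congr_fun ((laurentHom hC n).commutes c)

variable (hC V) in
/-- The homomorphism `a ⊗ v ↦ a b_r ⊗ v`. -/
def bandIncl (n r : ℤ) : Lam J ⊗[k] V →ₗ[Lam J] BandComp hC n ⊗[k[T;T⁻¹]] V :=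
  TensorProduct.AlgebraTensorModule.lift <| LinearMap.toSpanSingleton (Lam J)
    (V →ₗ[k] BandComp hC n ⊗[k[T;T⁻¹]] V)
    ((TensorProduct.mk k[T;T⁻¹] (BandComp hC n) V (bandGen hC n r)).restrictScalars k)

theorem bandIncl_tmul (r : ℤ) (a : Lam J) (v : V) :
    bandIncl hC V n r (a ⊗ₜ v) = a • (bandGen hC n r ⊗ₜ v) := rfl

theorem sum_bandIncl_bandCoord :
    ∑ r ∈ Finset.Ico 0 (C.period : ℤ), bandIncl hC V n r ∘ₗ bandCoord hC n r = LinearMap.id := by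
  refine bandTensor_hom_ext fun i v => ?_
  have hr : i % C.period ∈ Finset.Ico 0 (C.period : ℤ) := Finset.mem_Ico.2
    ⟨Int.emod_nonneg _ hC.period_pos.ne', Int.emod_lt_of_pos _ hC.period_pos⟩
  have hgen : (C.pre.gen n i).1 i • C.pre.gen n i = C.pre.gen n i :=
    Subtype.ext (by rw [PreWord.coe_smul_gen]; simp [PreWord.gen])
  rw [LinearMap.sum_apply, Finset.sum_eq_single_of_mem _ hr, LinearMap.comp_apply,
    bandCoord_bandGen_tmul, if_pos rfl, bandIncl_tmul, ← bandGen_tmul]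
  · exact congrArg (tmulHom hC n v) hgen
  · intro r _ hne
    rw [LinearMap.comp_apply, bandCoord_bandGen_tmul, if_neg hne.symm, map_zero]

variable (hC V) in
/-- The homomorphism to `Pⁿ(C) ⊗ V` from the sum of the copies of `Λ ⊗ V` which belong to the
`b_r` in one period. -/
def bandCover (n : ℤ) :
    (Finset.Ico 0 (C.period : ℤ) → Lam J ⊗[k] V) →ₗ[Lam J] BandComp hC n ⊗[k[T;T⁻¹]] V :=
  ∑ r : Finset.Ico 0 (C.period : ℤ), bandIncl hC V n r ∘ₗ LinearMap.proj r

variable (hC V) in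
theorem bandCover_comp_pi_bandCoord (n : ℤ) :
    bandCover hC V n ∘ₗ LinearMap.pi (fun r => bandCoord hC n r) = LinearMap.id := by
  rw [← sum_bandIncl_bandCoord, ← Finset.sum_coe_sort]
  ext x
  simp [bandCover]

variable [FiniteDimensional k V]

instance projective_bandTensor : Module.Projective (Lam J) (BandComp hC n ⊗[k[T;T⁻¹]] V) :=
  .of_split _ _ (bandCover_comp_pi_bandCoord hC V n)

instance finite_bandTensor : Module.Finite (Lam J) (BandComp hC n ⊗[k[T;T⁻¹]] V) :=
  .of_surjective _ (LinearMap.surjective_of_comp_eq_id _ _ (bandCover_comp_pi_bandCoord hC V n))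

theorem isPlusB_bandComplex : IsPlusB (bandComplex hC V) := by
  obtain ⟨b, hb⟩ := exists_subsingleton_bandTensor hC V
  refine .of_forall_exactAt (fun n => projective_bandTensor) (fun n => finite_bandTensor)
    ⟨-b, fun n hn => hb n (lt_abs.2 (.inr (lt_neg.2 hn)))⟩ ⟨b, fun n hn => ?_⟩
  have : Subsingleton ((bandComplex hC V).X n) := hb n (lt_abs.2 (.inl hn))
  exact .of_isZero (ModuleCat.isZero_of_subsingleton _)

end Word

end Bands

section BandDimension

variable {k : Type u} [Field k] {Q : Type u} [Quiver.{u} Q] [Fintype Q]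
  {J : TwoSidedIdeal (PathAlgebra k Q)}

/-- The map `a ⊗ v ↦ χ(a) v`, where `χ` is the character of the simple module at the vertex `w`. -/
def vertexEval (hJ : IsQuadratic J) (w : Q) (V : Type*) [AddCommGroup V] [Module k V] :
    Lam J ⊗[k] V →ₛₗ[hJ.vertexHom w] V :=
  let χ : Lam J →ₐ[k] k := AlgHom.mk (hJ.vertexHom w) (hJ.vertexHom_algebraMap w)
  let F : Lam J ⊗[k] V →ₗ[k] V := TensorProduct.lift (LinearMap.lsmul k V ∘ₗ χ.toLinearMap)
  { F with
    map_smul' a x := by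
      change F (a • x) = χ a • F x
      induction x using TensorProduct.induction_on with
      | zero => rw [smul_zero, map_zero, smul_zero]
      | add x y hx hy => rw [smul_add, map_add, map_add, smul_add, hx, hy]
      | tmul b v =>
        change χ (a * b) • v = χ a • χ b • v
        rw [map_mul, mul_smul] }

theorem vertexEval_tmul (hJ : IsQuadratic J) (w : Q) {V : Type*} [AddCommGroup V] [Module k V]
    (a : Lam J) (v : V) : vertexEval hJ w V (a ⊗ₜ v) = hJ.vertexHom w a • v := rfl

namespace Word

variable {C : Word J} (hC : C.IsPeriodic)

theorem IsPeriodic.exists_vertexAt_zero (hC : C.IsPeriodic) : ∃ w, C.pre.vertexAt 0 = some w := by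
  obtain ⟨f, hf⟩ := hC.hasPeriod.1
  exact ⟨_, PreWord.vertexAt_of_letterAt (l := f 0) (by rw [hf]; rfl)⟩

theorem finiteDimensional_of_homotopyEquiv {V : Type u} [AddCommGroup V] [Module k V]
    [Module k[T;T⁻¹] V] [IsScalarTower k k[T;T⁻¹] V] (hJ : IsQuadratic J)
    {Y : CochainComplex (ModuleCat.{u} (Lam J)) ℤ} (e : HomotopyEquiv (bandComplex hC V) Y)
    (hY : IsPlusB Y) : FiniteDimensional k V := by
  obtain ⟨w, hw⟩ := hC.exists_vertexAt_zero
  let φ : (bandComplex hC V).X 0 →ₛₗ[hJ.vertexHom w] V :=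
    (vertexEval hJ w V).comp (bandCoord hC 0 0)
  have hφ (v : V) : φ (bandGen hC 0 0 ⊗ₜ v : BandComp hC 0 ⊗[k[T;T⁻¹]] V) = v := by
    have hgen : (C.pre.gen 0 0).1 0 = idem J w := by
      rw [PreWord.coe_gen (by simp [PreWord.mu]) hw, Finsupp.single_eq_same]
    have hcoord : bandCoord hC 0 0 (bandGen hC 0 0 ⊗ₜ[k[T;T⁻¹]] v) = idem J w ⊗ₜ v := by
      rw [bandCoord_bandGen_tmul, if_pos (Int.zero_emod _), hgen, Int.zero_ediv, neg_zero,
        LaurentPolynomial.T_zero, one_smul]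
    refine (congrArg (vertexEval hJ w V) hcoord).trans ?_
    rw [vertexEval_tmul, hJ.vertexHom_idem, one_smul]
  have hinv := map_inv_hom_apply (fun n m => map_bandComplex_d_apply hJ w) e φ
  have : RingHomSurjective (hJ.vertexHom w) :=
    ⟨fun c => ⟨algebraMap k (Lam J) c, hJ.vertexHom_algebraMap w c⟩⟩
  have := hY.finite 0
  refine Module.Finite.of_surjective (φ.comp (e.inv.f 0).hom) fun v => ?_
  exact ⟨_, (hinv _).trans (hφ v)⟩

end Word

end BandDimension

theorem inKPlusB_stringComplex_iff {k : Type u} [Field k] {Q : Type u} [Quiver.{u} Q] [Fintype Q]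
    {J : TwoSidedIdeal (PathAlgebra k Q)} (hJ : IsQuadratic J) (s : SignChoice J) {A : Word J} :
    InKPlusB ((HomotopyCategory.quotient _ _).obj A.stringComplex) ↔ A.pre.HasResolvingEnds := by
  rw [inKPlusB_quotient_iff]
  constructor
  · rintro ⟨Y, hY, ⟨e⟩⟩
    exact Word.hasResolvingEnds_of_homotopyEquiv hJ e hY
  · exact fun h => ⟨_, Word.isPlusB_stringComplex hJ s h, ⟨.refl _⟩⟩

theorem inKPlusB_bandComplex_iff {k : Type u} [Field k] {Q : Type u} [Quiver.{u} Q] [Fintype Q]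
    {J : TwoSidedIdeal (PathAlgebra k Q)} (hJ : IsQuadratic J) {D : Word J} (hD : D.IsPeriodic)
    (V : Type u) [AddCommGroup V] [Module k V] [Module k[T;T⁻¹] V] [IsScalarTower k k[T;T⁻¹] V] :
    InKPlusB ((HomotopyCategory.quotient _ _).obj (Word.bandComplex hD V)) ↔
      FiniteDimensional k V := by
  rw [inKPlusB_quotient_iff]
  constructor
  · rintro ⟨Y, hY, ⟨e⟩⟩
    exact Word.finiteDimensional_of_homotopyEquiv hD hJ e hY
  · exact fun _ => ⟨_, Word.isPlusB_bandComplex, ⟨.refl _⟩⟩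

theorem proposition3_general {k : Type u} [Field k] {Q : Type u} [Quiver.{u} Q] [Fintype Q]
    {J : TwoSidedIdeal (PathAlgebra k Q)} (hJ : IsQuadratic J) (s : SignChoice J) :
    (∀ A : Word J,
      (A.IsAperiodic ∧ InKPlusB ((HomotopyCategory.quotient _ _).obj A.stringComplex)) ↔
        ∃ C : Word J, C.IsFinite ∧ ∃ t : ℤ,
          A = C.shift t ∨ A = (C.sw s).shift t ∨ A = (C.se s).shift t ∨
            A = (C.swse s).shift t) ∧
    (∀ (D : Word J) (hD : D.IsPeriodic) (V : Type u) [AddCommGroup V] [Module k V]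
      [Module k[T;T⁻¹] V] [IsScalarTower k k[T;T⁻¹] V] (n : ℤ),
        (InKPlusB (((HomotopyCategory.quotient _ _).obj (Word.bandComplex hD V))⟦n⟧) ↔
          FiniteDimensional k V)) := by
  refine ⟨fun A => ?_, fun D hD V _ _ _ _ n => ?_⟩
  · rw [inKPlusB_stringComplex_iff hJ s, ← Word.hasResolvingEnds_iff s]
    exact and_iff_right_of_imp fun hends hA => hA.not_hasResolvingEnds hends
  · rw [inKPlusB_shift_iff, inKPlusB_bandComplex_iff hJ hD V]

end GentleAlgebra

end

/-- Let `kQ / J` be a gentle algebra, with a choice of signs `s`. A string complex `P(A)` lies in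
`K^{+,b}(Λ-proj)` if and only if, up to a shift of the indexing of `A`, it is `P(C)`, `P(C(↙))`,
`P(C(↘))` or `P(C(↙↘))` for some finite generalised word `C`. A shift of a band complex `P(D,V)` lies
in `K^{+,b}(Λ-proj)` if and only if `V` is finite-dimensional over `k`. -/
theorem proposition3 {k : Type u} [Field k] {Q : Type u} [Quiver.{u} Q] [Fintype Q]
    (J : TwoSidedIdeal (PathAlgebra k Q)) (hJ : IsGentle J) (s : SignChoice J) :
    (∀ A : Word J,
      (A.IsAperiodic ∧ InKPlusB ((HomotopyCategory.quotient _ _).obj A.stringComplex)) ↔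
        ∃ C : Word J, C.IsFinite ∧ ∃ t : ℤ,
          A = C.shift t ∨ A = (C.sw s).shift t ∨ A = (C.se s).shift t ∨
            A = (C.swse s).shift t) ∧
    (∀ (D : Word J) (hD : D.IsPeriodic) (V : Type u) [AddCommGroup V] [Module k V]
      [Module k[T;T⁻¹] V] [IsScalarTower k k[T;T⁻¹] V],
      Indecomposable (ModuleCat.of k[T;T⁻¹] V) → ∀ n : ℤ,
        (InKPlusB (((HomotopyCategory.quotient _ _).obj (Word.bandComplex hD V))⟦n⟧) ↔
          FiniteDimensional k V)) := by
  obtain ⟨hstring, hband⟩ := proposition3_general hJ.generated s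
  exact ⟨hstring, fun D hD V _ _ _ _ _ n => hband D hD V n⟩
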